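/- Let $\Omega\subset\mathbb R^2$ be a bounded, connected Lipschitz domain, and let $\Gamma_{\rm D},\Gamma_{\rm N}$ be two relatively open, nonempty, disjoint subsets of $\partial\Omega$ such that $\partial\Omega\setminus(\Gamma_{\rm D}\cup\Gamma_{\rm N})$ has (one-dimensional) measure zero. Put $\Gamma=\Gamma_{\rm D}$. The Neumann Laplacian on $\Omega$ is the operator $u\mapsto-\Delta u$ in the complex space $L^2(\Omega)$ whose domain consists of all $u\in H^1(\Omega)$ with $\Delta u\in L^2(\Omega)$ in the sense of distributions and $\partial_\nu u|_{\partial\Omega}=0$. The mixed Laplacian $-\Delta_\Gamma$ is the operator $u\mapsto-\Delta u$ in $L^2(\Omega)$ whose domain consists of all $u\in H^1(\Omega)$ with trace $u|_{\Gamma}=0$, $\Delta u\in L^2(\Omega)$ and $\partial_\nu u|_{\Gamma_{\rm N}}=0$. Here $\partial_\nu u|_{\partial\Omega}$ is defined through Green's identity $$\int_\Omega\nabla u\cdot\overline{\nabla v}\,dx=-\int_\Omega\Delta u\,\overline v\,dx+(\partial_\nu u|_{\partial\Omega},v|_{\partial\Omega})_{\partial\Omega},\qquad v\in H^1(\Omega),$$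 and $\partial_\nu u|_{\Gamma_{\rm N}}=0$ means that $(\partial_\nu u|_{\partial\Omega},v|_{\partial\Omega})_{\partial\Omega}=0$ for all $v\in H^1(\Omega)$ with $v|_{\partial\Omega\setminus\overline{\Gamma_{\rm N}}}=0$. Assume that $\Gamma_{\rm N}$ is contained in a union of finitely or countably many line segments which are all parallel to one another. Then the eigenvalues of the Neumann Laplacian and those of $-\Delta_\Gamma$, counted with multiplicities, can each be arranged in an infinite nondecreasing sequence, $\mu_1\le\mu_2\le\cdots$ and $\lambda_1^\Gamma\le\lambda_2^\Gamma\le\cdots$ respectively, and $$\mu_{k+1}\le\lambda_k^\Gamma\qquad\text{for all }k\in\mathbb N=\{1,2,3,\dots\}.$$ -/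

import Mathlib

open MeasureTheory Set
open scoped ContDiff InnerProductSpace

noncomputable section

namespace MixedLaplacian

/-- The Euclidean plane. -/
abbrev Plane : Type := EuclideanSpace ℝ (Fin 2)

/-! ### Geometry -/

/-- A bounded, connected Lipschitz domain: a nonempty connected bounded open set which, near each
of its boundary points and up to an isometric change of coordinates, coincides with the region
below the graph of a Lipschitz function of one variable. -/
structure IsBoundedLipschitzDomain (Ω : Set Plane) : Prop where
  isOpen : IsOpen Ω
  isConnected : IsConnected Ω
  isBounded : Bornology.IsBounded Ω
  localGraph : ∀ p ∈ frontier Ω, ∃ W : Set Plane, IsOpen W ∧ p ∈ W ∧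
    ∃ (Φ : Plane ≃ₗᵢ[ℝ] Plane) (K : NNReal) (h : ℝ → ℝ), LipschitzWith K h ∧
      ∀ x ∈ W, (x ∈ Ω ↔ (Φ x) 1 < h ((Φ x) 0))

/-- `Γ` is a relatively open subset of the boundary of `Ω`. -/
def IsRelOpenInBoundary (Ω Γ : Set Plane) : Prop :=
  ∃ U : Set Plane, IsOpen U ∧ Γ = U ∩ frontier Ω

/-- Arc length (one-dimensional Hausdorff measure) on the boundary of `Ω`. -/
def boundaryMeasure (Ω : Set Plane) : Measure Plane :=
  (Measure.hausdorffMeasure 1 : Measure Plane).restrict (frontier Ω)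

/-- The boundary of `Ω` is split, up to a set of measure zero, into a Dirichlet part `ΓD` and a
Neumann part `ΓN`, which are relatively open, nonempty and disjoint. -/
structure IsBoundarySplitting (Ω ΓD ΓN : Set Plane) : Prop where
  relOpenD : IsRelOpenInBoundary Ω ΓD
  relOpenN : IsRelOpenInBoundary Ω ΓN
  nonemptyD : ΓD.Nonempty
  nonemptyN : ΓN.Nonempty
  disjoint : ΓD ∩ ΓN = ∅
  null : boundaryMeasure Ω (frontier Ω \ (ΓD ∪ ΓN)) = 0

/-- `Γ` is contained in a union of (finitely or countably many) line segments all of which are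
parallel to one common direction `e ≠ 0`. -/
def ContainedInParallelSegments (Γ : Set Plane) : Prop :=
  ∃ e : Plane, e ≠ 0 ∧ ∃ S : Set (Set Plane), S.Countable ∧
    (∀ s ∈ S, ∃ (p : Plane) (c : ℝ), s = segment ℝ p (p + c • e)) ∧ Γ ⊆ ⋃₀ S

/-! ### Function spaces -/

/-- The space `L²(Ω)` of complex-valued functions. -/
abbrev L2 (Ω : Set Plane) : Type := Lp ℂ 2 (volume.restrict Ω)

/-- The space `L²(∂Ω)` of complex-valued functions on the boundary. -/
abbrev L2Boundary (Ω : Set Plane) : Type := Lp ℂ 2 (boundaryMeasure Ω)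

/-- The classical partial derivative of `φ` in the `i`-th coordinate direction. -/
def partialDeriv (i : Fin 2) (φ : Plane → ℂ) (x : Plane) : ℂ :=
  fderiv ℝ φ x (EuclideanSpace.single i 1)

/-- Test functions: smooth functions with compact support in `Ω`. -/
structure IsTestFunction (Ω : Set Plane) (φ : Plane → ℂ) : Prop where
  contDiff : ContDiff ℝ ∞ φ
  hasCompactSupport : HasCompactSupport φ
  tsupport_subset : tsupport φ ⊆ Ω

theorem integrable_mul_of_compactSupport {Ω : Set Plane} {ψ : Plane → ℂ} (hc : Continuous ψ)
    (hs : HasCompactSupport ψ) (u : L2 Ω) :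
    Integrable (fun x => ψ x * u x) (volume.restrict Ω) :=
  MemLp.integrable_mul (p := 2) (q := 2) (hc.memLp_of_hasCompactSupport hs) (Lp.memLp u)

theorem integral_mul_add {Ω : Set Plane} {ψ : Plane → ℂ} (hc : Continuous ψ)
    (hs : HasCompactSupport ψ) (u v : L2 Ω) :
    ∫ x in Ω, ψ x * (u + v : L2 Ω) x = (∫ x in Ω, ψ x * u x) + ∫ x in Ω, ψ x * v x := by
  rw [← integral_add (integrable_mul_of_compactSupport hc hs u)
    (integrable_mul_of_compactSupport hc hs v)]
  apply integral_congr_ae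
  filter_upwards [Lp.coeFn_add u v] with x hx
  rw [hx, Pi.add_apply, mul_add]

theorem integral_mul_smul {Ω : Set Plane} (ψ : Plane → ℂ) (c : ℂ) (u : L2 Ω) :
    ∫ x in Ω, ψ x * (c • u : L2 Ω) x = c * ∫ x in Ω, ψ x * u x := by
  rw [← integral_const_mul]
  apply integral_congr_ae
  filter_upwards [Lp.coeFn_smul c u] with x hx
  rw [hx, Pi.smul_apply, smul_eq_mul]
  ring

theorem integral_mul_zero {Ω : Set Plane} (ψ : Plane → ℂ) :
    ∫ x in Ω, ψ x * (0 : L2 Ω) x = 0 := by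
  simpa using integral_mul_smul ψ 0 (0 : L2 Ω)

theorem IsTestFunction.continuous_partialDeriv {Ω : Set Plane} {φ : Plane → ℂ}
    (h : IsTestFunction Ω φ) (i : Fin 2) : Continuous (partialDeriv i φ) :=
  (h.contDiff.continuous_fderiv (by simp)).clm_apply continuous_const

theorem IsTestFunction.hasCompactSupport_partialDeriv {Ω : Set Plane} {φ : Plane → ℂ}
    (h : IsTestFunction Ω φ) (i : Fin 2) : HasCompactSupport (partialDeriv i φ) :=
  h.hasCompactSupport.fderiv_apply (𝕜 := ℝ) _

theorem IsTestFunction.continuous_laplacian {Ω : Set Plane} {φ : Plane → ℂ}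
    (h : IsTestFunction Ω φ) : Continuous (Laplacian.laplacian φ) := by
  rw [InnerProductSpace.laplacian_eq_iteratedFDeriv_stdOrthonormalBasis]
  have hc := h.contDiff.continuous_iteratedFDeriv (m := 2) (WithTop.coe_le_coe.mpr (le_top : (2 : ℕ∞) ≤ ⊤))
  fun_prop

theorem IsTestFunction.hasCompactSupport_laplacian {Ω : Set Plane} {φ : Plane → ℂ}
    (h : IsTestFunction Ω φ) : HasCompactSupport (Laplacian.laplacian φ) := by
  refine (h.hasCompactSupport.iteratedFDeriv (𝕜 := ℝ) 2).mono fun x hx => ?_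
  rw [Function.mem_support] at hx ⊢
  intro h0
  apply hx
  rw [InnerProductSpace.laplacian_eq_iteratedFDeriv_stdOrthonormalBasis]
  simp [h0]

/-- The Sobolev space `H¹(Ω)`, as the set of all pairs `(u, ∇u)` in which `u` lies in `L²(Ω)` and
`∇u`, the gradient of `u` in the weak sense, has components in `L²(Ω)`. (The second entry is
determined by the first.) -/
def sobolevH1 (Ω : Set Plane) : Submodule ℂ (L2 Ω × (Fin 2 → L2 Ω)) where
  carrier := {p | ∀ φ : Plane → ℂ, IsTestFunction Ω φ → ∀ i : Fin 2,
    ∫ x in Ω, partialDeriv i φ x * p.1 x = -∫ x in Ω, φ x * p.2 i x}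
  add_mem' := by
    intro p q hp hq φ hφ i
    rw [Prod.fst_add, Prod.snd_add, Pi.add_apply,
      integral_mul_add (hφ.continuous_partialDeriv i) (hφ.hasCompactSupport_partialDeriv i),
      integral_mul_add hφ.contDiff.continuous hφ.hasCompactSupport, hp φ hφ i, hq φ hφ i]
    ring
  zero_mem' := by
    intro φ _ i
    rw [Prod.fst_zero, Prod.snd_zero, Pi.zero_apply, integral_mul_zero, integral_mul_zero, neg_zero]
  smul_mem' := by
    intro c p hp φ hφ i
    rw [Prod.smul_fst, Prod.smul_snd, Pi.smul_apply, integral_mul_smul, integral_mul_smul,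
      hp φ hφ i]
    ring

/-- The pairs `(u, f)` in `L²(Ω) × L²(Ω)` with `-Δ u = f` in the sense of distributions. -/
def weakLaplaceGraph (Ω : Set Plane) : Submodule ℂ (L2 Ω × L2 Ω) where
  carrier := {p | ∀ φ : Plane → ℂ, IsTestFunction Ω φ →
    ∫ x in Ω, Laplacian.laplacian φ x * p.1 x = -∫ x in Ω, φ x * p.2 x}
  add_mem' := by
    intro p q hp hq φ hφ
    rw [Prod.fst_add, Prod.snd_add,
      integral_mul_add hφ.continuous_laplacian hφ.hasCompactSupport_laplacian,
      integral_mul_add hφ.contDiff.continuous hφ.hasCompactSupport, hp φ hφ, hq φ hφ]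
    ring
  zero_mem' := by
    intro φ _
    rw [Prod.fst_zero, Prod.snd_zero, integral_mul_zero, integral_mul_zero, neg_zero]
  smul_mem' := by
    intro c p hp φ hφ
    rw [Prod.smul_fst, Prod.smul_snd, integral_mul_smul, integral_mul_smul, hp φ hφ]
    ring

/-- The triples `(φ, ∇φ, φ|_{∂Ω})` for smooth functions `φ` on the closure of `Ω`, more precisely
for restrictions of compactly supported smooth functions on the whole plane. -/
def smoothTraceGraph (Ω : Set Plane) :
    Submodule ℂ ((L2 Ω × (Fin 2 → L2 Ω)) × L2Boundary Ω) where
  carrier := {w | ∃ φ : Plane → ℂ, ContDiff ℝ ∞ φ ∧ HasCompactSupport φ ∧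
    w.1.1 =ᵐ[volume.restrict Ω] φ ∧
    (∀ i, w.1.2 i =ᵐ[volume.restrict Ω] partialDeriv i φ) ∧
    w.2 =ᵐ[boundaryMeasure Ω] φ}
  add_mem' := by
    rintro a b ⟨φ, h1, h2, h3, h4, h5⟩ ⟨ψ, k1, k2, k3, k4, k5⟩
    refine ⟨φ + ψ, h1.add k1, h2.add k2, (Lp.coeFn_add _ _).trans (h3.add k3), fun i => ?_,
      (Lp.coeFn_add _ _).trans (h5.add k5)⟩
    refine (Lp.coeFn_add _ _).trans (((h4 i).add (k4 i)).trans (Filter.Eventually.of_forall ?_))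
    intro x
    simp only [partialDeriv, Pi.add_apply]
    rw [fderiv_add (h1.differentiable (by simp) x) (k1.differentiable (by simp) x)]
    rfl
  zero_mem' := by
    refine ⟨0, contDiff_const, HasCompactSupport.zero, Lp.coeFn_zero _ _ _, fun i => ?_,
      Lp.coeFn_zero _ _ _⟩
    refine (Lp.coeFn_zero _ _ _).trans (Filter.Eventually.of_forall ?_)
    intro x
    simp [partialDeriv]
  smul_mem' := by
    rintro c a ⟨φ, h1, h2, h3, h4, h5⟩
    refine ⟨c • φ, h1.const_smul c, h2.mono (Function.support_const_smul_subset c φ),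
      (Lp.coeFn_smul _ _).trans (h3.const_smul c), fun i => ?_,
      (Lp.coeFn_smul _ _).trans (h5.const_smul c)⟩
    refine (Lp.coeFn_smul _ _).trans (((h4 i).const_smul c).trans (Filter.Eventually.of_forall ?_))
    intro x
    simp only [partialDeriv, Pi.smul_apply]
    rw [fderiv_const_smul (h1.differentiable (by simp) x)]
    rfl

/-- The graph of the trace operator `H¹(Ω) → L²(∂Ω)`, that is, of the continuous extension of the
restriction map `φ ↦ φ|_{∂Ω}` from smooth functions to `H¹(Ω)`: it consists of all triples
`((u, ∇u), τ)` for which smooth functions converge to `u` in `H¹(Ω)` and their restrictions to the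
boundary converge to `τ` in `L²(∂Ω)`. -/
def traceGraph (Ω : Set Plane) : Submodule ℂ ((L2 Ω × (Fin 2 → L2 Ω)) × L2Boundary Ω) :=
  (smoothTraceGraph Ω).topologicalClosure

/-- The space of all `u` in `H¹(Ω)` whose trace vanishes (almost everywhere) on `Γ ⊆ ∂Ω`. -/
def sobolevH1ZeroOn (Ω Γ : Set Plane) : Submodule ℂ (L2 Ω × (Fin 2 → L2 Ω)) where
  carrier := {p | p ∈ sobolevH1 Ω ∧ ∃ τ : L2Boundary Ω, (p, τ) ∈ traceGraph Ω ∧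
    ∀ᵐ x ∂(boundaryMeasure Ω), x ∈ Γ → τ x = 0}
  add_mem' := by
    rintro p q ⟨hp, τ, hτ, h0⟩ ⟨hq, σ, hσ, k0⟩
    refine ⟨add_mem hp hq, τ + σ, add_mem hτ hσ, ?_⟩
    filter_upwards [h0, k0, Lp.coeFn_add τ σ] with x h k hx hΓ
    rw [hx, Pi.add_apply, h hΓ, k hΓ, add_zero]
  zero_mem' := by
    refine ⟨zero_mem _, 0, zero_mem _, ?_⟩
    filter_upwards [Lp.coeFn_zero ℂ 2 (boundaryMeasure Ω)] with x hx _
    rw [hx, Pi.zero_apply]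
  smul_mem' := by
    rintro c p ⟨hp, τ, hτ, h0⟩
    refine ⟨Submodule.smul_mem _ c hp, c • τ, Submodule.smul_mem _ c hτ, ?_⟩
    filter_upwards [h0, Lp.coeFn_smul c τ] with x h hx hΓ
    rw [hx, Pi.smul_apply, h hΓ, smul_zero]

/-! ### Operators and eigenvalues -/

/-- For `p = (u, ∇u)`, for `f = -Δ u` and for `q = (v, ∇v)`, this is the duality pairing
`(∂_ν u|_{∂Ω}, v|_{∂Ω})` of the normal derivative of `u` with the trace of `v`, as defined through
Green's identity: `∫_Ω ∇u · conj ∇v + ∫_Ω Δu conj v`. (Mathlib's inner product is conjugate linear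
in its first argument.) -/
def normalDerivPairing {Ω : Set Plane} (p : L2 Ω × (Fin 2 → L2 Ω)) (f : L2 Ω)
    (q : L2 Ω × (Fin 2 → L2 Ω)) : ℂ :=
  (∑ i : Fin 2, inner ℂ (q.2 i) (p.2 i)) - inner ℂ q.1 f

/-- The graph of a realization of the negative Laplacian in `L²(Ω)`: the pairs `(u, f)` such that
`u` lies in the space `V ⊆ H¹(Ω)`, such that `-Δ u = f` lies in `L²(Ω)` in the sense of
distributions, and such that the normal derivative of `u` annihilates the traces of all functions
in the space `W ⊆ H¹(Ω)`. -/
def laplaceOperator (Ω : Set Plane) (V W : Submodule ℂ (L2 Ω × (Fin 2 → L2 Ω))) :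
    Submodule ℂ (L2 Ω × L2 Ω) where
  carrier := {a | a ∈ weakLaplaceGraph Ω ∧ ∃ g : Fin 2 → L2 Ω, (a.1, g) ∈ V ∧
    ∀ q ∈ W, normalDerivPairing (a.1, g) a.2 q = 0}
  add_mem' := by
    rintro a b ⟨ha, g, hg, h0⟩ ⟨hb, k, hk, k0⟩
    refine ⟨add_mem ha hb, g + k, add_mem hg hk, fun q hq => ?_⟩
    have h1 := h0 q hq
    have h2 := k0 q hq
    simp only [normalDerivPairing, Prod.snd_add, Pi.add_apply, inner_add_right,
      Finset.sum_add_distrib] at h1 h2 ⊢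
    linear_combination h1 + h2
  zero_mem' := by
    refine ⟨zero_mem _, 0, zero_mem _, fun q _ => ?_⟩
    simp [normalDerivPairing]
  smul_mem' := by
    rintro c a ⟨ha, g, hg, h0⟩
    refine ⟨Submodule.smul_mem _ c ha, c • g, Submodule.smul_mem _ c hg, fun q hq => ?_⟩
    have h1 := h0 q hq
    simp only [normalDerivPairing, Prod.smul_snd, Pi.smul_apply, inner_smul_right,
      ← Finset.mul_sum] at h1 ⊢
    linear_combination c * h1

/-- The graph of the Neumann Laplacian on `Ω`: the negative Laplacian on functions `u` in `H¹(Ω)`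
with `∂_ν u|_{∂Ω} = 0`. -/
def neumannLaplacian (Ω : Set Plane) : Submodule ℂ (L2 Ω × L2 Ω) :=
  laplaceOperator Ω (sobolevH1 Ω) (sobolevH1 Ω)

/-- The graph of the mixed Laplacian on `Ω`: the negative Laplacian on functions `u` in `H¹(Ω)`
with `u|_{ΓD} = 0` and `∂_ν u|_{ΓN} = 0`. The latter condition means that the normal derivative of
`u` annihilates the traces of all `v` in `H¹(Ω)` which vanish on `∂Ω` off the closure of `ΓN`. -/
def mixedLaplacian (Ω ΓD ΓN : Set Plane) : Submodule ℂ (L2 Ω × L2 Ω) :=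
  laplaceOperator Ω (sobolevH1ZeroOn Ω ΓD) (sobolevH1ZeroOn Ω (frontier Ω \ closure ΓN))

/-- The eigenspace, for the real number `t`, of the operator in `L²(Ω)` whose graph is `A`. -/
def eigenspace {Ω : Set Plane} (A : Submodule ℂ (L2 Ω × L2 Ω)) (t : ℝ) : Submodule ℂ (L2 Ω) :=
  A.comap (LinearMap.prod LinearMap.id ((t : ℂ) • LinearMap.id))

/-- `s 0 ≤ s 1 ≤ s 2 ≤ ⋯` is the sequence of all (real) eigenvalues of the operator with graph `A`,
ordered nondecreasingly and counted with multiplicities: each real number `t` occurs in the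
sequence as often as the dimension of its eigenspace says. -/
def IsEigenvalueSequence {Ω : Set Plane} (A : Submodule ℂ (L2 Ω × L2 Ω)) (s : ℕ → ℝ) : Prop :=
  Monotone s ∧ ∀ t : ℝ, Module.rank ℂ (eigenspace A t) = Cardinal.mk {k : ℕ // s k = t}

end MixedLaplacian

end

/-! Both operators come from the form `∫ ∇u · conj ∇v`, taken on all of `H¹(Ω)` for the Neumann
problem and on the functions with zero trace on `ΓD` for the mixed one. If `J` is the inclusion of
the form domain into `L²(Ω)` and the domain carries the `H¹` inner product, then `-Δ x = t x` reads
`⟪q, x⟫ = (t + 1) ⟪J q, J x⟫` for all `q`; this is `formEig`, and the shift by one comes from the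
`L²` part of the `H¹` norm.

Fix `k` and let `t` be the `k`-th mixed eigenvalue. By min-max it suffices to find a space of
dimension `k + 1` (counting from one) on which the energy is at most `t` times the squared `L²`
norm. The first `k` mixed eigenfunctions span a space of dimension `k`; the extra function is the
plane wave `v = exp(i √t e·x)`, where the unit vector `e` is parallel to the segments containing
`ΓN`. Three facts make it work. Pointwise `|∇v|² = t |v|²`. The wave vanishes nowhere, so it is not
in the mixed form domain and the dimension grows. For `u` in the mixed domain, integrating the
derivative of `u · conj v` along `e` over `Ω` gives zero: on `ΓD` the trace of `u` vanishes, and on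
`ΓN` the direction `e` is tangential. Hence the cross terms between `u` and `v` in the energy are
exactly `t` times those in `L²`. The abstract comparison is `IsFormEigSeq.le_of_trial`, the trial
function is `exists_trial_function`.

The integration by parts uses no normal vector. In `norm_setIntegral_fderiv_le` the domain is cut
into lines parallel to `e`. By an inequality of Eilenberg type (`exists_slice_bound`) almost every
line meets the boundary in finitely many points, and almost every line misses `ΓN`, whose projection
along `e` is countable. The resulting bound involves only boundary values off `ΓN` and passes to
limits in the trace graph.

Discreteness of the spectra rests on two facts about Lipschitz domains: compactness of `H¹(Ω)` in
`L²(Ω)` (`isCompactOperator_pairFst_comp`), obtained by mollifying along inward shifts instead of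
extending functions, and the trace inequality (`exists_trace_inequality`), which makes the mixed
form domain closed. -/

noncomputable section

namespace MixedLaplacian

/-! ### Compact forms on Hilbert spaces -/

section FormEigen

variable {H L : Type*} [NormedAddCommGroup H] [InnerProductSpace ℂ H]
  [NormedAddCommGroup L] [InnerProductSpace ℂ L]

/-- The solutions `x` of `⟪q, x⟫ = (t + 1) ⟪J q, J x⟫` for all `q`. -/
def formEig (J : H →L[ℂ] L) (t : ℝ) : Submodule ℂ H where
  carrier := {x | ∀ q, inner ℂ q x = ((t : ℂ) + 1) * inner ℂ (J q) (J x)}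
  add_mem' := by
    intro x y hx hy q
    simp only [mem_ofPred_eq] at hx hy
    rw [inner_add_right, hx, hy, map_add, inner_add_right]
    ring
  zero_mem' := by simp
  smul_mem' := by
    intro c x hx q
    simp only [mem_ofPred_eq] at hx
    rw [inner_smul_right, hx, map_smul, inner_smul_right]
    ring

theorem norm_sq_of_mem_formEig {J : H →L[ℂ] L} {t : ℝ} {x : H} (hx : x ∈ formEig J t) :
    ‖x‖ ^ 2 = (t + 1) * ‖J x‖ ^ 2 := by
  have h := hx x
  rw [inner_self_eq_norm_sq_to_K, inner_self_eq_norm_sq_to_K] at h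
  apply Complex.ofReal_injective
  push_cast
  exact h

theorem inner_map_eq_zero_of_mem_formEig {J : H →L[ℂ] L} {s t : ℝ} (hst : s ≠ t) {x y : H}
    (hx : x ∈ formEig J s) (hy : y ∈ formEig J t) : inner ℂ (J x) (J y) = 0 := by
  have h1 := hy x
  have h2 := congrArg (starRingEnd ℂ) (hx y)
  rw [map_mul, inner_conj_symm, inner_conj_symm, map_add, Complex.conj_ofReal, map_one] at h2
  have h3 : ((s : ℂ) - t) * inner ℂ (J x) (J y) = 0 := by linear_combination h1 - h2
  rcases mul_eq_zero.mp h3 with h | h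
  · exact absurd (by exact_mod_cast sub_eq_zero.mp h) hst
  · exact h

theorem inner_eq_zero_of_mem_formEig {J : H →L[ℂ] L} {s t : ℝ} (hst : s ≠ t) {x y : H}
    (hx : x ∈ formEig J s) (hy : y ∈ formEig J t) : inner ℂ x y = 0 := by
  rw [hy x, inner_map_eq_zero_of_mem_formEig hst hx hy, mul_zero]

theorem orthogonalFamily_formEig (J : H →L[ℂ] L) :
    OrthogonalFamily ℂ (fun t => formEig J t) fun t => (formEig J t).subtypeₗᵢ :=
  OrthogonalFamily.of_pairwise fun _ _ hst => Submodule.isOrtho_iff_inner_eq.mpr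
    fun _ hx _ hy => inner_eq_zero_of_mem_formEig hst hx hy

theorem norm_sum_sq_of_inner_eq_zero {ι : Type*} (s : Finset ι) (f : ι → H)
    (h : ∀ i j, i ≠ j → inner ℂ (f i) (f j) = 0) : ‖∑ i ∈ s, f i‖ ^ 2 = ∑ i ∈ s, ‖f i‖ ^ 2 := by
  classical
  induction s using Finset.induction_on with
  | empty => simp
  | insert a s ha ih =>
    rw [Finset.sum_insert ha, Finset.sum_insert ha, norm_add_sq (𝕜 := ℂ), inner_sum,
      Finset.sum_eq_zero (fun i hi => h a i (by rintro rfl; exact ha hi)), ih]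
    simp

/-- The span of the eigenvectors with eigenvalue at most `T`. -/
def spectralSubspace (J : H →L[ℂ] L) (T : ℝ) : Submodule ℂ H :=
  ⨆ t : Iic T, formEig J t

theorem formEig_le_spectralSubspace (J : H →L[ℂ] L) {t T : ℝ} (h : t ≤ T) :
    formEig J t ≤ spectralSubspace J T :=
  le_iSup (fun t : Iic T => formEig J t) ⟨t, h⟩

/-- Eigenvectors for different eigenvalues are orthogonal in `H`, and so are their images under `J`.
Pythagoras for both norms reduces the bound to a single eigenvector. -/
theorem norm_sq_le_of_mem_spectralSubspace {J : H →L[ℂ] L} {T : ℝ} {x : H}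
    (hx : x ∈ spectralSubspace J T) : ‖x‖ ^ 2 ≤ (T + 1) * ‖J x‖ ^ 2 := by
  classical
  obtain ⟨f, hf, rfl⟩ := (Submodule.mem_iSup_iff_exists_finsupp _ _).mp hx
  rw [Finsupp.sum, map_sum, norm_sum_sq_of_inner_eq_zero, norm_sum_sq_of_inner_eq_zero,
    Finset.mul_sum]
  · refine Finset.sum_le_sum fun i _ => ?_
    rw [norm_sq_of_mem_formEig (hf i)]
    have := i.2
    simp only [mem_Iic] at this
    gcongr
  · intro i j hij
    exact inner_map_eq_zero_of_mem_formEig (fun h => hij (Subtype.ext h)) (hf i) (hf j)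
  · intro i j hij
    exact inner_eq_zero_of_mem_formEig (fun h => hij (Subtype.ext h)) (hf i) (hf j)

/-- On the closure of `W` the compact operator is bounded below, hence a closed embedding. The
preimage of a compact set is then a compact neighbourhood of zero, and a locally compact normed
space is finite dimensional. -/
theorem finiteDimensional_of_isCompactOperator [CompleteSpace H] {J : H →L[ℂ] L}
    (hJ : IsCompactOperator J) (W : Submodule ℂ H) (C : NNReal) (hC : ∀ x ∈ W, ‖x‖ ≤ C * ‖J x‖) :
    FiniteDimensional ℂ W := by
  have hC' : ∀ x ∈ W.topologicalClosure, ‖x‖ ≤ C * ‖J x‖ := by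
    have hcl : IsClosed {x : H | ‖x‖ ≤ C * ‖J x‖} :=
      isClosed_le continuous_norm (by fun_prop)
    exact fun x hx => closure_minimal hC hcl hx
  have : CompleteSpace W.topologicalClosure :=
    W.isClosed_topologicalClosure.completeSpace_coe
  let J' : W.topologicalClosure →L[ℂ] L := J ∘L W.topologicalClosure.subtypeL
  have hJ' : AntilipschitzWith C J' :=
    J'.antilipschitz_of_bound fun x => hC' x x.2
  have hemb : Topology.IsClosedEmbedding J' := hJ'.isClosedEmbedding J'.uniformContinuous
  obtain ⟨K, hK, hKJ⟩ := hJ.comp_clm W.topologicalClosure.subtypeL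
  have hcomp : IsCompact (J' ⁻¹' K) := hemb.isCompact_preimage hK
  have : LocallyCompactSpace W.topologicalClosure :=
    hcomp.locallyCompactSpace_of_mem_nhds_of_addGroup hKJ
  have : FiniteDimensional ℂ W.topologicalClosure := FiniteDimensional.of_locallyCompactSpace ℂ
  exact Submodule.finiteDimensional_of_le W.le_topologicalClosure

theorem finiteDimensional_spectralSubspace [CompleteSpace H] {J : H →L[ℂ] L}
    (hJ : IsCompactOperator J) (T : ℝ) : FiniteDimensional ℂ (spectralSubspace J T) := by
  refine finiteDimensional_of_isCompactOperator hJ _ (Real.toNNReal (Real.sqrt (T + 1)))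
    fun x hx => ?_
  have h := norm_sq_le_of_mem_spectralSubspace hx
  rw [Real.coe_toNNReal _ (Real.sqrt_nonneg _)]
  rcases le_or_gt 0 (T + 1) with h0 | h0
  · refine abs_le_of_sq_le_sq' ?_ (by positivity) |>.2
    rw [mul_pow, Real.sq_sqrt h0]
    exact h
  · have h1 : ‖x‖ ^ 2 ≤ 0 := h.trans (mul_nonpos_of_nonpos_of_nonneg h0.le (by positivity))
    have h2 : ‖x‖ = 0 := by nlinarith [norm_nonneg x]
    rw [h2]
    positivity

theorem finiteDimensional_formEig [CompleteSpace H] {J : H →L[ℂ] L}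
    (hJ : IsCompactOperator J) (t : ℝ) : FiniteDimensional ℂ (formEig J t) := by
  have := finiteDimensional_spectralSubspace hJ t
  exact Submodule.finiteDimensional_of_le (formEig_le_spectralSubspace J le_rfl)

/-- Each real number `t` occurs in the nondecreasing sequence `s` as often as the dimension of
`formEig J t` says. -/
def IsFormEigSeq (J : H →L[ℂ] L) (s : ℕ → ℝ) : Prop :=
  Monotone s ∧ ∀ t : ℝ, Module.rank ℂ (formEig J t) = Cardinal.lift (Cardinal.mk {k : ℕ // s k = t})

/-- The multiplicity condition lets the indices `k` with `s k = t` label an orthonormal basis of the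
eigenspace at `t`; orthogonality of different eigenspaces makes the union of these bases
orthonormal. -/
theorem IsFormEigSeq.exists_orthonormal [CompleteSpace H] {J : H →L[ℂ] L}
    (hJ : IsCompactOperator J) {s : ℕ → ℝ} (hs : IsFormEigSeq J s) :
    ∃ x : ℕ → H, Orthonormal ℂ x ∧ (∀ k, x k ∈ formEig J (s k)) ∧
      ∀ T, spectralSubspace J T ≤ Submodule.span ℂ (x '' {k | s k ≤ T}) := by
  classical
  have hfd := finiteDimensional_formEig hJ
  have hfin : ∀ t, Finite {k : ℕ // s k = t} := fun t => by
    have h1 : Module.rank ℂ (formEig J t) < Cardinal.aleph0 := Module.rank_lt_aleph0 ℂ _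
    rw [hs.2 t, Cardinal.lift_lt_aleph0] at h1
    exact Cardinal.lt_aleph0_iff_finite.mp h1
  have hft : ∀ t, Fintype {k : ℕ // s k = t} := fun t => Fintype.ofFinite _
  have hcard : ∀ t, Module.finrank ℂ (formEig J t) = Fintype.card {k : ℕ // s k = t} := fun t => by
    rw [Module.finrank, hs.2 t, Cardinal.toNat_lift, Cardinal.mk_toNat_eq_card]
  let b : ∀ t, OrthonormalBasis {k : ℕ // s k = t} ℂ (formEig J t) := fun t =>
    (stdOrthonormalBasis ℂ (formEig J t)).reindex
      (Fintype.equivOfCardEq (by rw [Fintype.card_fin, hcard t]))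
  have h1 := (orthogonalFamily_formEig J).orthonormal_sigma_orthonormal
    (v_family := fun t => b t) fun t => (b t).orthonormal
  let e : ℕ → Σ t, {k : ℕ // s k = t} := fun k => ⟨s k, k, rfl⟩
  have he : Function.Injective e := fun k l h => by
    have := congrArg (fun p : Σ t, {k : ℕ // s k = t} => (p.2 : ℕ)) h
    exact this
  refine ⟨fun k => (b (s k) ⟨k, rfl⟩ : H), h1.comp e he, fun k => (b (s k) ⟨k, rfl⟩).2,
    fun T => iSup_le fun t x hx => ?_⟩
  have h2 := (b t).sum_repr ⟨x, hx⟩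
  have h3 := congrArg (fun y : formEig J t => (y : H)) h2
  simp only [Submodule.coe_sum, Submodule.coe_smul] at h3
  rw [← h3]
  refine Submodule.sum_mem _ fun i _ => Submodule.smul_mem _ _ (Submodule.subset_span ?_)
  obtain ⟨k, hk⟩ := i
  refine ⟨k, ?_, ?_⟩
  · rw [mem_ofPred_eq, hk]; exact t.2
  · have key : ∀ t' (h : s k = t'), (b (s k) ⟨k, rfl⟩ : H) = b t' ⟨k, h⟩ := by
      rintro _ rfl
      rfl
    exact key _ hk

/-! ### The Gram operator and the gap above a spectral subspace -/

section Adjoint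

variable [CompleteSpace H] [CompleteSpace L]

/-- The operator `J† J`. -/
noncomputable def gram (J : H →L[ℂ] L) : H →L[ℂ] H := ContinuousLinearMap.adjoint J ∘L J

theorem inner_gram (J : H →L[ℂ] L) (x y : H) : inner ℂ x (gram J y) = inner ℂ (J x) (J y) := by
  rw [gram, ContinuousLinearMap.comp_apply, ContinuousLinearMap.adjoint_inner_right]

theorem gram_inner (J : H →L[ℂ] L) (x y : H) : inner ℂ (gram J x) y = inner ℂ (J x) (J y) := by
  rw [gram, ContinuousLinearMap.comp_apply, ContinuousLinearMap.adjoint_inner_left]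

theorem isSymmetric_gram (J : H →L[ℂ] L) : (gram J : H →ₗ[ℂ] H).IsSymmetric := fun x y => by
  rw [ContinuousLinearMap.coe_coe, inner_gram, gram_inner]

theorem isCompactOperator_gram {J : H →L[ℂ] L} (hJ : IsCompactOperator J) :
    IsCompactOperator (gram J) :=
  hJ.clm_comp (ContinuousLinearMap.adjoint J)

/-- Eigenvectors of `J† J` solve the form eigenvalue equation. -/
theorem mem_formEig_of_gram_eq {J : H →L[ℂ] L} (hinj : Function.Injective J) {c : ℂ} {x : H}
    (hx : gram J x = c • x) (hx0 : x ≠ 0) :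
    0 < c.re ∧ ‖J x‖ ^ 2 = c.re * ‖x‖ ^ 2 ∧ c = (c.re : ℂ) ∧ x ∈ formEig J (c.re⁻¹ - 1) := by
  have hJx : J x ≠ 0 := fun h => hx0 (hinj (by rw [h, map_zero]))
  have h1 := inner_gram J x x
  rw [hx, inner_smul_right, inner_self_eq_norm_sq_to_K, inner_self_eq_norm_sq_to_K] at h1
  have hxn : 0 < ‖x‖ ^ 2 := by positivity
  have hJn : 0 < ‖J x‖ ^ 2 := by positivity
  have hc : c = ((‖J x‖ ^ 2 / ‖x‖ ^ 2 : ℝ) : ℂ) := by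
    push_cast
    rw [eq_div_iff (by exact_mod_cast hxn.ne')]
    exact_mod_cast h1
  have hre : c.re = ‖J x‖ ^ 2 / ‖x‖ ^ 2 := by rw [hc, Complex.ofReal_re]
  have hpos : 0 < c.re := by rw [hre]; positivity
  refine ⟨hpos, by rw [hre]; field_simp, by rw [hre]; exact hc, fun q => ?_⟩
  rw [← inner_gram, hx, inner_smul_right]
  have hcc : c = (c.re : ℂ) := by rw [hre]; exact hc
  have hc0 : (c.re : ℂ) ≠ 0 := by exact_mod_cast hpos.ne'
  push_cast
  rw [sub_add_cancel, ← mul_assoc]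
  nth_rewrite 2 [hcc]
  rw [inv_mul_cancel₀ hc0, one_mul]

/-- The orthogonal complement of the spectral subspace is invariant under the compact symmetric
operator `J† J`. The norm of the restriction is the absolute value of a spectral point. If that
point is nonzero, it belongs to an eigenvector in the complement, whose form eigenvalue must exceed
`T`. The inequality is strict because the norm is attained in this way. -/
theorem norm_sq_lt_of_mem_orthogonal {J : H →L[ℂ] L} (hJ : IsCompactOperator J)
    (hinj : Function.Injective J) {T : ℝ} (hT : 0 < T + 1) {x : H} (hx0 : x ≠ 0)
    (hx : x ∈ (spectralSubspace J T)ᗮ) : (T + 1) * ‖J x‖ ^ 2 < ‖x‖ ^ 2 := by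
  set M := (spectralSubspace J T)ᗮ with hM
  have hinv : ∀ y ∈ M, gram J y ∈ M := by
    intro y hy
    rw [hM, Submodule.mem_orthogonal] at hy ⊢
    intro u hu
    rw [← ContinuousLinearMap.coe_coe, ← isSymmetric_gram J]
    refine hy _ ?_
    induction hu using Submodule.iSup_induction' with
    | mem t u hu =>
      have h0 : ((t : ℂ) + 1) • gram J u = u := by
        refine ext_inner_left ℂ fun q => ?_
        rw [inner_smul_right, inner_gram, hu q]
      -- At `t = -1` the eigenvalue equation forces `u = 0`, and there is nothing to divide by.
      by_cases ht : ((t : ℂ) + 1) = 0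
      · rw [ht, zero_smul] at h0
        rw [← h0, map_zero]
        exact zero_mem _
      · have : gram J u = ((t : ℂ) + 1)⁻¹ • u := by
          conv_rhs => rw [← h0]
          rw [smul_smul, inv_mul_cancel₀ ht, one_smul]
        rw [ContinuousLinearMap.coe_coe, this]
        exact Submodule.smul_mem _ _ (formEig_le_spectralSubspace J t.2 hu)
    | zero => simp
    | add u v _ _ hu hv =>
      rw [map_add]
      exact add_mem hu hv
  let S : M →L[ℂ] M := (gram J).restrict hinv
  have hSc : IsCompactOperator S := (isCompactOperator_gram hJ).restrict' hinv
  have hSs : (S : M →ₗ[ℂ] M).IsSymmetric := (isSymmetric_gram J).restrict_invariant hinv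
  have : Nontrivial M := ⟨⟨⟨x, hx⟩, 0, fun h => hx0 (congrArg Subtype.val h)⟩⟩
  -- For a self-adjoint operator the spectral radius equals the norm; a spectral point of maximal
  -- modulus exists because the space is nontrivial, as it contains `x`.
  obtain ⟨c, hc, hcS⟩ := spectrum.exists_nnnorm_eq_spectralRadius S
  rw [S.spectralRadius_eq_nnnorm hSs.isSelfAdjoint] at hcS
  have hcn : ‖c‖ = ‖S‖ := by
    have : ‖c‖₊ = ‖S‖₊ := by exact_mod_cast hcS
    exact congrArg NNReal.toReal this
  have hJx : ‖J x‖ ^ 2 ≤ ‖S‖ * ‖x‖ ^ 2 := by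
    have h1 : ‖J x‖ ^ 2 = ‖inner ℂ (⟨x, hx⟩ : M) (S ⟨x, hx⟩)‖ := by
      have h2 : inner ℂ (⟨x, hx⟩ : M) (S ⟨x, hx⟩) = inner ℂ x (gram J x) := rfl
      rw [h2, inner_gram, inner_self_eq_norm_sq_to_K]
      simp
    rw [h1]
    refine (norm_inner_le_norm _ _).trans ?_
    have h3 := S.le_opNorm ⟨x, hx⟩
    have h4 : ‖(⟨x, hx⟩ : M)‖ = ‖x‖ := rfl
    rw [h4] at h3 ⊢
    nlinarith [norm_nonneg x]
  have hxn : 0 < ‖x‖ ^ 2 := by positivity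
  by_cases hc0 : c = 0
  · rw [← hcn, hc0, norm_zero, zero_mul] at hJx
    nlinarith
  · obtain ⟨y, hy⟩ := ((hSc.hasEigenvalue_iff_mem_spectrum hc0).mpr hc).exists_hasEigenvector
    have hy1 : gram J (y : H) = c • (y : H) := congrArg Subtype.val hy.apply_eq_smul
    have hy0 : (y : H) ≠ 0 := fun h => hy.2 (Subtype.ext h)
    obtain ⟨h1, -, h3, h4⟩ := mem_formEig_of_gram_eq hinj hy1 hy0
    have hcr : ‖S‖ = c.re := by
      rw [← hcn, h3, Complex.norm_real, Real.norm_of_nonneg h1.le, Complex.ofReal_re]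
    -- Otherwise `y` would lie in the spectral subspace as well as in its complement.
    have h5 : T < c.re⁻¹ - 1 := by
      by_contra! h
      have h6 := (Submodule.mem_orthogonal _ _).mp y.2 _ (formEig_le_spectralSubspace J h h4)
      exact hy0 (inner_self_eq_zero.mp h6)
    rw [hcr] at hJx
    have h7 : (T + 1) * c.re < 1 := by
      have : T + 1 < c.re⁻¹ := by linarith
      calc (T + 1) * c.re < c.re⁻¹ * c.re := by gcongr
        _ = 1 := inv_mul_cancel₀ h1.ne'
    calc (T + 1) * ‖J x‖ ^ 2 ≤ (T + 1) * (c.re * ‖x‖ ^ 2) := by gcongr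
      _ = ((T + 1) * c.re) * ‖x‖ ^ 2 := by ring
      _ < 1 * ‖x‖ ^ 2 := by gcongr
      _ = ‖x‖ ^ 2 := one_mul _

end Adjoint

end FormEigen

/-- Multiplicities `d` with finite total on each half line `(-∞, T]` and unbounded support are
those of a nondecreasing sequence. -/
theorem exists_monotone_seq_of_multiplicity (d : ℝ → ℕ) (h1 : ∀ T, {t | t ≤ T ∧ d t ≠ 0}.Finite)
    (h2 : ∀ T, ∃ t, T < t ∧ d t ≠ 0) :
    ∃ s : ℕ → ℝ, Monotone s ∧ ∀ t, Nonempty (Fin (d t) ≃ {k : ℕ // s k = t}) := by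
  classical
  -- Each `t` is repeated `d t` times as the pairs `(t, n)` with `n < d t`, ordered
  -- lexicographically. Initial segments are finite and there is no maximum, so the order type is
  -- that of `ℕ`; the sequence is the first component read along the isomorphism.
  let I : Type := {p : ℝ ×ₗ ℕ // (ofLex p).2 < d (ofLex p).1}
  have hfin : ∀ a : I, (Iic a).Finite := by
    intro a
    set T := (ofLex a.1).1 with hT
    have hS : (⋃ t ∈ {t | t ≤ T ∧ d t ≠ 0}, (fun n : ℕ => (toLex (t, n) : ℝ ×ₗ ℕ)) ''
        (Iio (d t))).Finite :=
      (h1 T).biUnion fun t _ => (finite_Iio _).image _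
    refine Finite.of_finite_image (f := Subtype.val) (hS.subset ?_) Subtype.val_injective.injOn
    rintro _ ⟨⟨p, hp⟩, hpa, rfl⟩
    simp only [mem_iUnion]
    refine ⟨(ofLex p).1, ⟨?_, by omega⟩, (ofLex p).2, hp, rfl⟩
    have : p ≤ a.1 := hpa
    rcases (Prod.Lex.le_iff).mp this with h | h
    · exact h.le
    · exact h.1.le
  let mk : ∀ t, d t ≠ 0 → I := fun t h => ⟨toLex (t, 0), Nat.pos_of_ne_zero h⟩
  have : Nonempty I := let ⟨t, _, h⟩ := h2 0; ⟨mk t h⟩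
  have hbot : ∃ b : I, ∀ a, b ≤ a := by
    obtain ⟨a⟩ := this
    obtain ⟨b, hb, hmin⟩ := (hfin a).exists_minimal ⟨a, le_refl a⟩
    refine ⟨b, fun c => ?_⟩
    rcases le_total c b with h | h
    · exact hmin (le_trans h hb) h
    · exact h
  let : OrderBot I := { bot := hbot.choose, bot_le := hbot.choose_spec }
  let : LocallyFiniteOrder I := LocallyFiniteOrder.ofFiniteIcc fun a b =>
    (hfin b).subset Icc_subset_Iic_self
  let : SuccOrder I := LinearLocallyFiniteOrder.succOrder I
  let : PredOrder I := LinearLocallyFiniteOrder.predOrder I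
  have : NoMaxOrder I := ⟨fun a => by
    obtain ⟨t, ht, hd⟩ := h2 (ofLex a.1).1
    exact ⟨mk t hd, Subtype.mk_lt_mk.mpr (Prod.Lex.lt_iff.mpr (Or.inl ht))⟩⟩
  let e : I ≃o ℕ := orderIsoNatOfLinearSuccPredArch
  refine ⟨fun k => (ofLex (e.symm k).1).1, fun k l hkl => ?_, fun t => ⟨?_⟩⟩
  · have h : (e.symm k).1 ≤ (e.symm l).1 := e.symm.monotone hkl
    rcases (Prod.Lex.le_iff).mp h with h | h
    · exact h.le
    · exact h.1.le
  · exact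
    { toFun := fun i => ⟨e ⟨toLex (t, i), i.2⟩, by simp⟩
      invFun := fun k => ⟨(ofLex (e.symm k.1).1).2, by
        have := (e.symm k.1).2
        have hk : (ofLex (e.symm k.1).1).1 = t := k.2
        rwa [hk] at this⟩
      left_inv := fun i => by simp
      right_inv := fun k => by
        apply Subtype.ext
        obtain ⟨k, rfl⟩ := k
        exact e.apply_symm_apply k }

/-! ### Existence of the eigenvalue sequence and the comparison principle -/

section FormEigen

variable {H L : Type*} [NormedAddCommGroup H] [InnerProductSpace ℂ H]
  [NormedAddCommGroup L] [InnerProductSpace ℂ L] [CompleteSpace H]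

theorem finite_setOf_formEig_ne_bot {J : H →L[ℂ] L} (hJ : IsCompactOperator J) (T : ℝ) :
    {t | t ≤ T ∧ formEig J t ≠ ⊥}.Finite := by
  have hfd := finiteDimensional_spectralSubspace hJ T
  have hx : ∀ t : {t | t ≤ T ∧ formEig J t ≠ ⊥}, ∃ x ∈ formEig J t, x ≠ 0 := fun t =>
    (Submodule.ne_bot_iff _).mp t.2.2
  choose x hx hx0 using hx
  let y : {t | t ≤ T ∧ formEig J t ≠ ⊥} → spectralSubspace J T := fun t =>
    ⟨x t, formEig_le_spectralSubspace J t.2.1 (hx t)⟩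
  have hli : LinearIndependent ℂ y := by
    refine linearIndependent_of_ne_zero_of_inner_eq_zero
      (fun t h => hx0 t (congrArg Subtype.val h)) fun s t hst => ?_
    exact inner_eq_zero_of_mem_formEig (x := x s) (fun h => hst (Subtype.ext h)) (hx s) (hx t)
  have := hli.finite
  exact Set.toFinite _

variable [CompleteSpace L]

/-- Without eigenvalues above `T`, every eigenvector of `J† J` lies in the finite-dimensional
spectral subspace at `T`. By the spectral theorem for compact symmetric operators that subspace is
then everything. -/
theorem exists_formEig_ne_bot {J : H →L[ℂ] L} (hJ : IsCompactOperator J)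
    (hinj : Function.Injective J) (hinf : ¬ FiniteDimensional ℂ H) (T : ℝ) :
    ∃ t, T < t ∧ formEig J t ≠ ⊥ := by
  by_contra! hcon
  apply hinf
  have hfd := finiteDimensional_spectralSubspace hJ T
  have h1 := (gram J).orthogonalComplement_iSup_eigenspaces_eq_bot (isCompactOperator_gram hJ)
    (isSymmetric_gram J)
  have h2 : (⨆ c, Module.End.eigenspace (gram J : Module.End ℂ H) c) ≤ spectralSubspace J T := by
    refine iSup_le fun c x hx => ?_
    by_cases hx0 : x = 0
    · rw [hx0]; exact zero_mem _
    have h3 := (mem_formEig_of_gram_eq hinj (Module.End.mem_eigenspace_iff.mp hx) hx0).2.2.2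
    rcases le_or_gt (c.re⁻¹ - 1) T with h | h
    · exact formEig_le_spectralSubspace J h h3
    · rw [hcon _ h] at h3
      exact absurd h3 hx0
  have h4 : spectralSubspace J T = ⊤ := by
    rw [← Submodule.orthogonal_eq_bot_iff]
    exact le_bot_iff.mp ((Submodule.orthogonal_le h2).trans h1.le)
  rw [h4] at hfd
  exact Module.finite_def.mpr (Module.finite_def.mp (Module.Finite.equiv Submodule.topEquiv))

theorem exists_isFormEigSeq {J : H →L[ℂ] L} (hJ : IsCompactOperator J)
    (hinj : Function.Injective J) (hinf : ¬ FiniteDimensional ℂ H) :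
    ∃ s, IsFormEigSeq J s := by
  have hfd := finiteDimensional_formEig hJ
  have hne : ∀ t, Module.finrank ℂ (formEig J t) ≠ 0 ↔ formEig J t ≠ ⊥ := fun t => by
    rw [ne_eq, Submodule.finrank_eq_zero]
  obtain ⟨s, hs, hst⟩ := exists_monotone_seq_of_multiplicity
    (fun t => Module.finrank ℂ (formEig J t))
    (fun T => by simpa only [hne] using finite_setOf_formEig_ne_bot hJ T)
    (fun T => by simpa only [hne] using exists_formEig_ne_bot hJ hinj hinf T)
  refine ⟨s, hs, fun t => ?_⟩
  obtain ⟨e⟩ := hst t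
  rw [← Module.finrank_eq_rank, ← Cardinal.mk_congr e, Cardinal.mk_fin, Cardinal.lift_natCast]

/-- Min-max with one additional trial vector. Let `t = lam k`. If the conclusion failed, the
spectral subspace of the large form at `t` would have dimension at most `k + 1`, while `v` and the
first `k + 1` eigenvectors of the restricted form span dimension `k + 2`. Some nonzero `w` in that
span is then orthogonal to the spectral subspace, so `(t + 1) ‖J w‖² < ‖w‖²`. The hypotheses on `v`
give the opposite inequality on the whole span. -/
theorem IsFormEigSeq.le_of_trial {J : H →L[ℂ] L} (hJ : IsCompactOperator J)
    (hinj : Function.Injective J) (H' : Submodule ℂ H) [CompleteSpace H'] {μ lam : ℕ → ℝ}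
    (hμ : IsFormEigSeq J μ) (hlam : IsFormEigSeq (J ∘L H'.subtypeL) lam) (k : ℕ) {v : H}
    (hv : v ∉ H')
    (h1 : ∀ u ∈ H', inner ℂ u v = ((lam k : ℂ) + 1) * inner ℂ (J u) (J v))
    (h2 : ‖v‖ ^ 2 = (lam k + 1) * ‖J v‖ ^ 2) : μ (k + 1) ≤ lam k := by
  by_contra! hlt
  set t := lam k with ht
  have hJ' : IsCompactOperator (J ∘L H'.subtypeL) := hJ.comp_clm H'.subtypeL
  obtain ⟨x, hx, hxs, -⟩ := hlam.exists_orthonormal hJ'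
  obtain ⟨y, hy, -, hyW⟩ := hμ.exists_orthonormal hJ
  have ht0 : 0 < t + 1 := by
    have h := norm_sq_of_mem_formEig (hxs k)
    rw [hx.1 k] at h
    by_contra! hcon
    have := mul_nonpos_of_nonpos_of_nonneg hcon (sq_nonneg ‖(J ∘L H'.subtypeL) (x k)‖)
    linarith
  have hWfd := finiteDimensional_spectralSubspace hJ t
  -- Indexing from zero, only the `k + 1` indices `0, …, k` can carry an eigenvalue at most `t`.
  have hW : Module.finrank ℂ (spectralSubspace J t) ≤ k + 1 := by
    classical
    have hle : spectralSubspace J t ≤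
        Submodule.span ℂ ((Finset.range (k + 1)).image y : Set H) := by
      refine (hyW t).trans (Submodule.span_mono ?_)
      rintro _ ⟨l, hl, rfl⟩
      simp only [Finset.coe_image, Finset.coe_range]
      refine ⟨l, ?_, rfl⟩
      rw [mem_Iio]
      by_contra! hkl
      exact absurd (hμ.1 hkl) (not_le.mpr (lt_of_le_of_lt hl hlt))
    calc Module.finrank ℂ (spectralSubspace J t)
        ≤ Module.finrank ℂ (Submodule.span ℂ ((Finset.range (k + 1)).image y : Set H)) :=
          Submodule.finrank_mono hle
      _ ≤ ((Finset.range (k + 1)).image y).card := finrank_span_finset_le_card _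
      _ ≤ k + 1 := Finset.card_image_le.trans (Finset.card_range _).le
  let z : Fin (k + 2) → H := Fin.cons v fun i : Fin (k + 1) => (x i : H)
  have hz : LinearIndependent ℂ z := by
    refine linearIndependent_finCons.mpr ⟨?_, fun h => hv ?_⟩
    · have h3 := hx.linearIndependent.comp (fun i : Fin (k + 1) => (i : ℕ)) Fin.val_injective
      exact h3.map' H'.subtype H'.ker_subtype
    · refine Submodule.span_le.mpr ?_ h
      rintro _ ⟨i, rfl⟩
      exact (x i).2
  -- A nonzero coefficient vector in the kernel of this projection yields a trial vector orthogonal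
  -- to the spectral subspace; it exists because `k + 2 > k + 1`.
  let F : (Fin (k + 2) → ℂ) →ₗ[ℂ] spectralSubspace J t :=
    ((spectralSubspace J t).orthogonalProjectionOnto : H →ₗ[ℂ] spectralSubspace J t) ∘ₗ
      Fintype.linearCombination ℂ z
  have hker : LinearMap.ker F ≠ ⊥ := by
    apply LinearMap.ker_ne_bot_of_finrank_lt
    rw [Module.finrank_fin_fun]
    omega
  obtain ⟨c, hc, hc0⟩ := (Submodule.ne_bot_iff _).mp hker
  set w := Fintype.linearCombination ℂ z c with hw
  have hw0 : w ≠ 0 := fun h => hc0 (by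
    have := Fintype.linearIndependent_iff.mp hz c (by
      rw [← h, hw, Fintype.linearCombination_apply])
    exact funext this)
  have hwperp : w ∈ (spectralSubspace J t)ᗮ :=
    (Submodule.orthogonalProjectionOnto_eq_zero_iff).mp hc
  have hlt2 := norm_sq_lt_of_mem_orthogonal hJ hinj ht0 hw0 hwperp
  have hwdec : ∃ (u : H') (a : ℂ), u ∈ spectralSubspace (J ∘L H'.subtypeL) t ∧
      w = u + a • v := by
    refine ⟨∑ i : Fin (k + 1), c i.succ • x i, c 0, ?_, ?_⟩
    · refine Submodule.sum_mem _ fun i _ => Submodule.smul_mem _ _ ?_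
      exact formEig_le_spectralSubspace _ (hlam.1 (by omega)) (hxs i)
    · rw [hw, Fintype.linearCombination_apply, Fin.sum_univ_succ, add_comm]
      simp [z]
  obtain ⟨u, a, hu, hwu⟩ := hwdec
  have hu2 : ‖(u : H)‖ ^ 2 ≤ (t + 1) * ‖J u‖ ^ 2 :=
    norm_sq_le_of_mem_spectralSubspace (J := J ∘L H'.subtypeL) hu
  -- The cross terms carry exactly the factor `t + 1`, so they cancel from the comparison and only
  -- the squares of `u` and `v` matter.
  have hre : RCLike.re (inner ℂ (u : H) (a • v)) =
      (t + 1) * RCLike.re (inner ℂ (J u) (J (a • v))) := by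
    rw [map_smul, inner_smul_right, inner_smul_right, h1 u u.2]
    have : a * (((t : ℂ) + 1) * inner ℂ (J (u : H)) (J v)) =
        ((t + 1 : ℝ) : ℂ) * (a * inner ℂ (J (u : H)) (J v)) := by push_cast; ring
    rw [this]
    exact Complex.re_ofReal_mul _ _
  have hle : ‖w‖ ^ 2 ≤ (t + 1) * ‖J w‖ ^ 2 := by
    rw [hwu, map_add, norm_add_sq (𝕜 := ℂ), norm_add_sq (𝕜 := ℂ), hre, map_smul, norm_smul,
      norm_smul, mul_pow, mul_pow, h2]
    nlinarith
  linarith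

end FormEigen

/-! ### Rellich's theorem -/

/-- Finitely many functionals map the unit ball into a totally bounded set. Points with close
functional values have close images under `J`, so the image of the ball is totally bounded too. -/
theorem isCompactOperator_of_le_finite {H L : Type*} [NormedAddCommGroup H] [NormedSpace ℂ H]
    [NormedAddCommGroup L] [NormedSpace ℂ L] [CompleteSpace L] (J : H →L[ℂ] L)
    (h : ∀ ε > 0, ∃ (n : ℕ) (F : Fin n → (H →L[ℂ] ℂ)), ∀ x, ‖J x‖ ≤ ε * ‖x‖ + ∑ j, ‖F j x‖) :
    IsCompactOperator J := by
  change IsCompactOperator (J : H →ₗ[ℂ] L)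
  rw [isCompactOperator_iff_isCompact_closure_image_closedBall (J : H →ₗ[ℂ] L) one_pos]
  refine TotallyBounded.isCompact_of_isClosed ?_ isClosed_closure
  refine TotallyBounded.closure (Metric.totallyBounded_iff.mpr fun ε hε => ?_)
  -- Two points of the unit ball differ by at most `2`, so `ε / 8` contributes `ε / 4`; the mesh `ε
  -- / (4 (n + 1))` keeps the sum of the `n` functionals below another `ε / 4`.
  obtain ⟨n, F, hF⟩ := h (ε / 8) (by positivity)
  let G : H →L[ℂ] (Fin n → ℂ) := ContinuousLinearMap.pi F
  have hbdd : Bornology.IsBounded (G '' Metric.closedBall 0 1) :=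
    (Metric.isBounded_closedBall.image G)
  have htb : TotallyBounded (G '' Metric.closedBall 0 1) := 
    hbdd.isCompact_closure.totallyBounded.subset subset_closure
  obtain ⟨t, hts, htf, htc⟩ := Metric.finite_approx_of_totallyBounded htb
    (ε / (4 * (n + 1))) (by positivity)
  have hts' : ∀ w, w ∈ t → ∃ x, x ∈ Metric.closedBall (0 : H) 1 ∧ G x = w := fun w hw => hts hw
  choose! y hy hyt using hts'
  refine ⟨(fun w => J (y w)) '' t, htf.image _, ?_⟩
  rintro _ ⟨x, hx, rfl⟩
  obtain ⟨w, hw, hxw⟩ := mem_iUnion₂.mp (htc ⟨x, hx, rfl⟩)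
  refine mem_iUnion₂.mpr ⟨J (y w), ⟨w, hw, rfl⟩, ?_⟩
  rw [Metric.mem_ball, dist_eq_norm] at hxw ⊢
  rw [← hyt w hw, ← map_sub] at hxw
  rw [ContinuousLinearMap.coe_coe, ← map_sub]
  have h1 : ‖x - y w‖ ≤ 2 := by
    have h2 := hy w hw
    rw [mem_closedBall_zero_iff] at hx h2
    exact (norm_sub_le _ _).trans (by linarith)
  have h3 : ∑ j, ‖F j (x - y w)‖ ≤ ∑ _j : Fin n, ε / (4 * (n + 1)) :=
    Finset.sum_le_sum fun j _ => (norm_le_pi_norm (G (x - y w)) j).trans hxw.le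
  rw [Finset.sum_const, Finset.card_univ, Fintype.card_fin, nsmul_eq_mul] at h3
  have h4 : (n : ℝ) * (ε / (4 * (n + 1))) ≤ ε / 4 := by
    rw [mul_div_assoc', div_le_div_iff₀ (by positivity) (by positivity)]
    nlinarith [hε]
  calc ‖J (x - y w)‖ ≤ ε / 8 * ‖x - y w‖ + ∑ j, ‖F j (x - y w)‖ := hF _
    _ ≤ ε / 8 * 2 + ε / 4 := by gcongr; exact h3.trans h4
    _ < ε := by linarith

/-! ### Testing square integrable functions against smooth ones -/

variable {Ω : Set Plane}

/-- The functional `u ↦ ∫_Ω ψ u`. -/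
def pairing (ψ : Plane → ℂ) (hψ : MemLp ψ 2 (volume.restrict Ω)) : L2 Ω →L[ℂ] ℂ :=
  innerSL ℂ (hψ.star.toLp (star ψ))

theorem pairing_apply {ψ : Plane → ℂ} (hψ : MemLp ψ 2 (volume.restrict Ω)) (u : L2 Ω) :
    pairing ψ hψ u = ∫ x in Ω, ψ x * u x := by
  rw [pairing, innerSL_apply_apply, L2.inner_def]
  refine integral_congr_ae ?_
  filter_upwards [hψ.star.coeFn_toLp] with x hx
  rw [hx]
  simp [RCLike.inner_apply, mul_comm]

theorem norm_integral_mul_le {ψ : Plane → ℂ} (hψ : MemLp ψ 2 (volume.restrict Ω)) (u : L2 Ω) :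
    ‖∫ x in Ω, ψ x * u x‖ ≤ (eLpNorm ψ 2 (volume.restrict Ω)).toReal * ‖u‖ := by
  rw [← pairing_apply hψ, pairing, innerSL_apply_apply]
  refine (norm_inner_le_norm _ _).trans (le_of_eq ?_)
  rw [Lp.norm_toLp, eLpNorm_star]

/-- The norm in `L²` of the plane. -/
def l2norm (ψ : Plane → ℂ) : ℝ := (eLpNorm ψ 2 volume).toReal

theorem l2norm_nonneg (ψ : Plane → ℂ) : 0 ≤ l2norm ψ := ENNReal.toReal_nonneg

theorem norm_integral_mul_le_l2norm {ψ : Plane → ℂ} (hψ : MemLp ψ 2 volume) (u : L2 Ω) :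
    ‖∫ x in Ω, ψ x * u x‖ ≤ l2norm ψ * ‖u‖ := by
  refine (norm_integral_mul_le (hψ.mono_measure Measure.restrict_le_self) u).trans ?_
  gcongr
  exact ENNReal.toReal_mono hψ.2.ne (eLpNorm_mono_measure _ Measure.restrict_le_self)

theorem IsTestFunction.memLp {A : Set Plane} {φ : Plane → ℂ} (h : IsTestFunction A φ)
    (ν : Measure Plane) [IsFiniteMeasureOnCompacts ν] : MemLp φ 2 ν :=
  h.contDiff.continuous.memLp_of_hasCompactSupport h.hasCompactSupport

theorem IsTestFunction.mono {A B : Set Plane} {φ : Plane → ℂ} (h : IsTestFunction A φ)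
    (hAB : A ⊆ B) : IsTestFunction B φ :=
  ⟨h.contDiff, h.hasCompactSupport, h.tsupport_subset.trans hAB⟩

/-- The test functions on `A`, as a subspace of `L²(A)`. -/
def testSubspace (A : Set Plane) : Submodule ℂ (L2 A) where
  carrier := {w | ∃ φ, IsTestFunction A φ ∧ w =ᵐ[volume.restrict A] φ}
  add_mem' := by
    rintro a b ⟨φ, hφ, ha⟩ ⟨ψ, hψ, hb⟩
    refine ⟨φ + ψ, ⟨hφ.1.add hψ.1, hφ.2.add hψ.2, ?_⟩, (Lp.coeFn_add _ _).trans (ha.add hb)⟩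
    exact (tsupport_add φ ψ).trans (union_subset hφ.3 hψ.3)
  zero_mem' := ⟨0, ⟨contDiff_const, HasCompactSupport.zero, by simp [tsupport]⟩,
    Lp.coeFn_zero _ _ _⟩
  smul_mem' := by
    rintro c a ⟨φ, hφ, ha⟩
    refine ⟨c • φ, ⟨hφ.1.const_smul c, hφ.2.mono (Function.support_const_smul_subset c φ), ?_⟩,
      (Lp.coeFn_smul _ _).trans (ha.const_smul c)⟩
    exact (closure_mono (Function.support_const_smul_subset c φ)).trans hφ.3

/-- By the fundamental lemma of the calculus of variations, a function orthogonal to all real-valued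
test functions vanishes almost everywhere. -/
theorem testSubspace_dense {A : Set Plane} (hA : IsOpen A) :
    (testSubspace A).topologicalClosure = ⊤ := by
  rw [Submodule.topologicalClosure_eq_top_iff, Submodule.eq_bot_iff]
  intro w hw
  have h0 : ∀ᵐ x ∂volume, x ∈ A → w x = 0 := by
    refine hA.ae_eq_zero_of_integral_contDiff_smul_eq_zero
      (locallyIntegrableOn_of_locallyIntegrable_restrict
        (MemLp.locallyIntegrable (Lp.memLp w) (by norm_num))) fun g hg hgc hgA => ?_
    have hφ : IsTestFunction A (fun x => (g x : ℂ)) :=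
      ⟨Complex.ofRealCLM.contDiff.comp hg, hgc.comp_left Complex.ofReal_zero,
        (closure_mono (Function.support_comp_subset Complex.ofReal_zero g)).trans hgA⟩
    have hm : MemLp (fun x => (g x : ℂ)) 2 (volume.restrict A) := hφ.memLp _
    have h1 := (Submodule.mem_orthogonal _ _).mp hw (hm.toLp _) ⟨_, hφ, hm.coeFn_toLp⟩
    rw [L2.inner_def] at h1
    rw [← h1, ← setIntegral_eq_integral_of_forall_compl_eq_zero (s := A)]
    · refine integral_congr_ae ?_
      filter_upwards [hm.coeFn_toLp] with x hx
      rw [hx, RCLike.inner_apply]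
      simp [mul_comm]
    · intro x hx
      rw [image_eq_zero_of_notMem_tsupport (fun h => hx (hgA h)), zero_smul]
  rw [Lp.eq_zero_iff_ae_eq_zero, Filter.EventuallyEq, ae_restrict_iff' hA.measurableSet]
  exact h0

theorem IsTestFunction.conj {A : Set Plane} {φ : Plane → ℂ} (h : IsTestFunction A φ) :
    IsTestFunction A (fun x => starRingEnd ℂ (φ x)) where
  contDiff := Complex.conjCLE.contDiff.comp h.contDiff
  hasCompactSupport := h.hasCompactSupport.comp_left (map_zero (starRingEnd ℂ))
  tsupport_subset := by
    refine Subset.trans (closure_mono fun x hx => ?_) h.tsupport_subset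
    rw [Function.mem_support] at hx ⊢
    exact fun h0 => hx (by rw [h0, map_zero])

/-- The `L²` norm by duality. Test functions suffice because they are dense; they enter conjugated
since the inner product is conjugate linear in its first argument. -/
theorem norm_le_of_forall_test {A : Set Plane} (hA : IsOpen A) (w : L2 A) {C : ℝ} (hC : 0 ≤ C)
    (h : ∀ φ, IsTestFunction A φ → ‖∫ x in A, φ x * w x‖ ≤ C * l2norm φ) : ‖w‖ ≤ C := by
  have h1 : ∀ d ∈ testSubspace A, ‖inner ℂ d w‖ ≤ C * ‖d‖ := by
    rintro d ⟨φ, hφ, hd⟩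
    have h2 := h _ hφ.conj
    have h3 : inner ℂ d w = ∫ x in A, (starRingEnd ℂ (φ x)) * w x := by
      rw [L2.inner_def]
      refine integral_congr_ae ?_
      filter_upwards [hd] with x hx
      rw [hx, RCLike.inner_apply, mul_comm]
    have h4 : ‖d‖ = l2norm (fun x => starRingEnd ℂ (φ x)) := by
      have h5 : eLpNorm (fun x => starRingEnd ℂ (φ x)) 2 volume = eLpNorm φ 2 volume :=
        eLpNorm_congr_norm_ae (Filter.Eventually.of_forall fun x => RCLike.norm_conj _)
      rw [Lp.norm_def, eLpNorm_congr_ae hd, l2norm, h5, eLpNorm_restrict_eq_of_support_subset]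
      exact (subset_tsupport _).trans hφ.tsupport_subset
    rw [h3, h4]
    exact h2
  have h2 : ∀ d : L2 A, ‖inner ℂ d w‖ ≤ C * ‖d‖ := by
    intro d
    have hcl : IsClosed {d : L2 A | ‖inner ℂ d w‖ ≤ C * ‖d‖} :=
      isClosed_le (by fun_prop) (by fun_prop)
    have hd : d ∈ (testSubspace A).topologicalClosure := by
      rw [testSubspace_dense hA]; trivial
    exact closure_minimal h1 hcl hd
  have h3 := h2 w
  rw [inner_self_eq_norm_sq_to_K] at h3
  by_contra! hlt
  simp only [norm_pow, RCLike.norm_ofReal, abs_norm] at h3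
  nlinarith

/-- The directional derivative in the direction `z`, for the gradient `g`. -/
def dirGrad (g : Fin 2 → L2 Ω) (z : Plane) : L2 Ω := (z 0 : ℂ) • g 0 + (z 1 : ℂ) • g 1

theorem norm_dirGrad_le (g : Fin 2 → L2 Ω) (z : Plane) :
    ‖dirGrad g z‖ ≤ ‖z‖ * (‖g 0‖ + ‖g 1‖) := by
  have h : ∀ i, ‖(z i : ℂ)‖ ≤ ‖z‖ := fun i => by
    rw [Complex.norm_real]
    exact PiLp.norm_apply_le z i
  calc ‖dirGrad g z‖ ≤ ‖(z 0 : ℂ)‖ * ‖g 0‖ + ‖(z 1 : ℂ)‖ * ‖g 1‖ := by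
        refine (norm_add_le _ _).trans ?_
        rw [norm_smul, norm_smul]
    _ ≤ ‖z‖ * ‖g 0‖ + ‖z‖ * ‖g 1‖ := by gcongr <;> exact h _
    _ = _ := by ring

theorem fderiv_eq_sum_partialDeriv (φ : Plane → ℂ) (x z : Plane) :
    fderiv ℝ φ x z = (z 0 : ℂ) * partialDeriv 0 φ x + (z 1 : ℂ) * partialDeriv 1 φ x := by
  have hz : z = z 0 • EuclideanSpace.single 0 1 + z 1 • EuclideanSpace.single 1 1 := by
    ext i
    fin_cases i <;> simp
  conv_lhs => rw [hz]
  rw [map_add, map_smul, map_smul]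
  simp [partialDeriv]

theorem integral_fderiv_mul {p : L2 Ω × (Fin 2 → L2 Ω)} (hp : p ∈ sobolevH1 Ω) {φ : Plane → ℂ}
    (hφ : IsTestFunction Ω φ) (z : Plane) :
    ∫ x in Ω, fderiv ℝ φ x z * p.1 x = -∫ x in Ω, φ x * dirGrad p.2 z x := by
  have h1 : ∀ i, Integrable (fun x => partialDeriv i φ x * p.1 x) (volume.restrict Ω) := fun i =>
    integrable_mul_of_compactSupport (hφ.continuous_partialDeriv i)
      (hφ.hasCompactSupport_partialDeriv i) _
  simp_rw [fderiv_eq_sum_partialDeriv, add_mul, mul_assoc]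
  rw [integral_add ((h1 0).const_mul _) ((h1 1).const_mul _), integral_const_mul,
    integral_const_mul, hp φ hφ, hp φ hφ, dirGrad,
    integral_mul_add hφ.contDiff.continuous hφ.hasCompactSupport, integral_mul_smul,
    integral_mul_smul]
  ring

theorem tsupport_comp_sub_subset {φ : Plane → ℂ} (z : Plane) :
    tsupport (fun y => φ (y - z)) ⊆ (fun y => y - z) ⁻¹' tsupport φ :=
  closure_minimal (fun y hy => subset_closure (show y - z ∈ Function.support φ from hy))
    (isClosed_closure.preimage (by fun_prop))

theorem hasCompactSupport_comp_sub {φ : Plane → ℂ} (h : HasCompactSupport φ) (z : Plane) :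
    HasCompactSupport fun y => φ (y - z) :=
  h.comp_homeomorph (Homeomorph.subRight z)

theorem l2norm_comp_sub {φ : Plane → ℂ} (h : Continuous φ) (z : Plane) :
    l2norm (fun y => φ (y - z)) = l2norm φ := by
  rw [l2norm, l2norm]
  congr 1
  exact eLpNorm_comp_measurePreserving (g := φ) (f := fun y => y - z) h.aestronglyMeasurable
    (measurePreserving_sub_right volume z)

/-- The dual form of the estimate of `u(x + z) - u(x)` by `|z|` times the gradient. The pairing of
`u` with the shift of `φ` by `t z` is differentiated in `t`; the definition of the weak gradient
moves the derivative onto `u`, and the mean value inequality concludes. -/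
theorem norm_integral_shift_sub_le (hΩ : volume Ω ≠ ⊤) {p : L2 Ω × (Fin 2 → L2 Ω)}
    (hp : p ∈ sobolevH1 Ω) {φ : Plane → ℂ} (hφ : ContDiff ℝ ∞ φ) (hφc : HasCompactSupport φ)
    (z : Plane) (hz : ∀ t ∈ Icc (0 : ℝ) 1, ∀ x ∈ tsupport φ, x + t • z ∈ Ω) :
    ‖(∫ y in Ω, φ (y - z) * p.1 y) - ∫ y in Ω, φ y * p.1 y‖ ≤
      l2norm φ * (‖z‖ * (‖p.2 0‖ + ‖p.2 1‖)) := by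
  have : IsFiniteMeasure (volume.restrict Ω) := ⟨by simpa using hΩ.lt_top⟩
  have hu : Integrable p.1 (volume.restrict Ω) := (Lp.memLp p.1).integrable (by norm_num)
  have hd : Continuous (fun x => fderiv ℝ φ x (-z)) :=
    (hφ.continuous_fderiv (by simp)).clm_apply continuous_const
  obtain ⟨C, hC⟩ := (hφc.fderiv_apply (𝕜 := ℝ) (-z)).exists_bound_of_continuous hd
  obtain ⟨C', hC'⟩ := hφc.exists_bound_of_continuous hφ.continuous
  set f : ℝ → ℂ := fun t => ∫ y in Ω, φ (y - t • z) * p.1 y with hf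
  have hderiv : ∀ t, HasDerivAt f (∫ y in Ω, fderiv ℝ φ (y - t • z) (-z) * p.1 y) t := by
    intro t
    refine (hasDerivAt_integral_of_dominated_loc_of_deriv_le (𝕜 := ℝ) (s := univ)
      (bound := fun y => C * ‖p.1 y‖)
      (F' := fun t y => fderiv ℝ φ (y - t • z) (-z) * p.1 y) Filter.univ_mem ?_ ?_ ?_ ?_ ?_ ?_).2
    · refine Filter.Eventually.of_forall fun t => ?_
      exact (hφ.continuous.comp (by fun_prop)).aestronglyMeasurable.mul hu.1
    · exact hu.bdd_mul (c := C') (hφ.continuous.comp (by fun_prop)).aestronglyMeasurable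
        (Filter.Eventually.of_forall fun y => hC' _)
    · exact (hd.comp (by fun_prop : Continuous fun y => y - t • z)).aestronglyMeasurable.mul hu.1
    · refine Filter.Eventually.of_forall fun y t _ => ?_
      rw [norm_mul]
      gcongr
      exact hC _
    · exact hu.norm.const_mul C
    · refine Filter.Eventually.of_forall fun y t _ => ?_
      refine HasDerivAt.mul_const ?_ _
      have h1 : HasDerivAt (fun t : ℝ => y - t • z) (-z) t := by
        simpa using ((hasDerivAt_id t).smul_const z).const_sub y
      exact ((hφ.differentiable (by simp) _).hasFDerivAt.comp_hasDerivAt t h1)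
  have hbound : ∀ t ∈ Ico (0 : ℝ) 1, ‖∫ y in Ω, fderiv ℝ φ (y - t • z) (-z) * p.1 y‖ ≤
      l2norm φ * (‖z‖ * (‖p.2 0‖ + ‖p.2 1‖)) := by
    intro t ht
    -- The weak gradient may only be tested inside `Ω`; this is why the support must stay in `Ω`
    -- during the entire shift.
    have htest : IsTestFunction Ω (fun y => φ (y - t • z)) := by
      refine ⟨hφ.comp (contDiff_id.sub contDiff_const), hasCompactSupport_comp_sub hφc _, ?_⟩
      intro y hy
      have h2 := hz t (Ico_subset_Icc_self ht) _ (tsupport_comp_sub_subset _ hy)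
      simpa using h2
    have h3 := integral_fderiv_mul hp htest (-z)
    simp only [fderiv_comp_sub] at h3
    rw [h3, norm_neg]
    refine (norm_integral_mul_le_l2norm (htest.memLp _) _).trans ?_
    rw [l2norm_comp_sub hφ.continuous]
    have h4 := norm_dirGrad_le p.2 (-z)
    rw [norm_neg] at h4
    gcongr
    exact l2norm_nonneg _
  have h5 := norm_image_sub_le_of_norm_deriv_le_segment' (f := f) (a := 0) (b := 1)
    (fun t _ => (hderiv t).hasDerivWithinAt) hbound 1 (by simp)
  simpa [hf] using h5

/-- The square root of the area of `Ω`. -/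
def rootArea (Ω : Set Plane) : ℝ := ((volume Ω) ^ (1 / 2 : ℝ)).toReal

theorem rootArea_nonneg (Ω : Set Plane) : 0 ≤ rootArea Ω := ENNReal.toReal_nonneg

theorem norm_integral_mul_le_of_bound (hΩ : volume Ω ≠ ⊤) {ψ : Plane → ℂ} (hψ : Continuous ψ)
    {c : ℝ} (hc0 : 0 ≤ c) (hc : ∀ x, ‖ψ x‖ ≤ c) (u : L2 Ω) :
    ‖∫ x in Ω, ψ x * u x‖ ≤ rootArea Ω * c * ‖u‖ := by
  have : IsFiniteMeasure (volume.restrict Ω) := ⟨by simpa using hΩ.lt_top⟩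
  have hm : MemLp ψ 2 (volume.restrict Ω) :=
    MemLp.of_bound hψ.aestronglyMeasurable c (Filter.Eventually.of_forall hc)
  refine (norm_integral_mul_le hm u).trans ?_
  gcongr
  have h := eLpNorm_le_of_ae_bound (p := 2) (μ := volume.restrict Ω)
    (Filter.Eventually.of_forall hc)
  have h2 := ENNReal.toReal_mono (by finiteness) h
  rw [ENNReal.toReal_mul, ENNReal.toReal_ofReal hc0] at h2
  simpa [rootArea] using h2

theorem integral_norm_le_rootArea (hΩ : volume Ω ≠ ⊤) {φ : Plane → ℂ}
    (hφ : IsTestFunction Ω φ) : ∫ x, ‖φ x‖ ≤ rootArea Ω * l2norm φ := by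
  have : IsFiniteMeasure (volume.restrict Ω) := ⟨by simpa using hΩ.lt_top⟩
  have h1 : ∫ x, ‖φ x‖ = ∫ x in Ω, ‖φ x‖ :=
    (setIntegral_eq_integral_of_forall_compl_eq_zero fun x hx => by
      rw [image_eq_zero_of_notMem_tsupport fun h => hx (hφ.tsupport_subset h), norm_zero]).symm
  rw [h1, integral_norm_eq_lintegral_enorm hφ.contDiff.continuous.aestronglyMeasurable,
    ← eLpNorm_one_eq_lintegral_enorm]
  have h2 := eLpNorm_le_eLpNorm_mul_rpow_measure_univ (p := 1) (q := 2)
    (μ := volume.restrict Ω) (by norm_num) hφ.contDiff.continuous.aestronglyMeasurable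
  have h4 : eLpNorm φ 2 (volume.restrict Ω) ≠ ⊤ := (hφ.memLp _).2.ne
  have h3 := ENNReal.toReal_mono (by
    refine ENNReal.mul_ne_top h4 ?_
    norm_num
    finiteness) h2
  refine h3.trans ?_
  rw [ENNReal.toReal_mul, mul_comm]
  refine mul_le_mul (le_of_eq ?_) ?_ ENNReal.toReal_nonneg (rootArea_nonneg _)
  · norm_num [rootArea]
  · exact ENNReal.toReal_mono (hφ.memLp _).2.ne
      (eLpNorm_mono_measure _ Measure.restrict_le_self)

/-- Averages of shifts of a test function, tested against `u`. -/
theorem integral_average_shift (hΩ : volume Ω ≠ ⊤) (u : L2 Ω) {φ : Plane → ℂ}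
    (hφ : Continuous φ) (hφc : HasCompactSupport φ) {ρ : Plane → ℝ} (hρ : Continuous ρ)
    (hρc : HasCompactSupport ρ) :
    Integrable (fun z => (ρ z : ℂ) * ∫ y in Ω, φ (y - z) * u y) ∧
    ∫ z, (ρ z : ℂ) * ∫ y in Ω, φ (y - z) * u y =
      ∫ x, φ x * ∫ y in Ω, (ρ (y - x) : ℂ) * u y := by
  have : IsFiniteMeasure (volume.restrict Ω) := ⟨by simpa using hΩ.lt_top⟩
  have hu : Integrable u (volume.restrict Ω) := (Lp.memLp u).integrable (by norm_num)
  have hρ' : Continuous fun z => (ρ z : ℂ) := Complex.continuous_ofReal.comp hρ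
  have hρi : Integrable (fun z => (ρ z : ℂ)) (volume : Measure Plane) :=
    hρ'.integrable_of_hasCompactSupport (hρc.comp_left Complex.ofReal_zero)
  have hφi : Integrable φ (volume : Measure Plane) := hφ.integrable_of_hasCompactSupport hφc
  obtain ⟨C, hC⟩ := hφc.exists_bound_of_continuous hφ
  obtain ⟨D, hD⟩ := hρc.exists_bound_of_continuous hρ
  have hint1 : Integrable (fun q : Plane × Plane => (ρ q.1 : ℂ) * (φ (q.2 - q.1) * u q.2))
      (volume.prod (volume.restrict Ω)) := by
    have h := (hρi.mul_prod hu).bdd_mul (f := fun q : Plane × Plane => φ (q.2 - q.1)) (c := C)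
      (hφ.comp (by fun_prop)).aestronglyMeasurable (Filter.Eventually.of_forall fun _ => hC _)
    refine h.congr (Filter.Eventually.of_forall fun q => ?_)
    simp only
    ring
  have hint2 : Integrable (fun q : Plane × Plane => φ q.1 * ((ρ (q.2 - q.1) : ℂ) * u q.2))
      (volume.prod (volume.restrict Ω)) := by
    have h := (hφi.mul_prod hu).bdd_mul (f := fun q : Plane × Plane => (ρ (q.2 - q.1) : ℂ)) (c := D)
      (hρ'.comp (by fun_prop)).aestronglyMeasurable (Filter.Eventually.of_forall fun _ => by
        rw [Complex.norm_real]; exact hD _)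
    refine h.congr (Filter.Eventually.of_forall fun q => ?_)
    simp only
    ring
  refine ⟨by simpa only [integral_const_mul] using hint1.integral_prod_left, ?_⟩
  simp_rw [← integral_const_mul]
  refine (integral_integral_swap hint1).trans (Eq.trans ?_ (integral_integral_swap hint2).symm)
  congr 1
  ext y
  have h := integral_sub_left_eq_self
    (fun x => φ x * ((ρ (y - x) : ℂ) * u y)) (volume : Measure Plane) y
  rw [← h]
  congr 1
  ext z
  rw [sub_sub_cancel]
  ring

/-- The average over `z`, with weight `ρ`, of the pairings of `u` with the shifts of `φ` is compared
in two ways. It differs from the pairing with `φ` by at most the gradient term. By Fubini it equals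
the pairing of `φ` with the mollification of `u`, which is bounded by `S` on `A`. -/
theorem norm_integral_le_of_average (hΩ : volume Ω ≠ ⊤) {p : L2 Ω × (Fin 2 → L2 Ω)}
    (hp : p ∈ sobolevH1 Ω) {A : Set Plane} (hAΩ : A ⊆ Ω) {ε r : ℝ} {z₀ : Plane}
    (hball : ∀ z ∈ Metric.ball z₀ r, ‖z‖ < ε ∧ ∀ y ∈ A, ∀ t ∈ Icc (0 : ℝ) 1, y + t • z ∈ Ω)
    {ρ : ContDiffBump z₀} (hρr : ρ.rOut = r) {S : ℝ}
    (hS : ∀ x ∈ A, ‖∫ y in Ω, (ρ.normed volume (y - x) : ℂ) * p.1 y‖ ≤ S) {φ : Plane → ℂ}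
    (hφ : IsTestFunction A φ) :
    ‖∫ y in Ω, φ y * p.1 y‖ ≤ (ε * (‖p.2 0‖ + ‖p.2 1‖) + rootArea Ω * S) * l2norm φ := by
  have hρc : Continuous (ρ.normed (volume : Measure Plane)) :=
    (ρ.contDiff_normed (n := 0)).continuous
  obtain ⟨hi, heq⟩ := integral_average_shift hΩ p.1 hφ.contDiff.continuous hφ.hasCompactSupport
    hρc ρ.hasCompactSupport_normed
  have hρi : Integrable (ρ.normed (volume : Measure Plane)) := ρ.integrable_normed
  set I := ∫ y in Ω, φ y * p.1 y with hI
  set B := l2norm φ * (ε * (‖p.2 0‖ + ‖p.2 1‖)) with hB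
  have h1 : ‖(∫ z, (ρ.normed volume z : ℂ) * ∫ y in Ω, φ (y - z) * p.1 y) - I‖ ≤ B := by
    have h2 : I = ∫ z, (ρ.normed volume z : ℂ) * I := by
      have h : ∫ z, (ρ.normed volume z : ℂ) = ((∫ z, ρ.normed volume z : ℝ) : ℂ) :=
        integral_ofReal (𝕜 := ℂ)
      rw [integral_mul_const, h, ρ.integral_normed, Complex.ofReal_one, one_mul]
    have hρC : Integrable (fun z => (ρ.normed volume z : ℂ)) := hρi.ofReal
    rw [h2, ← integral_sub hi (hρC.mul_const I)]
    have h3 : ∫ z, ρ.normed volume z * B = B := by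
      rw [integral_mul_const, ρ.integral_normed, one_mul]
    rw [← h3]
    refine norm_integral_le_of_norm_le (hρi.mul_const _) (Filter.Eventually.of_forall fun z => ?_)
    rw [← mul_sub, norm_mul, Complex.norm_real, Real.norm_of_nonneg (ρ.nonneg_normed z)]
    by_cases hz : z ∈ Metric.ball z₀ r
    · refine mul_le_mul_of_nonneg_left ?_ (ρ.nonneg_normed z)
      obtain ⟨hz1, hz2⟩ := hball z hz
      refine (norm_integral_shift_sub_le hΩ hp hφ.contDiff hφ.hasCompactSupport z
        fun t ht x hx => hz2 x (hφ.tsupport_subset hx) t ht).trans ?_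
      rw [hB]
      have := l2norm_nonneg φ
      gcongr
    · have h4 : ρ.normed (volume : Measure Plane) z = 0 := by
        rw [← Function.notMem_support, ρ.support_normed_eq, hρr]
        exact hz
      rw [h4, zero_mul, zero_mul]
  have h5 : ‖∫ x, φ x * ∫ y in Ω, (ρ.normed volume (y - x) : ℂ) * p.1 y‖ ≤
      rootArea Ω * l2norm φ * S := by
    by_cases hA : A.Nonempty
    · obtain ⟨a, ha⟩ := hA
      have hS0 : 0 ≤ S := (norm_nonneg _).trans (hS a ha)
      have h6 : ∫ x, ‖φ x‖ * S ≤ rootArea Ω * l2norm φ * S := by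
        rw [integral_mul_const]
        gcongr
        exact integral_norm_le_rootArea hΩ (hφ.mono hAΩ)
      refine le_trans ?_ h6
      refine norm_integral_le_of_norm_le
        ((hφ.contDiff.continuous.integrable_of_hasCompactSupport hφ.hasCompactSupport).norm.mul_const
          _) (Filter.Eventually.of_forall fun x => ?_)
      rw [norm_mul]
      by_cases hx : x ∈ A
      · gcongr
        exact hS x hx
      · rw [image_eq_zero_of_notMem_tsupport fun h => hx (hφ.tsupport_subset h), norm_zero,
          zero_mul, zero_mul]
    · have h7 : φ = 0 := by
        ext x
        exact image_eq_zero_of_notMem_tsupport fun h => hA ⟨x, hφ.tsupport_subset h⟩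
      have h8 : l2norm (0 : Plane → ℂ) = 0 := by simp [l2norm]
      rw [h7, h8]
      simp
  rw [heq] at h1
  have h9 := norm_sub_norm_le I (∫ x, φ x * ∫ y in Ω, (ρ.normed volume (y - x) : ℂ) * p.1 y)
  rw [norm_sub_rev] at h9
  rw [hB] at h1
  linarith

/-- The mollification of `u` is Lipschitz, with constant controlled by `‖u‖`. Its supremum over `A`
is therefore governed by its values on a finite net, and these values are the functionals. -/
theorem norm_le_sum_functionals (hΩ : Bornology.IsBounded Ω) {A : Set Plane} (hA : IsOpen A)
    (hAΩ : A ⊆ Ω) {ε r : ℝ} (hε : 0 < ε) {z₀ : Plane} (hr : 0 < r)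
    (hball : ∀ z ∈ Metric.ball z₀ r, ‖z‖ < ε ∧ ∀ y ∈ A, ∀ t ∈ Icc (0 : ℝ) 1, y + t • z ∈ Ω) :
    ∃ (n : ℕ) (F : Fin n → (L2 Ω →L[ℂ] ℂ)), ∀ p ∈ sobolevH1 Ω,
      eLpNorm p.1 2 (volume.restrict A) ≤
        ENNReal.ofReal (ε * (‖p.1‖ + ‖p.2 0‖ + ‖p.2 1‖) + ∑ j, ‖F j p.1‖) := by
  have hv : volume Ω ≠ ⊤ := hΩ.measure_lt_top.ne
  have : IsFiniteMeasure (volume.restrict Ω) := ⟨by simpa using hv.lt_top⟩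
  let ρ : ContDiffBump z₀ := ⟨r / 2, r, by positivity, by linarith⟩
  have hρs : ContDiff ℝ 1 (ρ.normed (volume : Measure Plane)) := ρ.contDiff_normed
  obtain ⟨K, hK⟩ := hρs.lipschitzWith_of_hasCompactSupport ρ.hasCompactSupport_normed (by norm_num)
  have hρc : Continuous fun z => (ρ.normed (volume : Measure Plane) z : ℂ) :=
    Complex.continuous_ofReal.comp hρs.continuous
  have hρcs : HasCompactSupport fun z => (ρ.normed (volume : Measure Plane) z : ℂ) :=
    ρ.hasCompactSupport_normed.comp_left Complex.ofReal_zero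
  have hkc : ∀ x, Continuous fun y => (ρ.normed (volume : Measure Plane) (y - x) : ℂ) :=
    fun x => hρc.comp (by fun_prop)
  have hk : ∀ x, MemLp (fun y => (ρ.normed volume (y - x) : ℂ)) 2 (volume.restrict Ω) := fun x =>
    (hkc x).memLp_of_hasCompactSupport
      (hasCompactSupport_comp_sub (φ := fun z => (ρ.normed (volume : Measure Plane) z : ℂ)) hρcs x)
  set m := rootArea Ω with hm
  have hm0 : 0 ≤ m := rootArea_nonneg Ω
  -- The net error is `m · m · K · δ` times `‖u‖`, and this choice keeps it below `ε ‖u‖`; the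
  -- summand `1` avoids division by zero.
  set δ : ℝ := ε / (m * m * K + 1) with hδ
  have hδ0 : 0 < δ := by positivity
  have hAb : TotallyBounded A := (hΩ.subset hAΩ).isCompact_closure.totallyBounded.subset
    subset_closure
  obtain ⟨t, -, htf, htc⟩ := Metric.finite_approx_of_totallyBounded hAb δ hδ0
  obtain ⟨n, e, -, he⟩ := htf.fin_param
  refine ⟨n, fun j => (m : ℂ) • pairing _ (hk (e j)), fun p hp => ?_⟩
  have hS : ∀ x ∈ A, ‖∫ y in Ω, (ρ.normed volume (y - x) : ℂ) * p.1 y‖ ≤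
      (∑ j, ‖pairing _ (hk (e j)) p.1‖) + m * (K * δ) * ‖p.1‖ := by
    intro x hx
    obtain ⟨w, hw, hxw⟩ := mem_iUnion₂.mp (htc hx)
    rw [← he] at hw
    obtain ⟨j, rfl⟩ := hw
    have h1 : ‖pairing _ (hk (e j)) p.1‖ ≤ ∑ j, ‖pairing _ (hk (e j)) p.1‖ :=
      Finset.single_le_sum (f := fun j => ‖pairing _ (hk (e j)) p.1‖)
        (fun _ _ => norm_nonneg _) (Finset.mem_univ j)
    rw [pairing_apply] at h1
    have h2 := norm_integral_mul_le_of_bound hv ((hkc x).sub (hkc (e j))) (c := K * δ)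
      (by positivity) (fun y => ?_) p.1
    · have h3 : ∀ x', Integrable (fun y => (ρ.normed volume (y - x') : ℂ) * p.1 y)
          (volume.restrict Ω) := fun x' => MemLp.integrable_mul (hk x') (Lp.memLp p.1)
      simp_rw [Pi.sub_apply, sub_mul] at h2
      rw [integral_sub (h3 x) (h3 (e j))] at h2
      have h4 := norm_sub_norm_le (∫ y in Ω, (ρ.normed volume (y - x) : ℂ) * p.1 y)
        (∫ y in Ω, (ρ.normed volume (y - e j) : ℂ) * p.1 y)
      linarith
    · rw [Pi.sub_apply, ← Complex.ofReal_sub, Complex.norm_real, ← dist_eq_norm]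
      refine (hK.dist_le_mul _ _).trans ?_
      rw [dist_sub_left, ]
      gcongr
      exact (Metric.mem_ball.mp hxw).le
  have hw : MemLp p.1 2 (volume.restrict A) :=
    (Lp.memLp p.1).mono_measure (Measure.restrict_mono hAΩ le_rfl)
  have hmain := norm_le_of_forall_test hA (hw.toLp _)
    (C := ε * (‖p.2 0‖ + ‖p.2 1‖) +
      m * ((∑ j, ‖pairing _ (hk (e j)) p.1‖) + m * (K * δ) * ‖p.1‖)) (by positivity) (by
    intro φ hφ
    have h1 : ∫ x in A, φ x * hw.toLp _ x = ∫ x in Ω, φ x * p.1 x := by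
      have h2 : ∫ x in A, φ x * hw.toLp _ x = ∫ x in A, φ x * p.1 x := by
        refine integral_congr_ae ?_
        filter_upwards [hw.coeFn_toLp] with x hx
        rw [hx]
      rw [h2]
      have h3 : ∀ x, x ∉ A → φ x * p.1 x = 0 := fun x hx => by
        rw [image_eq_zero_of_notMem_tsupport fun h => hx (hφ.tsupport_subset h), zero_mul]
      rw [setIntegral_eq_integral_of_forall_compl_eq_zero h3,
        setIntegral_eq_integral_of_forall_compl_eq_zero fun x hx => h3 x fun h => hx (hAΩ h)]
    rw [h1]
    exact norm_integral_le_of_average hv hp hAΩ hball (ρ := ρ) rfl hS hφ)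
  rw [← ENNReal.ofReal_toReal hw.2.ne, ← Lp.norm_toLp _ hw]
  refine ENNReal.ofReal_le_ofReal (hmain.trans ?_)
  have h5 : ∑ j, ‖((m : ℂ) • pairing _ (hk (e j))) p.1‖ =
      m * ∑ j, ‖pairing _ (hk (e j)) p.1‖ := by
    rw [Finset.mul_sum]
    refine Finset.sum_congr rfl fun j _ => ?_
    rw [_root_.smul_apply, norm_smul, Complex.norm_real, Real.norm_of_nonneg hm0]
  rw [h5]
  have h6 : m * (m * (K * δ)) ≤ ε := by
    have : m * (m * (K * δ)) = (m * m * K) * ε / (m * m * K + 1) := by rw [hδ]; ring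
    rw [this, div_le_iff₀ (by positivity)]
    nlinarith [show 0 ≤ m * m * K by positivity]
  nlinarith [norm_nonneg p.1, mul_le_mul_of_nonneg_right h6 (norm_nonneg p.1)]

theorem eLpNorm_restrict_biUnion_le {ι : Type*} (f : Plane → ℂ) (s : Finset ι)
    (B : ι → Set Plane) :
    eLpNorm f 2 (volume.restrict (⋃ i ∈ s, B i)) ≤
      ∑ i ∈ s, eLpNorm f 2 (volume.restrict (B i)) := by
  classical
  induction s using Finset.induction_on with
  | empty => simp
  | insert a s ha ih =>
    rw [Finset.sum_insert ha, Finset.set_biUnion_insert]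
    refine le_trans ?_ (add_le_add_right ih _)
    refine (eLpNorm_mono_measure f (Measure.restrict_union_le _ _)).trans ?_
    simp only [eLpNorm_eq_lintegral_rpow_enorm_toReal (two_ne_zero) (ENNReal.ofNat_ne_top),
      lintegral_add_measure]
    exact ENNReal.rpow_add_le_add_rpow _ _ (by norm_num) (by norm_num)

/-- Near each point of its closure, `Ω` is mapped into itself by all sufficiently small shifts by
vectors in some open set. -/
def HasLocalShifts (Ω : Set Plane) : Prop :=
  ∀ x ∈ closure Ω, ∃ N : Set Plane, IsOpen N ∧ x ∈ N ∧ ∀ ε > 0, ∃ (z₀ : Plane) (r : ℝ), 0 < r ∧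
    ∀ z ∈ Metric.ball z₀ r, ‖z‖ < ε ∧ ∀ y ∈ N ∩ Ω, ∀ t ∈ Icc (0 : ℝ) 1, y + t • z ∈ Ω

/-- Compactness of the closure leaves finitely many neighbourhoods, each with its own finite family
of functionals; the families are merged. -/
theorem exists_functionals (hΩ : Bornology.IsBounded Ω) (hΩo : IsOpen Ω)
    (hs : HasLocalShifts Ω) {ε : ℝ} (hε : 0 < ε) :
    ∃ (n : ℕ) (F : Fin n → (L2 Ω →L[ℂ] ℂ)), ∀ p ∈ sobolevH1 Ω,
      ‖p.1‖ ≤ ε * (‖p.1‖ + ‖p.2 0‖ + ‖p.2 1‖) + ∑ j, ‖F j p.1‖ := by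
  choose! N hNo hxN hN using hs
  have hcomp : IsCompact (closure Ω) := hΩ.isCompact_closure
  obtain ⟨t, ht, htc⟩ := hcomp.elim_nhds_subcover N fun x hx => (hNo x hx).mem_nhds (hxN x hx)
  -- The local errors are summed over `t.card` neighbourhoods.
  have hη : 0 < ε / (t.card + 1) := by positivity
  have hloc : ∀ x : t, ∃ (n : ℕ) (F : Fin n → (L2 Ω →L[ℂ] ℂ)), ∀ p ∈ sobolevH1 Ω,
      eLpNorm p.1 2 (volume.restrict (N x ∩ Ω)) ≤
        ENNReal.ofReal (ε / (t.card + 1) * (‖p.1‖ + ‖p.2 0‖ + ‖p.2 1‖) + ∑ j, ‖F j p.1‖) := by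
    intro x
    obtain ⟨z₀, r, hr, hball⟩ := hN x (ht x x.2) _ hη
    exact norm_le_sum_functionals hΩ ((hNo x (ht x x.2)).inter hΩo) inter_subset_right hη hr hball
  choose n F hF using hloc
  let e := Fintype.equivFin (Σ x : t, Fin (n x))
  refine ⟨_, fun j => F (e.symm j).1 (e.symm j).2, fun p hp => ?_⟩
  have hle : eLpNorm p.1 2 (volume.restrict Ω) ≤
      ∑ x : t, eLpNorm p.1 2 (volume.restrict (N x ∩ Ω)) := by
    refine (eLpNorm_mono_measure _ (Measure.restrict_mono ?_ le_rfl)).trans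
      (eLpNorm_restrict_biUnion_le p.1 Finset.univ fun x : t => N x ∩ Ω)
    intro x hx
    obtain ⟨y, hy, hxy⟩ := mem_iUnion₂.mp (htc (subset_closure hx))
    exact mem_iUnion₂.mpr ⟨⟨y, hy⟩, Finset.mem_univ _, hxy, hx⟩
  have h1 : ‖p.1‖ ≤ ∑ x : t, (ε / (t.card + 1) * (‖p.1‖ + ‖p.2 0‖ + ‖p.2 1‖) +
      ∑ j, ‖F x j p.1‖) := by
    rw [Lp.norm_def]
    refine ENNReal.toReal_le_of_le_ofReal (by positivity) (hle.trans ?_)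
    rw [ENNReal.ofReal_sum_of_nonneg fun x _ => by positivity]
    exact Finset.sum_le_sum fun x _ => hF x p hp
  refine h1.trans ?_
  rw [Finset.sum_add_distrib, Finset.sum_const, Finset.card_univ, Fintype.card_coe, nsmul_eq_mul]
  refine add_le_add ?_ (le_of_eq ?_)
  · rw [← mul_assoc]
    gcongr
    rw [mul_div_assoc', div_le_iff₀ (by positivity)]
    nlinarith
  · exact (Fintype.sum_sigma (fun y : Σ x : t, Fin (n x) => ‖F y.1 y.2 p.1‖)).symm.trans
      (e.symm.sum_comp (fun y : Σ x : t, Fin (n x) => ‖F y.1 y.2 p.1‖)).symm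

/-! ### Lipschitz domains -/

/-- Inside the domain every small shift is admissible. Near a boundary point the admissible shifts
form a cone: the point must descend at least as fast as the Lipschitz graph can fall. -/
theorem IsBoundedLipschitzDomain.hasLocalShifts (hΩ : IsBoundedLipschitzDomain Ω) :
    HasLocalShifts Ω := by
  intro x hx
  by_cases hxΩ : x ∈ Ω
  · obtain ⟨η, hη, hball⟩ := Metric.isOpen_iff.mp hΩ.isOpen x hxΩ
    refine ⟨Metric.ball x (η / 2), Metric.isOpen_ball, Metric.mem_ball_self (by positivity),
      fun ε hε => ⟨0, min ε (η / 2), by positivity, fun z hz => ?_⟩⟩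
    rw [mem_ball_zero_iff, lt_min_iff] at hz
    refine ⟨hz.1, fun y hy t ht => hball ?_⟩
    have h1 : ‖t • z‖ ≤ ‖z‖ := by
      rw [norm_smul, Real.norm_of_nonneg ht.1]
      exact mul_le_of_le_one_left (norm_nonneg _) ht.2
    have h2 := Metric.mem_ball.mp hy.1
    rw [dist_eq_norm] at h2
    rw [Metric.mem_ball, dist_eq_norm]
    calc ‖y + t • z - x‖ = ‖(y - x) + t • z‖ := by congr 1; abel
      _ ≤ ‖y - x‖ + ‖t • z‖ := norm_add_le _ _
      _ < η := by linarith
  · have hxf : x ∈ frontier Ω := by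
      rw [hΩ.isOpen.frontier_eq]
      exact ⟨hx, hxΩ⟩
    obtain ⟨W, hW, hxW, Φ, K, h, hh, hWΩ⟩ := hΩ.localGraph x hxf
    obtain ⟨η, hη, hball⟩ := Metric.isOpen_iff.mp hW x hxW
    refine ⟨Metric.ball x (η / 2), Metric.isOpen_ball, Metric.mem_ball_self (by positivity),
      fun ε hε => ?_⟩
    set ε' := min ε (η / 2) with hε'
    have hε'0 : 0 < ε' := by positivity
    -- The centre points straight down by `ε' / 2`. With this radius both coordinates err by less
    -- than `ε' / (4 (K + 1))`, so the vertical error plus `K` times the horizontal one stays below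
    -- `ε' / 4`.
    refine ⟨Φ.symm !₂[0, -(ε' / 2)], ε' / (4 * (K + 1)), by positivity, fun z hz => ?_⟩
    have hr : (K + 1) * (ε' / (4 * (K + 1))) = ε' / 4 := by field_simp
    have hr4 : ε' / (4 * (K + 1)) ≤ ε' / 4 := by
      gcongr
      linarith [K.2]
    have hz' : ‖Φ z - !₂[0, -(ε' / 2)]‖ < ε' / (4 * (K + 1)) := by
      rw [Metric.mem_ball, dist_eq_norm] at hz
      rwa [← Φ.norm_map, map_sub, Φ.apply_symm_apply] at hz
    have h0 : |(Φ z) 0| < ε' / (4 * (K + 1)) := by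
      refine lt_of_le_of_lt ?_ hz'
      simpa using PiLp.norm_apply_le (Φ z - !₂[0, -(ε' / 2)]) 0
    have h1 : |(Φ z) 1 + ε' / 2| < ε' / (4 * (K + 1)) := by
      refine lt_of_le_of_lt ?_ hz'
      simpa using PiLp.norm_apply_le (Φ z - !₂[0, -(ε' / 2)]) 1
    have hzn : ‖z‖ < ε' := by
      have h2 : ‖(!₂[0, -(ε' / 2)] : Plane)‖ = ε' / 2 := by
        rw [EuclideanSpace.norm_eq]
        simp [Real.sqrt_sq_eq_abs]
        positivity
      rw [← Φ.norm_map]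
      have h3 := norm_sub_norm_le (Φ z) !₂[0, -(ε' / 2)]
      linarith
    have hcone : (Φ z) 1 + K * |(Φ z) 0| ≤ 0 := by
      have h2 := (abs_lt.mp h1).2
      have h3 : (K : ℝ) * |(Φ z) 0| ≤ K * (ε' / (4 * (K + 1))) := by gcongr
      nlinarith
    refine ⟨hzn.trans_le (min_le_left _ _), fun y hy t ht => ?_⟩
    have hyW : y ∈ W := hball (Metric.ball_subset_ball (by linarith) hy.1)
    have hyzW : y + t • z ∈ W := by
      apply hball
      have h1 : ‖t • z‖ ≤ ‖z‖ := by
        rw [norm_smul, Real.norm_of_nonneg ht.1]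
        exact mul_le_of_le_one_left (norm_nonneg _) ht.2
      have h2 := Metric.mem_ball.mp hy.1
      rw [dist_eq_norm] at h2
      rw [Metric.mem_ball, dist_eq_norm]
      calc ‖y + t • z - x‖ = ‖(y - x) + t • z‖ := by congr 1; abel
        _ ≤ ‖y - x‖ + ‖t • z‖ := norm_add_le _ _
        _ < η := by linarith [min_le_right ε (η / 2)]
    rw [hWΩ _ hyzW]
    have hyΩ := (hWΩ y hyW).mp hy.2
    have hlip := hh.dist_le_mul ((Φ y) 0) ((Φ y) 0 + t * (Φ z) 0)
    rw [Real.dist_eq, Real.dist_eq, sub_add_cancel_left, abs_neg, abs_mul, abs_of_nonneg ht.1]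
      at hlip
    have h5 := (abs_le.mp hlip).2
    simp only [map_add, map_smul, PiLp.add_apply, PiLp.smul_apply, smul_eq_mul]
    nlinarith [mul_nonneg ht.1 (neg_nonneg.mpr hcone)]

/-- Coordinates `(s, t)` near a boundary point: `t` is the vertical distance from the graph. -/
def graphMap (Φ : Plane ≃ₗᵢ[ℝ] Plane) (h : ℝ → ℝ) (q : ℝ × ℝ) : Plane :=
  Φ.symm !₂[q.1, h q.1 - q.2]

theorem graphMap_eq_add (Φ : Plane ≃ₗᵢ[ℝ] Plane) (h : ℝ → ℝ) (s t : ℝ) :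
    graphMap Φ h (s, t) = graphMap Φ h (s, 0) + t • Φ.symm !₂[0, -1] := by
  rw [graphMap, graphMap, ← map_smul, ← map_add]
  congr 1
  ext i
  fin_cases i <;> simp [sub_eq_add_neg]

theorem norm_symm_down (Φ : Plane ≃ₗᵢ[ℝ] Plane) : ‖Φ.symm !₂[0, -1]‖ = 1 := by
  rw [LinearIsometryEquiv.norm_map, EuclideanSpace.norm_eq]
  simp

/-- The coordinates are a reflection in each vertical line about a point depending on `s`, followed
by an isometry; continuity of `h` provides the measurability. -/
theorem measurePreserving_graphMap (Φ : Plane ≃ₗᵢ[ℝ] Plane) {h : ℝ → ℝ} (hh : Continuous h) :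
    MeasurePreserving (graphMap Φ h) volume volume := by
  have h1 : MeasurePreserving (fun q : ℝ × ℝ => (q.1, h q.1 - q.2)) volume volume :=
    (MeasurePreserving.id volume).skew_product (g := fun s t => h s - t)
      (hh.measurable.comp measurable_fst |>.sub measurable_snd)
      (Filter.Eventually.of_forall fun s =>
        (Measure.measurePreserving_sub_left (volume : Measure ℝ) (h s)).map_eq)
  have h2 := (volume_preserving_finTwoArrow ℝ).symm
  exact Φ.symm.measurePreserving.comp
    ((PiLp.volume_preserving_toLp (Fin 2)).comp (h2.comp h1))

theorem lipschitzWith_graphMap (Φ : Plane ≃ₗᵢ[ℝ] Plane) {h : ℝ → ℝ} {K : NNReal}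
    (hh : LipschitzWith K h) : LipschitzWith (1 + K) fun s => graphMap Φ h (s, 0) := by
  refine LipschitzWith.of_dist_le_mul fun s s' => ?_
  rw [graphMap, graphMap, LinearIsometryEquiv.dist_map, EuclideanSpace.dist_eq]
  have h1 := hh.dist_le_mul s s'
  simp only [Fin.sum_univ_two]
  refine Real.sqrt_le_iff.mpr ⟨by positivity, ?_⟩
  simp only [Matrix.cons_val_zero, Matrix.cons_val_one, sub_zero]
  push_cast
  have h2 : dist (h s) (h s') ^ 2 ≤ (K * dist s s') ^ 2 := by gcongr
  nlinarith [mul_nonneg K.2 (sq_nonneg (dist s s'))]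

theorem abs_sub_le_dist_graphMap (Φ : Plane ≃ₗᵢ[ℝ] Plane) (h : ℝ → ℝ) (s : ℝ) (x : Plane) :
    |s - (Φ x) 0| ≤ dist (graphMap Φ h (s, 0)) x := by
  rw [dist_eq_norm, ← Φ.norm_map, map_sub, graphMap, Φ.apply_symm_apply]
  simpa using PiLp.norm_apply_le (!₂[s, h s - 0] - Φ x) 0

/-- The points of `W` strictly above the graph form an open set disjoint from `Ω`, so a frontier
point is neither below nor above the graph. -/
theorem eq_of_mem_frontier {W : Set Plane} (hΩ : IsOpen Ω) (hW : IsOpen W)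
    {Φ : Plane ≃ₗᵢ[ℝ] Plane} {h : ℝ → ℝ} (hh : Continuous h)
    (hWΩ : ∀ x ∈ W, (x ∈ Ω ↔ (Φ x) 1 < h ((Φ x) 0))) {x : Plane} (hxW : x ∈ W)
    (hx : x ∈ frontier Ω) : x = graphMap Φ h ((Φ x) 0, 0) := by
  rw [hΩ.frontier_eq] at hx
  have h1 : ¬ (Φ x) 1 < h ((Φ x) 0) := fun hlt => hx.2 ((hWΩ x hxW).mpr hlt)
  have h2 : ¬ h ((Φ x) 0) < (Φ x) 1 := by
    intro hlt
    have hopen : IsOpen (W ∩ {y | h ((Φ y) 0) < (Φ y) 1}) :=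
      hW.inter (isOpen_lt (by fun_prop) (by fun_prop))
    obtain ⟨y, hy, hyΩ⟩ := mem_closure_iff.mp hx.1 _ hopen ⟨hxW, hlt⟩
    exact lt_asymm hy.2 ((hWΩ y hy.1).mp hyΩ)
  have h3 : (Φ x) 1 = h ((Φ x) 0) := le_antisymm (not_lt.mp h2) (not_lt.mp h1)
  rw [graphMap, sub_zero, ← h3]
  apply Φ.injective
  rw [Φ.apply_symm_apply]
  ext i
  fin_cases i <;> rfl

theorem graphMap_mem_iff {W : Set Plane} {Φ : Plane ≃ₗᵢ[ℝ] Plane} {h : ℝ → ℝ}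
    (hWΩ : ∀ x ∈ W, (x ∈ Ω ↔ (Φ x) 1 < h ((Φ x) 0))) {s t : ℝ} (hW : graphMap Φ h (s, t) ∈ W) :
    graphMap Φ h (s, t) ∈ Ω ↔ 0 < t := by
  rw [hWΩ _ hW, graphMap, Φ.apply_symm_apply]
  simp

/-- The boundary piece lies in the image of a Lipschitz curve, and a Lipschitz map enlarges
one-dimensional Hausdorff measure by at most its constant. -/
theorem restrict_hausdorffMeasure_le {W : Set Plane} (hΩ : IsOpen Ω) (hW : IsOpen W)
    {Φ : Plane ≃ₗᵢ[ℝ] Plane} {h : ℝ → ℝ} {K : NNReal} (hh : LipschitzWith K h)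
    (hWΩ : ∀ x ∈ W, (x ∈ Ω ↔ (Φ x) 1 < h ((Φ x) 0))) {N : Set Plane} (hNW : N ⊆ W) :
    (Measure.hausdorffMeasure 1 : Measure Plane).restrict (frontier Ω ∩ N) ≤
      ((1 + K : NNReal) : ENNReal) • Measure.map (fun s => graphMap Φ h (s, 0))
        (volume.restrict ((fun s => graphMap Φ h (s, 0)) ⁻¹' N)) := by
  have hlip := lipschitzWith_graphMap Φ hh
  have hγ : Measurable fun s => graphMap Φ h (s, 0) := hlip.continuous.measurable
  refine Measure.le_iff.mpr fun B hB => ?_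
  rw [Measure.smul_apply, Measure.map_apply hγ hB, Measure.restrict_apply hB,
    Measure.restrict_apply (hγ hB), smul_eq_mul]
  have hsub : B ∩ (frontier Ω ∩ N) ⊆ (fun s => graphMap Φ h (s, 0)) ''
      ((fun s => graphMap Φ h (s, 0)) ⁻¹' B ∩ (fun s => graphMap Φ h (s, 0)) ⁻¹' N) := by
    rintro x ⟨hxB, hxf, hxN⟩
    have hx := eq_of_mem_frontier hΩ hW hh.continuous hWΩ (hNW hxN) hxf
    refine ⟨(Φ x) 0, ⟨?_, ?_⟩, hx.symm⟩
    · rw [mem_preimage, ← hx]; exact hxB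
    · rw [mem_preimage, ← hx]; exact hxN
  refine (measure_mono hsub).trans ((hlip.hausdorffMeasure_image_le zero_le_one _).trans ?_)
  rw [hausdorffMeasure_real, ENNReal.rpow_one]

/-- Projection to the horizontal graph coordinate does not increase length, and its image contains
an interval. This prevents the Dirichlet condition on `ΓD` from being void. -/
theorem hausdorffMeasure_pos_of_isOpen (hΩ : IsBoundedLipschitzDomain Ω) {U : Set Plane}
    (hU : IsOpen U) (hne : (U ∩ frontier Ω).Nonempty) :
    0 < (Measure.hausdorffMeasure 1 : Measure Plane) (U ∩ frontier Ω) := by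
  obtain ⟨p, hpU, hp⟩ := hne
  obtain ⟨W, hW, hpW, Φ, K, h, hh, hWΩ⟩ := hΩ.localGraph p hp
  have hpγ := eq_of_mem_frontier hΩ.isOpen hW hh.continuous hWΩ hpW hp
  set s₀ := (Φ p) 0 with hs₀
  have hγ : Continuous fun s => graphMap Φ h (s, 0) := (lipschitzWith_graphMap Φ hh).continuous
  have hnhds : ∀ᶠ s in nhds s₀, graphMap Φ h (s, 0) ∈ U ∩ W := by
    refine hγ.continuousAt.eventually ((hU.inter hW).mem_nhds ?_)
    have hmem : graphMap Φ h (s₀, 0) ∈ U ∩ W := by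
      rw [← hpγ]
      exact ⟨hpU, hpW⟩
    exact hmem
  obtain ⟨δ, hδ, hball⟩ := Metric.eventually_nhds_iff_ball.mp hnhds
  have hfr : ∀ s ∈ Metric.ball s₀ δ, graphMap Φ h (s, 0) ∈ frontier Ω := by
    intro s hs
    have hsW := (hball s hs).2
    rw [hΩ.isOpen.frontier_eq]
    refine ⟨?_, fun hmem => lt_irrefl _ ((graphMap_mem_iff hWΩ hsW).mp hmem)⟩
    have hc : Continuous fun t => graphMap Φ h (s, t) := by
      rw [show (fun t => graphMap Φ h (s, t)) = fun t => graphMap Φ h (s, 0) + t • Φ.symm !₂[0, -1]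
        from funext fun t => graphMap_eq_add Φ h s t]
      fun_prop
    have h1 : ∀ᶠ t in nhdsWithin (0 : ℝ) (Ioi 0), graphMap Φ h (s, t) ∈ Ω := by
      have h2 : ∀ᶠ t in nhds (0 : ℝ), graphMap Φ h (s, t) ∈ W :=
        hc.continuousAt.eventually (hW.mem_nhds hsW)
      filter_upwards [nhdsWithin_le_nhds h2, self_mem_nhdsWithin] with t ht ht0
      exact (graphMap_mem_iff hWΩ ht).mpr ht0
    exact mem_closure_of_tendsto (hc.continuousAt.tendsto.mono_left nhdsWithin_le_nhds) h1
  have hlip : LipschitzWith 1 fun x => (Φ x) 0 := by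
    refine LipschitzWith.of_dist_le_mul fun x y => ?_
    rw [NNReal.coe_one, one_mul, ← Φ.dist_map, dist_eq_norm (Φ x), Real.dist_eq]
    simpa using PiLp.norm_apply_le (Φ x - Φ y) 0
  have h1 := hlip.hausdorffMeasure_image_le zero_le_one (U ∩ frontier Ω)
  rw [hausdorffMeasure_real, ENNReal.coe_one, ENNReal.one_rpow, one_mul] at h1
  refine lt_of_lt_of_le ?_ h1
  have h2 : Metric.ball s₀ δ ⊆ (fun x => (Φ x) 0) '' (U ∩ frontier Ω) := fun s hs =>
    ⟨graphMap Φ h (s, 0), ⟨(hball s hs).1, hfr s hs⟩, by simp [graphMap]⟩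
  refine lt_of_lt_of_le ?_ (measure_mono h2)
  exact Metric.measure_ball_pos _ _ hδ

/-! ### The trace inequality -/

/-- The one-dimensional trace inequality: `|f 0|²` differs from `|f t|²` by the integral of a
derivative bounded by `|f|² + |f'|²`; then average over `t` in `[0, η]`. -/
theorem mul_sq_norm_le_integral {f : ℝ → ℂ} (hf : ContDiff ℝ 1 f) {η : ℝ} (hη : 0 < η) :
    η * ‖f 0‖ ^ 2 ≤ (1 + η) * ∫ t in (0 : ℝ)..η, (‖f t‖ ^ 2 + ‖deriv f t‖ ^ 2) := by
  have hd : Continuous (deriv f) := hf.continuous_deriv le_rfl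
  have hc : Continuous fun t => ‖f t‖ ^ 2 + ‖deriv f t‖ ^ 2 := by
    have := hf.continuous
    fun_prop
  set I := ∫ t in (0 : ℝ)..η, (‖f t‖ ^ 2 + ‖deriv f t‖ ^ 2) with hI
  have h1 : ∀ t ∈ Icc (0 : ℝ) η, ‖f 0‖ ^ 2 ≤ ‖f t‖ ^ 2 + I := by
    intro t ht
    have hcd : Continuous fun s => 2 * inner ℝ (f s) (deriv f s) := by
      have := hf.continuous
      fun_prop
    have h2 := intervalIntegral.integral_eq_sub_of_hasDerivAt (a := 0) (b := t)
      (f := fun s => ‖f s‖ ^ 2) (f' := fun s => 2 * inner ℝ (f s) (deriv f s))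
      (fun s _ => (hf.differentiable one_ne_zero s).hasDerivAt.norm_sq)
      (hcd.intervalIntegrable _ _)
    have h3 : ∫ s in (0 : ℝ)..t, -(2 * inner ℝ (f s) (deriv f s)) ≤
        ∫ s in (0 : ℝ)..t, (‖f s‖ ^ 2 + ‖deriv f s‖ ^ 2) := by
      refine intervalIntegral.integral_mono_on ht.1 (hcd.neg.intervalIntegrable _ _)
        (hc.intervalIntegrable _ _) fun s _ => ?_
      have h4 := abs_le.mp (abs_real_inner_le_norm (f s) (deriv f s))
      nlinarith [sq_nonneg (‖f s‖ - ‖deriv f s‖)]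
    have h5 : ∫ s in (0 : ℝ)..t, (‖f s‖ ^ 2 + ‖deriv f s‖ ^ 2) ≤ I :=
      intervalIntegral.integral_mono_interval le_rfl ht.1 ht.2
        (Filter.Eventually.of_forall fun s => by positivity) (hc.intervalIntegrable _ _)
    rw [intervalIntegral.integral_neg, h2] at h3
    linarith
  have h6 : ∫ _t in (0 : ℝ)..η, ‖f 0‖ ^ 2 ≤
      ∫ t in (0 : ℝ)..η, ((‖f t‖ ^ 2 + ‖deriv f t‖ ^ 2) + I) := by
    refine intervalIntegral.integral_mono_on hη.le (continuous_const.intervalIntegrable _ _)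
      ((hc.add continuous_const).intervalIntegrable _ _) fun t ht => ?_
    have := h1 t ht
    have := sq_nonneg ‖deriv f t‖
    linarith
  rw [intervalIntegral.integral_add (hc.intervalIntegrable _ _)
    (continuous_const.intervalIntegrable _ _), intervalIntegral.integral_const,
    intervalIntegral.integral_const] at h6
  simp only [sub_zero, smul_eq_mul] at h6
  linarith

/-- The density of the squared `H¹` norm. -/
def energyDensity (φ : Plane → ℂ) (x : Plane) : ℝ := ‖φ x‖ ^ 2 + ‖fderiv ℝ φ x‖ ^ 2

theorem continuous_energyDensity {φ : Plane → ℂ} (hφ : ContDiff ℝ 1 φ) :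
    Continuous (energyDensity φ) := by
  have h1 := hφ.continuous
  have h2 := hφ.continuous_fderiv (by simp)
  unfold energyDensity
  fun_prop

theorem sq_norm_graphMap_le {φ : Plane → ℂ} (hφ : ContDiff ℝ 1 φ) (Φ : Plane ≃ₗᵢ[ℝ] Plane)
    (h : ℝ → ℝ) (s : ℝ) {η : ℝ} (hη : 0 < η) :
    ENNReal.ofReal (‖φ (graphMap Φ h (s, 0))‖ ^ 2) ≤ ENNReal.ofReal ((1 + η) / η) *
      ∫⁻ t in Ioc 0 η, ENNReal.ofReal (energyDensity φ (graphMap Φ h (s, t))) := by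
  set e := Φ.symm !₂[0, -1] with he
  have hline : ∀ t, graphMap Φ h (s, t) = graphMap Φ h (s, 0) + t • e := graphMap_eq_add Φ h s
  have hc : Continuous fun t => graphMap Φ h (s, t) := by
    rw [show (fun t => graphMap Φ h (s, t)) = fun t => graphMap Φ h (s, 0) + t • e
      from funext hline]
    fun_prop
  set f : ℝ → ℂ := fun t => φ (graphMap Φ h (s, 0) + t • e) with hf
  have hfc : ContDiff ℝ 1 f := hφ.comp (by fun_prop)
  have hderiv : ∀ t, ‖deriv f t‖ ≤ ‖fderiv ℝ φ (graphMap Φ h (s, t))‖ := by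
    intro t
    have h1 : HasDerivAt (fun t : ℝ => graphMap Φ h (s, 0) + t • e) e t := by
      simpa using ((hasDerivAt_id t).smul_const e).const_add (graphMap Φ h (s, 0))
    have h2 := ((hφ.differentiable one_ne_zero _).hasFDerivAt.comp_hasDerivAt t h1).deriv
    rw [show deriv f t = _ from h2, hline t]
    refine (ContinuousLinearMap.le_opNorm _ _).trans ?_
    rw [show ‖e‖ = 1 from norm_symm_down Φ, mul_one]
  have h1 := mul_sq_norm_le_integral hfc hη
  have hQc : Continuous fun t => energyDensity φ (graphMap Φ h (s, t)) :=
    (continuous_energyDensity hφ).comp hc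
  have h2 : ∫ t in (0 : ℝ)..η, (‖f t‖ ^ 2 + ‖deriv f t‖ ^ 2) ≤
      ∫ t in (0 : ℝ)..η, energyDensity φ (graphMap Φ h (s, t)) := by
    have hd : Continuous (deriv f) := hfc.continuous_deriv le_rfl
    have hcf := hfc.continuous
    refine intervalIntegral.integral_mono_on hη.le
      (Continuous.intervalIntegrable (by fun_prop) _ _) (hQc.intervalIntegrable _ _) fun t _ => ?_
    have := hderiv t
    rw [energyDensity, hf]
    simp only
    rw [← hline t]
    gcongr
  rw [← ofReal_integral_eq_lintegral_ofReal, ← intervalIntegral.integral_of_le hη.le,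
    ← ENNReal.ofReal_mul (by positivity)]
  · refine ENNReal.ofReal_le_ofReal ?_
    have h3 : f 0 = φ (graphMap Φ h (s, 0)) := by simp [hf]
    rw [h3] at h1
    rw [div_mul_eq_mul_div, le_div_iff₀ hη, mul_comm]
    refine h1.trans ?_
    gcongr
  · exact (hQc.intervalIntegrable 0 η).1
  · exact Filter.Eventually.of_forall fun t => by
      simp only [energyDensity, Pi.zero_apply]
      positivity

/-- The one-dimensional inequality is applied on each vertical segment below the graph and
integrated over the horizontal coordinate. The coordinates preserve area, so the double integral is
at most an integral over `Ω`. -/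
theorem exists_local_trace (hΩ : IsBoundedLipschitzDomain Ω) {p : Plane} (hp : p ∈ frontier Ω) :
    ∃ N : Set Plane, IsOpen N ∧ p ∈ N ∧
      (Measure.hausdorffMeasure 1 : Measure Plane) (frontier Ω ∩ N) < ⊤ ∧
      ∃ C : NNReal, ∀ φ : Plane → ℂ, ContDiff ℝ 1 φ →
        ∫⁻ x in frontier Ω ∩ N, ENNReal.ofReal (‖φ x‖ ^ 2) ∂(Measure.hausdorffMeasure 1) ≤
          C * ∫⁻ x in Ω, ENNReal.ofReal (energyDensity φ x) := by
  obtain ⟨W, hW, hpW, Φ, K, h, hh, hWΩ⟩ := hΩ.localGraph p hp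
  obtain ⟨r, hr, hball⟩ := Metric.isOpen_iff.mp hW p hpW
  -- Half the radius, so that descending by at most `η` from the ball of radius `η` remains in `W`.
  set η := r / 2 with hη
  have hη0 : 0 < η := by positivity
  have hNW : Metric.ball p η ⊆ W := (Metric.ball_subset_ball (by linarith)).trans hball
  have hle := restrict_hausdorffMeasure_le hΩ.isOpen hW hh hWΩ hNW
  have hγc : Continuous fun s => graphMap Φ h (s, 0) := (lipschitzWith_graphMap Φ hh).continuous
  set I := (fun s => graphMap Φ h (s, 0)) ⁻¹' Metric.ball p η with hI
  have hIm : MeasurableSet I := hγc.measurable Metric.isOpen_ball.measurableSet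
  refine ⟨Metric.ball p η, Metric.isOpen_ball, Metric.mem_ball_self hη0, ?_, ?_⟩
  · have h1 := hle univ
    rw [Measure.restrict_apply_univ, Measure.smul_apply,
      Measure.map_apply hγc.measurable MeasurableSet.univ, preimage_univ,
      Measure.restrict_apply_univ] at h1
    refine h1.trans_lt (ENNReal.mul_lt_top ENNReal.coe_lt_top ?_)
    have h2 : I ⊆ Metric.ball ((Φ p) 0) η := fun s hs => by
      rw [Metric.mem_ball, Real.dist_eq]
      exact (abs_sub_le_dist_graphMap Φ h s p).trans_lt hs
    exact (measure_mono h2).trans_lt measure_ball_lt_top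
  · refine ⟨(1 + K) * Real.toNNReal ((1 + η) / η), fun φ hφ => ?_⟩
    have hφm : Measurable fun x => ENNReal.ofReal (‖φ x‖ ^ 2) := by
      have := hφ.continuous
      fun_prop
    have hQm : Measurable fun x => ENNReal.ofReal (energyDensity φ x) :=
      (continuous_energyDensity hφ).measurable.ennreal_ofReal
    have hG := measurePreserving_graphMap Φ hh.continuous
    calc ∫⁻ x in frontier Ω ∩ Metric.ball p η, ENNReal.ofReal (‖φ x‖ ^ 2)
          ∂(Measure.hausdorffMeasure 1)
        ≤ ∫⁻ x, ENNReal.ofReal (‖φ x‖ ^ 2) ∂(((1 + K : NNReal) : ENNReal) •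
            Measure.map (fun s => graphMap Φ h (s, 0)) (volume.restrict I)) :=
          lintegral_mono' hle le_rfl
      _ = ((1 + K : NNReal) : ENNReal) *
            ∫⁻ s in I, ENNReal.ofReal (‖φ (graphMap Φ h (s, 0))‖ ^ 2) := by
          rw [lintegral_smul_measure, lintegral_map hφm hγc.measurable, smul_eq_mul]
      _ ≤ ((1 + K : NNReal) : ENNReal) * ∫⁻ s in I, ENNReal.ofReal ((1 + η) / η) *
            ∫⁻ t in Ioc 0 η, ENNReal.ofReal (energyDensity φ (graphMap Φ h (s, t))) := by
          gcongr with s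
          exact sq_norm_graphMap_le hφ Φ h s hη0
      _ = ((1 + K : NNReal) : ENNReal) * (ENNReal.ofReal ((1 + η) / η) * ∫⁻ s in I,
            ∫⁻ t in Ioc 0 η, ENNReal.ofReal (energyDensity φ (graphMap Φ h (s, t)))) := by
          rw [lintegral_const_mul' _ _ ENNReal.ofReal_ne_top]
      _ ≤ ((1 + K : NNReal) : ENNReal) * (ENNReal.ofReal ((1 + η) / η) *
            ∫⁻ x in Ω, ENNReal.ofReal (energyDensity φ x)) := by
          gcongr
          have h3 := lintegral_prod (μ := volume.restrict I) (ν := volume.restrict (Ioc 0 η))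
            (fun q => ENNReal.ofReal (energyDensity φ (graphMap Φ h q)))
            (hQm.comp hG.measurable).aemeasurable
          rw [← h3, Measure.prod_restrict, ← hG.setLIntegral_comp_preimage
            hΩ.isOpen.measurableSet hQm]
          refine lintegral_mono_set ?_
          rintro ⟨s, t⟩ ⟨hs, ht⟩
          refine (graphMap_mem_iff hWΩ (hball ?_)).mpr ht.1
          rw [graphMap_eq_add, Metric.mem_ball, dist_eq_norm]
          have h4 := mem_ball_iff_norm.mp hs
          have h5 : ‖t • Φ.symm !₂[0, -1]‖ ≤ η := by
            rw [norm_smul, norm_symm_down, mul_one, Real.norm_of_nonneg ht.1.le]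
            exact ht.2
          calc ‖graphMap Φ h (s, 0) + t • Φ.symm !₂[0, -1] - p‖
              = ‖(graphMap Φ h (s, 0) - p) + t • Φ.symm !₂[0, -1]‖ := by congr 1; abel
            _ ≤ _ := norm_add_le _ _
            _ < r := by linarith
      _ = _ := by
          rw [ENNReal.coe_mul, mul_assoc]
          rfl

theorem hausdorffMeasure_frontier_lt_top (hΩ : IsBoundedLipschitzDomain Ω) :
    (Measure.hausdorffMeasure 1 : Measure Plane) (frontier Ω) < ⊤ := by
  have hcomp : IsCompact (frontier Ω) :=
    hΩ.isBounded.isCompact_closure.of_isClosed_subset isClosed_frontier frontier_subset_closure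
  choose! N hNo hxN hN using fun p (hp : p ∈ frontier Ω) => exists_local_trace hΩ hp
  obtain ⟨t, ht, htc⟩ := hcomp.elim_nhds_subcover N fun x hx => (hNo x hx).mem_nhds (hxN x hx)
  have hsub : frontier Ω ⊆ ⋃ x ∈ t, frontier Ω ∩ N x := fun y hy => by
    obtain ⟨x, hx, hyx⟩ := mem_iUnion₂.mp (htc hy)
    exact mem_iUnion₂.mpr ⟨x, hx, hy, hyx⟩
  refine (measure_mono hsub).trans_lt ((measure_biUnion_finset_le _ _).trans_lt ?_)
  exact ENNReal.sum_lt_top.mpr fun x hx => (hN x (ht x hx)).1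

theorem exists_trace_inequality (hΩ : IsBoundedLipschitzDomain Ω) :
    ∃ C : NNReal, ∀ φ : Plane → ℂ, ContDiff ℝ 1 φ →
      ∫⁻ x, ENNReal.ofReal (‖φ x‖ ^ 2) ∂(boundaryMeasure Ω) ≤
        C * ∫⁻ x in Ω, ENNReal.ofReal (energyDensity φ x) := by
  have hcomp : IsCompact (frontier Ω) :=
    hΩ.isBounded.isCompact_closure.of_isClosed_subset isClosed_frontier frontier_subset_closure
  choose! N hNo hxN hfin C hC using fun p (hp : p ∈ frontier Ω) => exists_local_trace hΩ hp
  obtain ⟨t, ht, htc⟩ := hcomp.elim_nhds_subcover N fun x hx => (hNo x hx).mem_nhds (hxN x hx)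
  have hsub : frontier Ω ⊆ ⋃ x ∈ t, frontier Ω ∩ N x := fun y hy => by
    obtain ⟨x, hx, hyx⟩ := mem_iUnion₂.mp (htc hy)
    exact mem_iUnion₂.mpr ⟨x, hx, hy, hyx⟩
  refine ⟨∑ x ∈ t, C x, fun φ hφ => ?_⟩
  calc ∫⁻ x, ENNReal.ofReal (‖φ x‖ ^ 2) ∂(boundaryMeasure Ω)
      ≤ ∫⁻ x in ⋃ x ∈ t, frontier Ω ∩ N x, ENNReal.ofReal (‖φ x‖ ^ 2)
          ∂(Measure.hausdorffMeasure 1) := lintegral_mono_set hsub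
    _ ≤ ∑ x ∈ t, ∫⁻ x in frontier Ω ∩ N x, ENNReal.ofReal (‖φ x‖ ^ 2)
          ∂(Measure.hausdorffMeasure 1) := by
        rw [← lintegral_finsetSum_measure]
        refine lintegral_mono' ?_ le_rfl
        refine Measure.le_iff.mpr fun B hB => ?_
        rw [Measure.finsetSum_apply, Measure.restrict_apply hB, inter_iUnion₂]
        refine (measure_biUnion_finset_le _ _).trans (Finset.sum_le_sum fun x _ => ?_)
        rw [Measure.restrict_apply hB]
    _ ≤ ∑ x ∈ t, C x * ∫⁻ x in Ω, ENNReal.ofReal (energyDensity φ x) :=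
        Finset.sum_le_sum fun x hx => hC x (ht x hx) φ hφ
    _ = _ := by
        rw [← Finset.sum_mul, ENNReal.ofNNReal_finsetSum]

/-! ### Slicing by parallel lines -/

/-- Eilenberg's inequality. Cover `B` nearly optimally by sets of diameter at most `1 / (n + 1)` and
count, over each `s`, the sets whose projection has `s` in its closure. The integral of this count
is at most the sum of the diameters. For large `n` any finitely many points of a fibre lie in
different sets, so the lower limit of the counts bounds the number of points, and Fatou's lemma
finishes. -/
theorem exists_slice_bound_set {π : Plane → ℝ} (hπ : LipschitzWith 1 π) (B : Set Plane) :
    ∃ N : ℝ → ENNReal, Measurable N ∧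
      (∀ s, ∑' x : π ⁻¹' {s}, B.indicator (fun _ => (1 : ENNReal)) x ≤ N s) ∧
      ∫⁻ s, N s ≤ (Measure.hausdorffMeasure 1 : Measure Plane) B := by
  classical
  by_cases hB : (Measure.hausdorffMeasure 1 : Measure Plane) B = ⊤
  · exact ⟨fun _ => ⊤, measurable_const, fun _ => le_top, by rw [hB]; exact le_top⟩
  have hcov : ∀ n : ℕ, ∃ t : ℕ → Set Plane, B ⊆ ⋃ i, t i ∧
      (∀ i, Metric.ediam (t i) ≤ ((n : ENNReal) + 1)⁻¹) ∧
      ∑' i, ⨆ _ : (t i).Nonempty, Metric.ediam (t i) ^ (1 : ℝ) <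
        (Measure.hausdorffMeasure 1 : Measure Plane) B + ((n : ENNReal) + 1)⁻¹ := by
    intro n
    have hpos : (0 : ENNReal) < ((n : ENNReal) + 1)⁻¹ := ENNReal.inv_pos.mpr (by finiteness)
    have h1 : (⨅ (t : ℕ → Set Plane) (_ : B ⊆ ⋃ i, t i)
        (_ : ∀ i, Metric.ediam (t i) ≤ ((n : ENNReal) + 1)⁻¹),
        ∑' i, ⨆ _ : (t i).Nonempty, Metric.ediam (t i) ^ (1 : ℝ)) <
        (Measure.hausdorffMeasure 1 : Measure Plane) B + ((n : ENNReal) + 1)⁻¹ := by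
      refine lt_of_le_of_lt ?_ (ENNReal.lt_add_right hB hpos.ne')
      rw [Measure.hausdorffMeasure_apply 1 B]
      exact le_iSup₂ (f := fun (r : ENNReal) (_ : 0 < r) =>
        ⨅ (t : ℕ → Set Plane) (_ : B ⊆ ⋃ i, t i) (_ : ∀ i, Metric.ediam (t i) ≤ r),
        ∑' i, ⨆ _ : (t i).Nonempty, Metric.ediam (t i) ^ (1 : ℝ)) _ hpos
    simp only [iInf_lt_iff] at h1
    obtain ⟨t, h2, h3, h4⟩ := h1
    exact ⟨t, h2, h3, h4⟩
  choose t htB htd hts using hcov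
  -- Taking closures makes the projected sets measurable without changing their diameters.
  let g : ℕ → ℝ → ENNReal := fun n s =>
    ∑' i, (closure (π '' t n i)).indicator (fun _ => (1 : ENNReal)) s
  have hgm : ∀ n, Measurable (g n) := fun n =>
    Measurable.tsum fun i => measurable_const.indicator isClosed_closure.measurableSet
  have hgi : ∀ n, ∫⁻ s, g n s ≤
      (Measure.hausdorffMeasure 1 : Measure Plane) B + ((n : ENNReal) + 1)⁻¹ := by
    intro n
    refine le_trans ?_ (hts n).le
    rw [lintegral_tsum fun i =>
      (measurable_const.indicator isClosed_closure.measurableSet).aemeasurable]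
    refine ENNReal.tsum_le_tsum fun i => ?_
    rw [lintegral_indicator isClosed_closure.measurableSet, setLIntegral_one]
    rcases (t n i).eq_empty_or_nonempty with h | h
    · rw [h]; simp
    · rw [ciSup_pos h, ENNReal.rpow_one]
      refine (Real.volume_le_diam _).trans ?_
      rw [Metric.ediam_closure]
      simpa using hπ.ediam_image_le (t n i)
  refine ⟨fun s => Filter.liminf (fun n => g n s) Filter.atTop, Measurable.liminf hgm,
    fun s => ?_, ?_⟩
  · rw [ENNReal.tsum_eq_iSup_sum]
    refine iSup_le fun F => ?_
    refine Filter.le_liminf_of_le (by isBoundedDefault) ?_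
    have hev : ∀ᶠ n : ℕ in Filter.atTop, ∀ x ∈ F, ∀ y ∈ F, x ≠ y →
        ((n : ENNReal) + 1)⁻¹ < edist (x : Plane) y := by
      refine (Filter.eventually_all_finset F).mpr fun x _ =>
        (Filter.eventually_all_finset F).mpr fun y _ => ?_
      by_cases hxy : x = y
      · exact Filter.Eventually.of_forall fun n h => absurd hxy h
      · have hpos : 0 < edist (x : Plane) y := edist_pos.mpr fun h => hxy (Subtype.ext h)
        have hlim : Filter.Tendsto (fun n : ℕ => ((n : ENNReal) + 1)⁻¹) Filter.atTop (nhds 0) := by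
          have := (Filter.tendsto_add_atTop_iff_nat 1).mpr ENNReal.tendsto_inv_nat_nhds_zero
          simpa using this
        filter_upwards [hlim.eventually (gt_mem_nhds hpos)] with n hn _
        exact hn
    filter_upwards [hev] with n hn
    have hex : ∀ x : π ⁻¹' {s}, (x : Plane) ∈ B → ∃ i, (x : Plane) ∈ t n i := fun x hx =>
      mem_iUnion.mp (htB n hx)
    choose! i hi using hex
    set F' : Finset (π ⁻¹' {s}) := F.filter fun x : π ⁻¹' {s} => (x : Plane) ∈ B with hF'
    have hinj : Set.InjOn i F' := by
      intro x hx y hy hxy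
      by_contra hne
      have hx' := Finset.mem_filter.mp hx
      have hy' := Finset.mem_filter.mp hy
      have h1 := hn x hx'.1 y hy'.1 hne
      have h2 := Metric.edist_le_ediam_of_mem (hi x hx'.2) (hxy ▸ hi y hy'.2)
      exact absurd (h2.trans (htd n _)) (not_le.mpr h1)
    calc ∑ x ∈ F, B.indicator (fun _ => (1 : ENNReal)) (x : Plane)
        = ∑ x ∈ F', (1 : ENNReal) := by
          rw [hF', Finset.sum_filter]
          rfl
      _ = ∑ x ∈ F', (closure (π '' t n (i x))).indicator (fun _ => (1 : ENNReal)) s := by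
          refine Finset.sum_congr rfl fun x hx => ?_
          have hx' := Finset.mem_filter.mp hx
          rw [indicator_of_mem]
          exact subset_closure ⟨x, hi x hx'.2, x.2⟩
      _ = ∑ j ∈ F'.image i, (closure (π '' t n j)).indicator (fun _ => (1 : ENNReal)) s := by
          rw [Finset.sum_image hinj]
      _ ≤ g n s := ENNReal.sum_le_tsum _
  · refine (lintegral_liminf_le hgm).trans ?_
    have hlim : Filter.Tendsto (fun n : ℕ => (Measure.hausdorffMeasure 1 : Measure Plane) B +
        ((n : ENNReal) + 1)⁻¹) Filter.atTop
        (nhds ((Measure.hausdorffMeasure 1 : Measure Plane) B + 0)) := by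
      refine tendsto_const_nhds.add ?_
      have := (Filter.tendsto_add_atTop_iff_nat 1).mpr ENNReal.tendsto_inv_nat_nhds_zero
      simpa using this
    rw [add_zero] at hlim
    rw [← hlim.liminf_eq]
    exact Filter.liminf_le_liminf (Filter.Eventually.of_forall hgi)

/-- An upper bound, with measurable majorant, for the integral over all `s` of the sum of `f` over
the fibre of a `1`-Lipschitz function `π` at `s`. -/
theorem exists_slice_bound {π : Plane → ℝ} (hπ : LipschitzWith 1 π) {f : Plane → ENNReal}
    (hf : Measurable f) :
    ∃ N : ℝ → ENNReal, Measurable N ∧ (∀ s, ∑' x : π ⁻¹' {s}, f x ≤ N s) ∧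
      ∫⁻ s, N s ≤ ∫⁻ x, f x ∂(Measure.hausdorffMeasure 1) := by
  refine Measurable.ennreal_induction (motive := fun f => ∃ N : ℝ → ENNReal, Measurable N ∧
    (∀ s, ∑' x : π ⁻¹' {s}, f x ≤ N s) ∧
      ∫⁻ s, N s ≤ ∫⁻ x, f x ∂(Measure.hausdorffMeasure 1)) ?_ ?_ ?_ hf
  · intro c B hB
    obtain ⟨N, hN, h1, h2⟩ := exists_slice_bound_set hπ B
    refine ⟨fun s => c * N s, hN.const_mul c, fun s => ?_, ?_⟩
    · have h3 : ∀ x : π ⁻¹' {s}, B.indicator (fun _ => c) (x : Plane) =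
          c * B.indicator (fun _ => (1 : ENNReal)) x := fun x => by
        by_cases hx : (x : Plane) ∈ B <;> simp [hx]
      simp_rw [h3]
      rw [ENNReal.tsum_mul_left]
      gcongr
      exact h1 s
    · rw [lintegral_const_mul _ hN, lintegral_indicator hB, setLIntegral_const]
      gcongr
  · intro f g _ hf hg hNf hNg
    obtain ⟨N, hN, h1, h2⟩ := hNf
    obtain ⟨M, hM, k1, k2⟩ := hNg
    refine ⟨fun s => N s + M s, hN.add hM, fun s => ?_, ?_⟩
    · simp_rw [Pi.add_apply]
      rw [ENNReal.tsum_add]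
      exact add_le_add (h1 s) (k1 s)
    · rw [lintegral_add_left hN]
      simp_rw [Pi.add_apply]
      rw [lintegral_add_left hf]
      exact add_le_add h2 k2
  · intro f hf hmono hN
    choose N hNm h1 h2 using hN
    -- The majorants chosen for the individual `f n` need not increase with `n`; the lower limit
    -- still dominates each fibre sum, and Fatou's lemma bounds its integral.
    refine ⟨fun s => Filter.liminf (fun n => N n s) Filter.atTop, Measurable.liminf hNm,
      fun s => ?_, ?_⟩
    · rw [ENNReal.tsum_eq_iSup_sum]
      refine iSup_le fun F => ?_
      rw [ENNReal.finsetSum_iSup_of_monotone (f := fun (x : π ⁻¹' {s}) n => f n x)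
        fun x i j hij => hmono hij x]
      refine iSup_le fun n => ?_
      refine Filter.le_liminf_of_le (by isBoundedDefault) ?_
      filter_upwards [Filter.eventually_ge_atTop n] with m hm
      calc ∑ x ∈ F, f n (x : Plane) ≤ ∑ x ∈ F, f m (x : Plane) :=
            Finset.sum_le_sum fun x _ => hmono hm x
        _ ≤ ∑' x : π ⁻¹' {s}, f m x := ENNReal.sum_le_tsum F
        _ ≤ N m s := h1 m s
    · refine (lintegral_liminf_le hNm).trans ?_
      refine Filter.liminf_le_of_le (by isBoundedDefault) fun b hb => ?_
      obtain ⟨n, hn⟩ := hb.exists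
      refine hn.trans ((h2 n).trans (lintegral_mono fun x => ?_))
      exact le_iSup (fun n => f n x) n

theorem inter_frontier_nonempty {X : Type*} [TopologicalSpace X] {t U : Set X}
    (ht : IsPreconnected t) (hU : IsOpen U) {x y : X} (hxt : x ∈ t) (hxU : x ∈ U) (hyt : y ∈ t)
    (hyU : y ∉ U) : (t ∩ frontier U).Nonempty := by
  by_contra hne
  refine hyU (ht.subset_of_closure_inter_subset hU ⟨x, hxt, hxU⟩ ?_ hyt)
  rintro z ⟨hz, hzt⟩
  by_contra hzU
  exact hne ⟨z, hzt, hU.frontier_eq ▸ ⟨hz, hzU⟩⟩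

/-- Each component of `U` contributes a difference of two boundary values. A frontier point ends at
most two components, and the rightmost point `m` at most one, which accounts for its coefficient.
The induction removes the largest point `a` of `F` by cutting `U` there. -/
theorem norm_setIntegral_deriv_le_aux {f : ℝ → ℂ} (hf : ContDiff ℝ 1 f) (F : Finset ℝ) :
    ∀ m, (∀ y ∈ F, y < m) → ∀ U : Set ℝ, IsOpen U → Bornology.IsBounded U →
      frontier U ⊆ insert m F → ‖∫ t in U, deriv f t‖ ≤ 2 * ∑ t ∈ F, ‖f t‖ + ‖f m‖ := by
  have hd : Continuous (deriv f) := hf.continuous_deriv le_rfl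
  have hdi : ∀ U : Set ℝ, Bornology.IsBounded U → IntegrableOn (deriv f) U := fun U hU =>
    (hd.locallyIntegrable.integrableOn_isCompact hU.isCompact_closure).mono_set subset_closure
  -- Beyond the last frontier point the set is either empty or an unbounded ray, and boundedness
  -- excludes the ray.
  have hleft : ∀ (U : Set ℝ) (m : ℝ), IsOpen U → Bornology.IsBounded U →
      (Ioi m ∩ frontier U = ∅) → U ⊆ Iic m := by
    intro U m hUo hU hfr x hx
    by_contra hxm
    rw [mem_Iic, not_le] at hxm
    have hsub : Ioi m ⊆ U := by
      by_contra hns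
      obtain ⟨y, hy, hyU⟩ := not_subset.mp hns
      obtain ⟨z, hz⟩ := inter_frontier_nonempty isPreconnected_Ioi hUo hxm hx hy hyU
      rw [hfr] at hz
      exact hz
    exact not_bddAbove_Ioi m ((hU.subset hsub).bddAbove)
  induction F using Finset.induction_on_max with
  | empty =>
    intro m _ U hUo hU hfr
    simp only [Finset.coe_empty, insert_empty_eq] at hfr
    have h1 : U ⊆ Iic m := hleft U m hUo hU (by
      ext x
      simp only [mem_inter_iff, mem_Ioi, mem_empty_iff_false, iff_false, not_and]
      exact fun h1 h2 => h1.ne' (hfr h2))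
    have h2 : U ⊆ {m} := by
      intro x hx
      by_contra hxm
      have hxlt : x < m := lt_of_le_of_ne (h1 hx) hxm
      have hsub : Iio m ⊆ U := by
        by_contra hns
        obtain ⟨y, hy, hyU⟩ := not_subset.mp hns
        obtain ⟨z, hz, hzf⟩ := inter_frontier_nonempty isPreconnected_Iio hUo hxlt hx hy hyU
        exact (mem_Iio.mp hz).ne (hfr hzf)
      exact not_bddBelow_Iio m ((hU.subset hsub).bddBelow)
    rw [setIntegral_measure_zero _ (measure_mono_null h2 (measure_singleton m))]
    simp
  | insert a F hmax ih =>
    intro m hm U hUo hU hfr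
    have ham : a < m := hm a (Finset.mem_insert_self a F)
    have haF : a ∉ F := fun h => lt_irrefl _ (hmax a h)
    have h1 : U ⊆ Iic m := hleft U m hUo hU (by
      ext x
      simp only [mem_inter_iff, mem_Ioi, mem_empty_iff_false, iff_false, not_and]
      intro h1 h2
      rcases hfr h2 with h | h
      · exact h1.ne' h
      · exact lt_asymm h1 (hm x h))
    -- After the cut, `a` takes the role of the rightmost point. The piece to the right of `a` is,
    -- up to a null set, either empty or the whole interval from `a` to `m`.
    have h2 := ih a hmax (U ∩ Iio a) (hUo.inter isOpen_Iio) (hU.subset inter_subset_left) (by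
      refine (frontier_inter_subset _ _).trans (union_subset ?_ ?_)
      · rw [closure_Iio]
        rintro x ⟨hx, hxa⟩
        rcases hfr hx with h | h
        · exact absurd (h ▸ hxa : m ≤ a) (not_le.mpr ham)
        · simpa using h
      · rw [frontier_Iio]
        rintro x ⟨_, hx⟩
        exact Or.inl hx)
    have h3 : ‖∫ t in U ∩ Ici a, deriv f t‖ ≤ ‖f a‖ + ‖f m‖ := by
      by_cases hsub : Ioo a m ⊆ U
      · have hae : (U ∩ Ici a : Set ℝ) =ᵐ[volume] Ioc a m := by
          have h4 : (U ∩ Ici a) \ Ioc a m ⊆ {a, m} := by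
            rintro x ⟨⟨hx, hxa⟩, hxn⟩
            rcases eq_or_lt_of_le (mem_Ici.mp hxa) with h | h
            · exact Or.inl h.symm
            · exact absurd ⟨h, h1 hx⟩ hxn
          have h5 : Ioc a m \ (U ∩ Ici a) ⊆ {a, m} := by
            rintro x ⟨hx, hxn⟩
            rcases eq_or_lt_of_le hx.2 with h | h
            · exact Or.inr h
            · exact absurd ⟨hsub ⟨hx.1, h⟩, hx.1.le⟩ hxn
          have h0 : volume ({a, m} : Set ℝ) = 0 := (Set.toFinite _).measure_zero _
          exact ae_eq_set.mpr ⟨measure_mono_null h4 h0, measure_mono_null h5 h0⟩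
        rw [setIntegral_congr_set hae, ← intervalIntegral.integral_of_le ham.le,
          intervalIntegral.integral_deriv_eq_sub
            (fun t _ => hf.differentiable one_ne_zero t) (hd.intervalIntegrable _ _)]
        exact (norm_sub_le _ _).trans (add_comm _ _).le
      · have hnull : U ∩ Ici a ⊆ {a, m} := by
          rintro x ⟨hx, hxa⟩
          by_contra hne
          simp only [mem_insert_iff, mem_singleton_iff, not_or] at hne
          have hxI : x ∈ Ioo a m :=
            ⟨lt_of_le_of_ne hxa (Ne.symm hne.1), lt_of_le_of_ne (h1 hx) hne.2⟩
          obtain ⟨y, hy, hyU⟩ := not_subset.mp hsub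
          obtain ⟨z, hz, hzf⟩ := inter_frontier_nonempty isPreconnected_Ioo hUo
            hxI hx hy hyU
          rcases hfr hzf with h | h
          · exact hz.2.ne h
          · rcases Finset.mem_insert.mp h with h | h
            · exact hz.1.ne' h
            · exact lt_asymm hz.1 (hmax z h)
        rw [setIntegral_measure_zero _
          (measure_mono_null hnull ((Set.toFinite {a, m}).measure_zero _))]
        simp only [norm_zero]
        positivity
    have h4 : ∫ t in U, deriv f t =
        (∫ t in U ∩ Iio a, deriv f t) + ∫ t in U ∩ Ici a, deriv f t := by
      rw [← setIntegral_union _ (hUo.measurableSet.inter measurableSet_Ici)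
        ((hdi U hU).mono_set inter_subset_left) ((hdi U hU).mono_set inter_subset_left),
        ← inter_union_distrib_left, Iio_union_Ici, inter_univ]
      exact Disjoint.mono inter_subset_right inter_subset_right
        (disjoint_left.mpr fun x h1 h2 => not_le.mpr (mem_Iio.mp h1) (mem_Ici.mp h2))
    rw [h4, Finset.sum_insert haF]
    refine (norm_add_le _ _).trans ?_
    linarith

theorem norm_setIntegral_deriv_le {f : ℝ → ℂ} (hf : ContDiff ℝ 1 f) (F : Finset ℝ) {U : Set ℝ}
    (hUo : IsOpen U) (hU : Bornology.IsBounded U) (hfr : frontier U ⊆ F) :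
    ‖∫ t in U, deriv f t‖ ≤ 2 * ∑ t ∈ F, ‖f t‖ := by
  rcases F.eq_empty_or_nonempty with rfl | hF
  · have h1 : IsClopen U := by
      rw [isClopen_iff_frontier_eq_empty]
      simpa using hfr
    rcases isClopen_iff.mp h1 with h | h
    · simp [h]
    · rw [h] at hU
      exact absurd hU fun hb => noncompact_univ ℝ
        (hb.isCompact_closure.of_isClosed_subset isClosed_univ subset_closure)
  · set m := F.max' hF with hm
    have hmF : m ∈ F := F.max'_mem hF
    have h := norm_setIntegral_deriv_le_aux hf (F.erase m) m
      (fun y hy => lt_of_le_of_ne (F.le_max' y (Finset.mem_of_mem_erase hy))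
        (Finset.ne_of_mem_erase hy)) U hUo hU (by
        rw [← Finset.coe_insert, Finset.insert_erase hmF]
        exact hfr)
    rw [← Finset.add_sum_erase F _ hmF]
    have := norm_nonneg (f m)
    linarith

theorem exists_isometry_symm_down {e : Plane} (he : ‖e‖ = 1) :
    ∃ Φ : Plane ≃ₗᵢ[ℝ] Plane, Φ.symm !₂[0, -1] = e := by
  have h : ‖(!₂[0, -1] : Plane)‖ = ‖e‖ := by
    rw [he, EuclideanSpace.norm_eq]
    simp
  refine ⟨(Submodule.reflection (ℝ ∙ (!₂[0, -1] - e))ᗮ).symm, ?_⟩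
  rw [LinearIsometryEquiv.symm_symm]
  exact Submodule.reflection_sub h

theorem lipschitzWith_coord (Φ : Plane ≃ₗᵢ[ℝ] Plane) : LipschitzWith 1 fun x => (Φ x) 0 := by
  refine LipschitzWith.of_dist_le_mul fun x y => ?_
  rw [NNReal.coe_one, one_mul, ← Φ.dist_map, dist_eq_norm (Φ x), Real.dist_eq]
  simpa using PiLp.norm_apply_le (Φ x - Φ y) 0

/-- In coordinates whose vertical axis is parallel to the segments, each segment projects to a
single point. -/
theorem countable_image_of_parallel {Γ : Set Plane} (hpar : ContainedInParallelSegments Γ) :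
    ∃ e : Plane, ‖e‖ = 1 ∧ ∀ Φ : Plane ≃ₗᵢ[ℝ] Plane, Φ.symm !₂[0, -1] = e →
      ((fun x => (Φ x) 0) '' Γ).Countable := by
  obtain ⟨e, he, S, hS, hseg, hsub⟩ := hpar
  have hen : ‖e‖ ≠ 0 := norm_ne_zero_iff.mpr he
  refine ⟨‖e‖⁻¹ • e, by rw [norm_smul, norm_inv, norm_norm, inv_mul_cancel₀ hen], fun Φ hΦ => ?_⟩
  have hΦe : (Φ e) 0 = 0 := by
    have h1 : e = ‖e‖ • Φ.symm !₂[0, -1] := by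
      rw [hΦ, smul_smul, mul_inv_cancel₀ hen, one_smul]
    rw [h1, map_smul, Φ.apply_symm_apply]
    simp
  refine Countable.mono (image_mono hsub) ?_
  rw [sUnion_eq_biUnion, image_iUnion₂]
  refine hS.biUnion fun s hs => ?_
  obtain ⟨p, c, rfl⟩ := hseg s hs
  refine (countable_singleton ((Φ p) 0)).mono ?_
  rintro _ ⟨x, hx, rfl⟩
  rw [segment_eq_image_lineMap] at hx
  obtain ⟨t, -, rfl⟩ := hx
  simp [AffineMap.lineMap_apply, hΦe]

/-- A substitute for the divergence theorem, in which `Γ` would drop out because the field is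
tangential there. On almost every line in the given direction the one-dimensional estimate applies,
and the line avoids `Γ`; the slice bound integrates the result. The factor `2` is harmless, since
the bound is eventually applied to traces vanishing off `Γ`. -/
theorem norm_setIntegral_fderiv_le (hΩo : IsOpen Ω) (hΩb : Bornology.IsBounded Ω)
    (hfin : (Measure.hausdorffMeasure 1 : Measure Plane) (frontier Ω) < ⊤)
    {Γ : Set Plane} (hΓ : MeasurableSet Γ) {Φ : Plane ≃ₗᵢ[ℝ] Plane}
    (hc : ((fun x => (Φ x) 0) '' Γ).Countable) {φ : Plane → ℂ} (hφ : ContDiff ℝ 1 φ) :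
    ‖∫ x in Ω, fderiv ℝ φ x (Φ.symm !₂[0, -1])‖ₑ ≤
      2 * ∫⁻ x in frontier Ω \ Γ, ‖φ x‖ₑ ∂(Measure.hausdorffMeasure 1) := by
  set e := Φ.symm !₂[0, -1] with he
  set G := graphMap Φ 0 with hGdef
  have hG : MeasurePreserving G volume volume := measurePreserving_graphMap Φ continuous_const
  have hGline : ∀ s t, G (s, t) = G (s, 0) + t • e := graphMap_eq_add Φ 0
  have hGc : Continuous G := by
    rw [hGdef]
    unfold graphMap
    refine Φ.symm.continuous.comp ((PiLp.continuous_toLp 2 _).comp ?_)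
    refine continuous_pi fun i => ?_
    fin_cases i
    · exact continuous_fst
    · exact continuous_const.sub continuous_snd
  have hGΦ : ∀ q : ℝ × ℝ, (Φ (G q)) 0 = q.1 ∧ (Φ (G q)) 1 = -q.2 := fun q => by
    rw [hGdef, graphMap, Φ.apply_symm_apply]
    simp
  have hGinj : Function.Injective G := fun q q' h => by
    have h1 := hGΦ q
    rw [h] at h1
    exact Prod.ext (h1.1.symm.trans (hGΦ q').1) (neg_injective (h1.2.symm.trans (hGΦ q').2))
  have hGemb : MeasurableEmbedding G := hGc.measurableEmbedding hGinj
  have hfrm : MeasurableSet (frontier Ω) := isClosed_frontier.measurableSet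
  have hφc := hφ.continuous
  have hdc : Continuous fun x => fderiv ℝ φ x e :=
    (hφ.continuous_fderiv one_ne_zero).clm_apply continuous_const
  obtain ⟨N, hN, hN1, hN2⟩ := exists_slice_bound (lipschitzWith_coord Φ)
    (f := (frontier Ω \ Γ).indicator fun x => ‖φ x‖ₑ)
    (hφc.enorm.measurable.indicator (hfrm.diff hΓ))
  -- Slicing the constant `1` shows that almost every line meets the boundary, which has finite
  -- length, in finitely many points.
  obtain ⟨M, hM, hM1, hM2⟩ := exists_slice_bound (lipschitzWith_coord Φ)
    (f := (frontier Ω).indicator fun _ => 1) (measurable_const.indicator hfrm)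
  rw [lintegral_indicator (hfrm.diff hΓ)] at hN2
  rw [lintegral_indicator hfrm, setLIntegral_one] at hM2
  have hMfin : ∀ᵐ s, M s < ⊤ := ae_lt_top hM (hM2.trans_lt hfin).ne
  have hsΓ : ∀ᵐ s : ℝ, s ∉ (fun x => (Φ x) 0) '' Γ := hc.ae_notMem volume
  set g : ℝ × ℝ → ℂ := (G ⁻¹' Ω).indicator fun q => fderiv ℝ φ (G q) e with hg
  have hgi : Integrable g (volume.prod volume) := by
    have h1 : IntegrableOn (fun x => fderiv ℝ φ x e) Ω :=
      (hdc.locallyIntegrable.integrableOn_isCompact hΩb.isCompact_closure).mono_set subset_closure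
    have h2 := (hG.integrable_comp_emb hGemb).mpr
      ((integrable_indicator_iff hΩo.measurableSet).mpr h1)
    exact h2
  have h1 : ∫ x in Ω, fderiv ℝ φ x e = ∫ s, ∫ t, g (s, t) := by
    rw [← integral_prod _ hgi, ← integral_indicator hΩo.measurableSet,
      ← hG.integral_comp hGemb]
    rfl
  have hslice : ∀ᵐ s, ‖∫ t, g (s, t)‖ₑ ≤ 2 * N s := by
    filter_upwards [hMfin, hsΓ] with s hs hsn
    set U : Set ℝ := {t | G (s, t) ∈ Ω} with hU
    have hline : Continuous fun t => G (s, t) := hGc.comp (by fun_prop)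
    have hUo : IsOpen U := hΩo.preimage hline
    have hUb : Bornology.IsBounded U := by
      have h2 : Bornology.IsBounded (Φ '' Ω) := Φ.lipschitz.isBounded_image hΩb
      obtain ⟨R, hR⟩ := h2.subset_closedBall 0
      refine (Metric.isBounded_closedBall (x := (0 : ℝ)) (r := R)).subset fun t ht => ?_
      have h3 := hR ⟨_, ht, rfl⟩
      rw [mem_closedBall_zero_iff] at h3 ⊢
      have h4 := PiLp.norm_apply_le (Φ (G (s, t))) 1
      rw [(hGΦ (s, t)).2, norm_neg] at h4
      exact h4.trans h3
    have hfinset : {x : (fun x => (Φ x) 0) ⁻¹' {s} | (x : Plane) ∈ frontier Ω}.Finite := by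
      have h2 := ENNReal.finite_const_le_of_tsum_ne_top ((hM1 s).trans_lt hs).ne one_ne_zero
      refine h2.subset fun x hx => ?_
      have hx' : (x : Plane) ∈ frontier Ω := hx
      rw [mem_ofPred_eq, indicator_of_mem hx']
    set F := hfinset.toFinset with hF
    have hval : ∀ x : (fun x => (Φ x) 0) ⁻¹' {s}, G (s, -(Φ x) 1) = x := fun x => by
      apply Φ.injective
      ext i
      fin_cases i
      · exact (hGΦ _).1.trans x.2.symm
      · exact (hGΦ _).2.trans (neg_neg _)
    classical
    let T : Finset ℝ := F.image fun x : (fun x => (Φ x) 0) ⁻¹' {s} => -(Φ (x : Plane)) 1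
    have hfr : frontier U ⊆ T := by
      intro t ht
      have h2 : G (s, t) ∈ frontier Ω := hline.frontier_preimage_subset Ω ht
      refine Finset.mem_coe.mpr (Finset.mem_image.mpr ⟨⟨G (s, t), (hGΦ _).1⟩, ?_, ?_⟩)
      · exact hfinset.mem_toFinset.mpr h2
      · simp [(hGΦ (s, t)).2]
    set f : ℝ → ℂ := fun t => φ (G (s, 0) + t • e) with hf
    have hfG : ∀ t, f t = φ (G (s, t)) := fun t => by rw [hf, hGline s t]
    have hfc : ContDiff ℝ 1 f := hφ.comp (by fun_prop)
    have hderiv : ∀ t, deriv f t = fderiv ℝ φ (G (s, t)) e := by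
      intro t
      have h1 : HasDerivAt (fun t : ℝ => G (s, 0) + t • e) e t := by
        simpa using ((hasDerivAt_id t).smul_const e).const_add (G (s, 0))
      have h2 := ((hφ.differentiable one_ne_zero _).hasFDerivAt.comp_hasDerivAt t h1).deriv
      rw [show deriv f t = _ from h2, hGline s t]
    have hint : ∫ t, g (s, t) = ∫ t in U, deriv f t := by
      rw [← integral_indicator hUo.measurableSet]
      congr 1
      ext t
      by_cases ht : t ∈ U
      · rw [indicator_of_mem ht, hderiv, hg, indicator_of_mem (by exact ht)]
      · rw [indicator_of_notMem ht, hg, indicator_of_notMem (by exact ht)]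
    have h3 := norm_setIntegral_deriv_le hfc T hUo hUb hfr
    have h4 : ∑ t ∈ T, ‖f t‖ₑ ≤ N s := by
      refine le_trans ?_ (hN1 s)
      rw [Finset.sum_image fun x _ y _ hxy => by
        have hx := hval x
        have hy := hval y
        simp only at hxy
        rw [hxy] at hx
        exact Subtype.ext (hx.symm.trans hy)]
      refine le_trans (Finset.sum_le_sum fun x hx => ?_) (ENNReal.sum_le_tsum F)
      have hxf : (x : Plane) ∈ frontier Ω := hfinset.mem_toFinset.mp hx
      have hxΓ : (x : Plane) ∉ Γ := fun h => hsn ⟨x, h, x.2⟩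
      rw [hfG, hval, indicator_of_mem (show (x : Plane) ∈ frontier Ω \ Γ from ⟨hxf, hxΓ⟩)]
    rw [hint]
    calc ‖∫ t in U, deriv f t‖ₑ ≤ ENNReal.ofReal (2 * ∑ t ∈ T, ‖f t‖) := by
          rw [← ofReal_norm]
          exact ENNReal.ofReal_le_ofReal h3
      _ = 2 * ∑ t ∈ T, ‖f t‖ₑ := by
          rw [ENNReal.ofReal_mul zero_le_two, ENNReal.ofReal_sum_of_nonneg fun _ _ => norm_nonneg _]
          simp
      _ ≤ 2 * N s := by gcongr
  rw [h1]
  calc ‖∫ s, ∫ t, g (s, t)‖ₑ ≤ ∫⁻ s, ‖∫ t, g (s, t)‖ₑ := enorm_integral_le_lintegral_enorm _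
    _ ≤ ∫⁻ s, 2 * N s := lintegral_mono_ae hslice
    _ = 2 * ∫⁻ s, N s := lintegral_const_mul _ hN
    _ ≤ _ := by gcongr

/-! ### Closedness of the form domains -/

theorem isClosed_sobolevH1 (Ω : Set Plane) :
    IsClosed (sobolevH1 Ω : Set (L2 Ω × (Fin 2 → L2 Ω))) := by
  have h : (sobolevH1 Ω : Set (L2 Ω × (Fin 2 → L2 Ω))) =
      ⋂ (φ : Plane → ℂ) (_ : IsTestFunction Ω φ) (i : Fin 2),
        {p | ∫ x in Ω, partialDeriv i φ x * p.1 x = -∫ x in Ω, φ x * p.2 i x} := by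
    ext p
    simp only [mem_iInter]
    rfl
  rw [h]
  refine isClosed_iInter fun φ => isClosed_iInter fun hφ => isClosed_iInter fun i => ?_
  have h1 : MemLp (partialDeriv i φ) 2 (volume.restrict Ω) :=
    (hφ.continuous_partialDeriv i).memLp_of_hasCompactSupport (hφ.hasCompactSupport_partialDeriv i)
  have h2 : MemLp φ 2 (volume.restrict Ω) := hφ.memLp _
  simp_rw [← pairing_apply h1, ← pairing_apply h2]
  exact isClosed_eq (by fun_prop) (by fun_prop)

/-- The pair `(φ, ∇φ)` for a compactly supported smooth function `φ`. -/
def smoothPair (Ω : Set Plane) {φ : Plane → ℂ} (hφ : ContDiff ℝ ∞ φ) (hc : HasCompactSupport φ) :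
    L2 Ω × (Fin 2 → L2 Ω) :=
  ((hφ.continuous.memLp_of_hasCompactSupport hc).toLp φ,
    fun i => (((hφ.continuous_fderiv (by simp)).clm_apply
      continuous_const).memLp_of_hasCompactSupport (hc.fderiv_apply (𝕜 := ℝ) _)).toLp
        (partialDeriv i φ))

theorem smoothPair_fst_ae {φ : Plane → ℂ} (hφ : ContDiff ℝ ∞ φ) (hc : HasCompactSupport φ) :
    (smoothPair Ω hφ hc).1 =ᵐ[volume.restrict Ω] φ :=
  (hφ.continuous.memLp_of_hasCompactSupport hc).coeFn_toLp

theorem smoothPair_snd_ae {φ : Plane → ℂ} (hφ : ContDiff ℝ ∞ φ) (hc : HasCompactSupport φ)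
    (i : Fin 2) : (smoothPair Ω hφ hc).2 i =ᵐ[volume.restrict Ω] partialDeriv i φ := by
  have h : MemLp (partialDeriv i φ) 2 (volume.restrict Ω) :=
    ((hφ.continuous_fderiv (by simp)).clm_apply
      continuous_const).memLp_of_hasCompactSupport (hc.fderiv_apply (𝕜 := ℝ) _)
  exact h.coeFn_toLp

/-- The test function has its support in `Ω`, so the integrals extend to the whole plane, where
integration by parts has no boundary term. -/
theorem smoothPair_mem_sobolevH1 {φ : Plane → ℂ} (hφ : ContDiff ℝ ∞ φ)
    (hc : HasCompactSupport φ) : smoothPair Ω hφ hc ∈ sobolevH1 Ω := by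
  intro ψ hψ i
  have h1 : ∫ x in Ω, partialDeriv i ψ x * (smoothPair Ω hφ hc).1 x =
      ∫ x in Ω, partialDeriv i ψ x * φ x := by
    refine integral_congr_ae ?_
    filter_upwards [smoothPair_fst_ae hφ hc] with x hx
    rw [hx]
  have h2 : ∫ x in Ω, ψ x * (smoothPair Ω hφ hc).2 i x = ∫ x in Ω, ψ x * partialDeriv i φ x := by
    refine integral_congr_ae ?_
    filter_upwards [smoothPair_snd_ae hφ hc i] with x hx
    rw [hx]
  have hψ0 : ∀ x, x ∉ Ω → ψ x = 0 := fun x hx =>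
    image_eq_zero_of_notMem_tsupport fun h => hx (hψ.tsupport_subset h)
  have hdψ0 : ∀ x, x ∉ Ω → partialDeriv i ψ x = 0 := fun x hx => by
    have h : fderiv ℝ ψ x = 0 :=
      image_eq_zero_of_notMem_tsupport fun h =>
        hx (hψ.tsupport_subset (tsupport_fderiv_subset ℝ h))
    rw [partialDeriv, h]
    rfl
  rw [h1, h2, setIntegral_eq_integral_of_forall_compl_eq_zero fun x hx => by
    rw [hdψ0 x hx, zero_mul], setIntegral_eq_integral_of_forall_compl_eq_zero fun x hx => by
    rw [hψ0 x hx, zero_mul]]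
  have hdφ : Continuous (partialDeriv i φ) :=
    (hφ.continuous_fderiv (by simp)).clm_apply continuous_const
  rw [eq_neg_iff_add_eq_zero, ← neg_eq_iff_add_eq_zero]
  refine (integral_mul_fderiv_eq_neg_fderiv_mul_of_integrable ?_ ?_ ?_ ?_ ?_).symm
  · exact (((hψ.continuous_partialDeriv i).mul hφ.continuous).integrable_of_hasCompactSupport
      (hψ.hasCompactSupport_partialDeriv i).mul_right)
  · exact (hψ.contDiff.continuous.mul hdφ).integrable_of_hasCompactSupport
      hψ.hasCompactSupport.mul_right
  · exact (hψ.contDiff.continuous.mul hφ.continuous).integrable_of_hasCompactSupport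
      hψ.hasCompactSupport.mul_right
  · exact fun x _ => hψ.contDiff.differentiable (by simp) x
  · exact fun x _ => hφ.differentiable (by simp) x

theorem isFiniteMeasure_boundaryMeasure (hΩ : IsBoundedLipschitzDomain Ω) :
    IsFiniteMeasure (boundaryMeasure Ω) :=
  ⟨by
    rw [boundaryMeasure, Measure.restrict_apply_univ]
    exact hausdorffMeasure_frontier_lt_top hΩ⟩

theorem smoothPair_mem_traceGraph (hΩ : IsBoundedLipschitzDomain Ω) {φ : Plane → ℂ}
    (hφ : ContDiff ℝ ∞ φ) (hc : HasCompactSupport φ) :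
    ∃ τ : L2Boundary Ω, τ =ᵐ[boundaryMeasure Ω] φ ∧ (smoothPair Ω hφ hc, τ) ∈ traceGraph Ω := by
  have := isFiniteMeasure_boundaryMeasure hΩ
  have hm : MemLp φ 2 (boundaryMeasure Ω) := hφ.continuous.memLp_of_hasCompactSupport hc
  exact ⟨hm.toLp φ, hm.coeFn_toLp, Submodule.le_topologicalClosure _
    ⟨φ, hφ, hc, smoothPair_fst_ae hφ hc, smoothPair_snd_ae hφ hc, hm.coeFn_toLp⟩⟩

theorem IsTestFunction.smoothPair_mem_sobolevH1ZeroOn (hΩ : IsBoundedLipschitzDomain Ω)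
    {φ : Plane → ℂ} (hφ : IsTestFunction Ω φ) (Γ : Set Plane) :
    smoothPair Ω hφ.contDiff hφ.hasCompactSupport ∈ sobolevH1ZeroOn Ω Γ := by
  obtain ⟨τ, hτ, hmem⟩ := smoothPair_mem_traceGraph hΩ hφ.contDiff hφ.hasCompactSupport
  refine ⟨smoothPair_mem_sobolevH1 _ _, τ, hmem, ?_⟩
  have h1 : ∀ᵐ x ∂(boundaryMeasure Ω), x ∈ frontier Ω :=
    ae_restrict_mem isClosed_frontier.measurableSet
  filter_upwards [hτ, h1] with x hx hxf _
  rw [hx]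
  refine image_eq_zero_of_notMem_tsupport fun h => ?_
  rw [hΩ.isOpen.frontier_eq] at hxf
  exact hxf.2 (hφ.tsupport_subset h)

theorem ofReal_norm_sq_eq_lintegral {μ : Measure Plane} (f : Lp ℂ 2 μ) :
    ENNReal.ofReal (‖f‖ ^ 2) = ∫⁻ x, ENNReal.ofReal (‖f x‖ ^ 2) ∂μ := by
  have h1 : ‖f‖ ^ 2 = ∫ x, ‖f x‖ ^ 2 ∂μ := by
    have h2 := inner_self_eq_norm_sq_to_K (𝕜 := ℂ) f
    rw [L2.inner_def] at h2
    simp only [inner_self_eq_norm_sq_to_K] at h2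
    apply Complex.ofReal_injective
    push_cast
    refine h2.symm.trans ?_
    have h3 := integral_ofReal (𝕜 := ℂ) (μ := μ) (f := fun x => ‖f x‖ ^ 2)
    refine Eq.trans ?_ h3
    refine integral_congr_ae (Filter.Eventually.of_forall fun x => ?_)
    simp
  rw [h1]
  exact ofReal_integral_eq_lintegral_ofReal (Lp.memLp f).norm.integrable_sq
    (Filter.Eventually.of_forall fun x => by positivity)

theorem energyDensity_le (φ : Plane → ℂ) (x : Plane) :
    energyDensity φ x ≤
      2 * (‖φ x‖ ^ 2 + ‖partialDeriv 0 φ x‖ ^ 2 + ‖partialDeriv 1 φ x‖ ^ 2) := by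
  have h1 : ‖fderiv ℝ φ x‖ ≤ ‖partialDeriv 0 φ x‖ + ‖partialDeriv 1 φ x‖ := by
    refine ContinuousLinearMap.opNorm_le_bound _ (by positivity) fun z => ?_
    have h : ∀ i, ‖(z i : ℂ)‖ ≤ ‖z‖ := fun i => by
      rw [Complex.norm_real]
      exact PiLp.norm_apply_le z i
    rw [fderiv_eq_sum_partialDeriv]
    refine (norm_add_le _ _).trans ?_
    rw [norm_mul, norm_mul, add_mul, mul_comm ‖partialDeriv 0 φ x‖, mul_comm ‖partialDeriv 1 φ x‖]
    exact add_le_add (mul_le_mul_of_nonneg_right (h 0) (norm_nonneg _))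
      (mul_le_mul_of_nonneg_right (h 1) (norm_nonneg _))
  have h2 : ‖fderiv ℝ φ x‖ ^ 2 ≤ (‖partialDeriv 0 φ x‖ + ‖partialDeriv 1 φ x‖) ^ 2 := by gcongr
  unfold energyDensity
  nlinarith [sq_nonneg (‖partialDeriv 0 φ x‖ - ‖partialDeriv 1 φ x‖), sq_nonneg ‖φ x‖]

/-- The trace inequality survives the closure that defines `traceGraph`. It shows in particular that
an element of `H¹(Ω)` has at most one trace. -/
theorem exists_trace_bound (hΩ : IsBoundedLipschitzDomain Ω) :
    ∃ C : NNReal, ∀ w ∈ traceGraph Ω, ‖w.2‖ ≤ C * ‖w.1‖ := by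
  obtain ⟨C, hC⟩ := exists_trace_inequality hΩ
  -- The energy density is at most twice a sum of three squares, and each of the three norms is
  -- bounded by the maximum norm of the pair.
  refine ⟨NNReal.sqrt (6 * C), ?_⟩
  have hcl : IsClosed {w : (L2 Ω × (Fin 2 → L2 Ω)) × L2Boundary Ω |
      ‖w.2‖ ≤ NNReal.sqrt (6 * C) * ‖w.1‖} := isClosed_le (by fun_prop) (by fun_prop)
  refine fun w hw => closure_minimal ?_ hcl hw
  rintro ⟨⟨u, g⟩, τ⟩ ⟨φ, hφ, hc, hu, hg, hτ⟩
  simp only at hu hg hτ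
  have h1 := hC φ (hφ.of_le (by exact_mod_cast le_top))
  have h2 : ∫⁻ x in Ω, ENNReal.ofReal (energyDensity φ x) ≤
      ENNReal.ofReal (2 * (‖u‖ ^ 2 + ‖g 0‖ ^ 2 + ‖g 1‖ ^ 2)) := by
    have hm : ∀ f : L2 Ω, AEMeasurable (fun x => ENNReal.ofReal (‖f x‖ ^ 2))
        (volume.restrict Ω) := fun f =>
      ((Lp.aestronglyMeasurable f).norm.aemeasurable.pow_const 2).ennreal_ofReal
    have hm' : AEMeasurable (fun x => ENNReal.ofReal (‖u x‖ ^ 2) + ENNReal.ofReal (‖g 0 x‖ ^ 2))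
        (volume.restrict Ω) := (hm u).add (hm (g 0))
    rw [ENNReal.ofReal_mul zero_le_two, ENNReal.ofReal_add (by positivity) (by positivity),
      ENNReal.ofReal_add (by positivity) (by positivity), ofReal_norm_sq_eq_lintegral,
      ofReal_norm_sq_eq_lintegral, ofReal_norm_sq_eq_lintegral, ← lintegral_add_left' (hm u),
      ← lintegral_add_left' hm', ← lintegral_const_mul' _ _ (by simp)]
    refine lintegral_mono_ae ?_
    filter_upwards [hu, hg 0, hg 1] with x h3 h4 h5
    rw [h3, h4, h5, ← ENNReal.ofReal_add (by positivity) (by positivity),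
      ← ENNReal.ofReal_add (by positivity) (by positivity), ← ENNReal.ofReal_mul zero_le_two]
    exact ENNReal.ofReal_le_ofReal (energyDensity_le φ x)
  have h3 : ENNReal.ofReal (‖τ‖ ^ 2) = ∫⁻ x, ENNReal.ofReal (‖φ x‖ ^ 2) ∂(boundaryMeasure Ω) := by
    rw [ofReal_norm_sq_eq_lintegral]
    refine lintegral_congr_ae ?_
    filter_upwards [hτ] with x hx
    rw [hx]
  have h4 : ENNReal.ofReal (‖τ‖ ^ 2) ≤
      ENNReal.ofReal (C * (2 * (‖u‖ ^ 2 + ‖g 0‖ ^ 2 + ‖g 1‖ ^ 2))) := by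
    rw [h3, ENNReal.ofReal_mul C.coe_nonneg, ENNReal.ofReal_coe_nnreal]
    exact h1.trans (by gcongr)
  rw [ENNReal.ofReal_le_ofReal_iff (by positivity)] at h4
  have hu' : ‖u‖ ≤ ‖(u, g)‖ := norm_fst_le (u, g)
  have hg' : ∀ i, ‖g i‖ ≤ ‖(u, g)‖ := fun i => (norm_le_pi_norm g i).trans (norm_snd_le (u, g))
  simp only [mem_ofPred_eq]
  refine abs_le_of_sq_le_sq' ?_ (by positivity) |>.2
  rw [mul_pow, Real.coe_sqrt, Real.sq_sqrt (by positivity)]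
  push_cast
  have h5 : ‖u‖ ^ 2 ≤ ‖(u, g)‖ ^ 2 := by gcongr
  have h6 : ‖g 0‖ ^ 2 ≤ ‖(u, g)‖ ^ 2 := by gcongr; exact hg' 0
  have h7 : ‖g 1‖ ^ 2 ≤ ‖(u, g)‖ ^ 2 := by gcongr; exact hg' 1
  calc ‖τ‖ ^ 2 ≤ C * (2 * (‖u‖ ^ 2 + ‖g 0‖ ^ 2 + ‖g 1‖ ^ 2)) := h4
    _ ≤ C * (2 * (‖(u, g)‖ ^ 2 + ‖(u, g)‖ ^ 2 + ‖(u, g)‖ ^ 2)) := by gcongr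
    _ = 6 * C * ‖(u, g)‖ ^ 2 := by ring

theorem restrict_eq_zero_iff {μ : Measure Plane} {S : Set Plane} (hS : MeasurableSet S)
    (τ : Lp ℂ 2 μ) :
    LpToLpRestrictCLM Plane ℂ ℂ μ 2 S τ = 0 ↔ ∀ᵐ x ∂μ, x ∈ S → τ x = 0 := by
  rw [Lp.eq_zero_iff_ae_eq_zero, ← ae_restrict_iff' hS]
  have h := LpToLpRestrictCLM_coeFn (𝕜 := ℂ) S τ
  constructor
  · intro h0
    filter_upwards [h, h0] with x h1 h2
    rw [← h1, h2]
    rfl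
  · intro h0
    filter_upwards [h, h0] with x h1 h2
    rw [h1, h2]
    rfl

/-- The part of the trace graph with trace zero on `Γ` is closed, hence complete. By the trace bound
its projection to `(u, ∇u)` is bounded below, so the image is closed. -/
theorem isClosed_sobolevH1ZeroOn (hΩ : IsBoundedLipschitzDomain Ω) {Γ : Set Plane}
    (hΓ : MeasurableSet Γ) :
    IsClosed (sobolevH1ZeroOn Ω Γ : Set (L2 Ω × (Fin 2 → L2 Ω))) := by
  obtain ⟨C, hC⟩ := exists_trace_bound hΩ
  let R := LpToLpRestrictCLM Plane ℂ ℂ (boundaryMeasure Ω) 2 Γ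
  let Z : Submodule ℂ ((L2 Ω × (Fin 2 → L2 Ω)) × L2Boundary Ω) :=
    traceGraph Ω ⊓ (LinearMap.ker R.toLinearMap).comap (LinearMap.snd ℂ _ _)
  have hZ : IsClosed (Z : Set ((L2 Ω × (Fin 2 → L2 Ω)) × L2Boundary Ω)) := by
    refine (Submodule.isClosed_topologicalClosure _).inter ?_
    exact isClosed_eq (R.continuous.comp continuous_snd) continuous_const
  have : CompleteSpace Z := hZ.completeSpace_coe
  let f : Z →L[ℂ] (L2 Ω × (Fin 2 → L2 Ω)) := ContinuousLinearMap.fst ℂ _ _ ∘L Z.subtypeL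
  have hf : AntilipschitzWith (1 + C) f := by
    refine f.antilipschitz_of_bound fun w => ?_
    have h1 := hC w w.2.1
    have h2 : ‖w‖ = max ‖(w : (L2 Ω × (Fin 2 → L2 Ω)) × L2Boundary Ω).1‖
      ‖(w : (L2 Ω × (Fin 2 → L2 Ω)) × L2Boundary Ω).2‖ := rfl
    have h3 : f w = (w : (L2 Ω × (Fin 2 → L2 Ω)) × L2Boundary Ω).1 := rfl
    rw [h2, h3]
    push_cast
    have h4 := norm_nonneg (w : (L2 Ω × (Fin 2 → L2 Ω)) × L2Boundary Ω).1
    have h5 : 0 ≤ (C : ℝ) * ‖(w : (L2 Ω × (Fin 2 → L2 Ω)) × L2Boundary Ω).1‖ := by positivity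
    exact max_le (by linarith) (by linarith)
  have hr := hf.isClosed_range f.uniformContinuous
  convert (isClosed_sobolevH1 Ω).inter hr using 1
  ext p
  constructor
  · rintro ⟨hp, τ, hτ, h0⟩
    exact ⟨hp, ⟨⟨(p, τ), hτ, (restrict_eq_zero_iff hΓ τ).mpr h0⟩, rfl⟩⟩
  · rintro ⟨hp, ⟨⟨⟨q, τ⟩, hτ, h0⟩, rfl⟩⟩
    exact ⟨hp, τ, hτ, (restrict_eq_zero_iff hΓ τ).mp h0⟩

/-! ### The Hilbert space structure of the form domain -/

/-- The Hilbert space `L²(Ω) ⊕ L²(Ω)²`, which contains `H¹(Ω)` isometrically. -/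
abbrev PairSpace (Ω : Set Plane) : Type := WithLp 2 (L2 Ω × PiLp 2 fun _ : Fin 2 => L2 Ω)

/-- The identification of the Hilbert space `PairSpace Ω` with the product space. -/
def pairEquiv (Ω : Set Plane) : PairSpace Ω ≃L[ℂ] (L2 Ω × (Fin 2 → L2 Ω)) :=
  (WithLp.prodContinuousLinearEquiv 2 ℂ _ _).trans
    ((ContinuousLinearEquiv.refl ℂ (L2 Ω)).prodCongr
      (PiLp.continuousLinearEquiv 2 ℂ fun _ : Fin 2 => L2 Ω))

theorem inner_pairSpace (x y : PairSpace Ω) :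
    inner ℂ x y = inner ℂ (pairEquiv Ω x).1 (pairEquiv Ω y).1 +
      ∑ i, inner ℂ ((pairEquiv Ω x).2 i) ((pairEquiv Ω y).2 i) := by
  rw [WithLp.prod_inner_apply, PiLp.inner_apply]
  rfl

/-- The embedding of `H¹(Ω)` into `L²(Ω)`. -/
def pairFst (Ω : Set Plane) : PairSpace Ω →L[ℂ] L2 Ω :=
  ContinuousLinearMap.fst ℂ _ _ ∘L (pairEquiv Ω).toContinuousLinearMap

theorem pairFst_apply (x : PairSpace Ω) : pairFst Ω x = (pairEquiv Ω x).1 := rfl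

/-- A subspace of the product space, as a subspace of the Hilbert space `PairSpace Ω`. -/
def hilbertSubspace (V : Submodule ℂ (L2 Ω × (Fin 2 → L2 Ω))) : Submodule ℂ (PairSpace Ω) :=
  V.comap (pairEquiv Ω).toLinearEquiv.toLinearMap

theorem mem_hilbertSubspace {V : Submodule ℂ (L2 Ω × (Fin 2 → L2 Ω))} {x : PairSpace Ω} :
    x ∈ hilbertSubspace V ↔ pairEquiv Ω x ∈ V := Iff.rfl

theorem isClosed_hilbertSubspace {V : Submodule ℂ (L2 Ω × (Fin 2 → L2 Ω))}
    (hV : IsClosed (V : Set (L2 Ω × (Fin 2 → L2 Ω)))) :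
    IsClosed (hilbertSubspace V : Set (PairSpace Ω)) :=
  hV.preimage (pairEquiv Ω).continuous

theorem inner_eq_integral_of_ae {ψ : Plane → ℂ} {f : L2 Ω} (hf : f =ᵐ[volume.restrict Ω] ψ)
    (u : L2 Ω) : inner ℂ f u = ∫ x in Ω, starRingEnd ℂ (ψ x) * u x := by
  rw [L2.inner_def]
  refine integral_congr_ae ?_
  filter_upwards [hf] with x hx
  rw [hx, RCLike.inner_apply, mul_comm]

/-- Uniqueness of the weak gradient; it makes the embedding of the form domain into `L²(Ω)`
injective. -/
theorem snd_eq_zero_of_mem_sobolevH1 (hΩ : IsOpen Ω) {p : L2 Ω × (Fin 2 → L2 Ω)}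
    (hp : p ∈ sobolevH1 Ω) (h : p.1 = 0) : p.2 = 0 := by
  funext i
  refine norm_le_zero_iff.mp (norm_le_of_forall_test hΩ _ le_rfl fun φ hφ => ?_)
  have h1 := hp φ hφ i
  rw [h, integral_mul_zero, zero_eq_neg] at h1
  rw [h1, norm_zero, zero_mul]

theorem partialDeriv_conj {φ : Plane → ℂ} (hφ : Differentiable ℝ φ) (i : Fin 2) (x : Plane) :
    partialDeriv i (fun y => starRingEnd ℂ (φ y)) x = starRingEnd ℂ (partialDeriv i φ x) := by
  have h := (Complex.conjCLE.toContinuousLinearMap.hasFDerivAt (x := φ x)).comp x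
    (hφ x).hasFDerivAt
  rw [partialDeriv]
  have h' : fderiv ℝ (fun y => starRingEnd ℂ (φ y)) x =
    Complex.conjCLE.toContinuousLinearMap ∘L fderiv ℝ φ x := h.fderiv
  rw [h']
  rfl

theorem IsTestFunction.partialDeriv {φ : Plane → ℂ} (hφ : IsTestFunction Ω φ) (i : Fin 2) :
    IsTestFunction Ω (partialDeriv i φ) where
  contDiff := (hφ.contDiff.fderiv_right (m := ∞) (by simp)).clm_apply contDiff_const
  hasCompactSupport := hφ.hasCompactSupport_partialDeriv i
  tsupport_subset :=
    (tsupport_fderiv_apply_subset ℝ _).trans hφ.tsupport_subset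

theorem laplacian_eq_sum_partialDeriv {φ : Plane → ℂ} (hφ : ContDiff ℝ ∞ φ) (x : Plane) :
    Laplacian.laplacian φ x = ∑ i, partialDeriv i (partialDeriv i φ) x := by
  rw [InnerProductSpace.laplacian_eq_iteratedFDeriv_orthonormalBasis φ
    (EuclideanSpace.basisFun (Fin 2) ℝ)]
  refine Finset.sum_congr rfl fun i _ => ?_
  rw [iteratedFDeriv_two_apply]
  have h : DifferentiableAt ℝ (fderiv ℝ φ) x :=
    (hφ.fderiv_right (m := ∞) (by simp)).differentiable (by simp) x
  unfold partialDeriv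
  rw [fderiv_clm_apply h (differentiableAt_const _)]
  simp

/-- The form equation, tested with conjugates of test functions, becomes the distributional equation
after moving the gradient of `u` back onto the test function. -/
theorem mem_weakLaplaceGraph_of_forall_test {p : L2 Ω × (Fin 2 → L2 Ω)} (hp : p ∈ sobolevH1 Ω)
    {f : L2 Ω} (h : ∀ (φ : Plane → ℂ) (hφ : IsTestFunction Ω φ),
      ∑ i, inner ℂ ((smoothPair Ω hφ.contDiff hφ.hasCompactSupport).2 i) (p.2 i) =
        inner ℂ (smoothPair Ω hφ.contDiff hφ.hasCompactSupport).1 f) :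
    (p.1, f) ∈ weakLaplaceGraph Ω := by
  intro φ hφ
  have h1 := h _ hφ.conj
  rw [inner_eq_integral_of_ae (smoothPair_fst_ae _ _)] at h1
  have h2 : ∀ i, inner ℂ ((smoothPair Ω hφ.conj.contDiff hφ.conj.hasCompactSupport).2 i) (p.2 i) =
      -∫ x in Ω, partialDeriv i (partialDeriv i φ) x * p.1 x := fun i => by
    rw [inner_eq_integral_of_ae (smoothPair_snd_ae _ _ i), hp _ (hφ.partialDeriv i) i, neg_neg]
    simp_rw [partialDeriv_conj (hφ.contDiff.differentiable (by simp)), Complex.conj_conj]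
  simp_rw [h2, Complex.conj_conj] at h1
  simp_rw [laplacian_eq_sum_partialDeriv hφ.contDiff, Finset.sum_mul]
  rw [integral_finsetSum _ fun i _ => integrable_mul_of_compactSupport
    ((hφ.partialDeriv i).continuous_partialDeriv i)
    ((hφ.partialDeriv i).hasCompactSupport_partialDeriv i) p.1, ← h1, Finset.sum_neg_distrib,
    neg_neg]

/-! ### Eigenspaces of the operators as eigenspaces of the forms -/

section Eigenspaces

variable {K : Type} [NormedAddCommGroup K] [InnerProductSpace ℂ K]

/-- Vanishing of the normal derivative pairing against `V` is the weak eigenvalue equation; adding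
the `L²` inner product to both sides turns it into the equation of `formEig`. The distributional
condition is then automatic because `V` contains the test functions. -/
theorem eigenspace_eq_map_formEig (ι : K →ₗᵢ[ℂ] PairSpace Ω)
    {V : Submodule ℂ (L2 Ω × (Fin 2 → L2 Ω))} (hV : ∀ p, p ∈ V ↔ ∃ k, pairEquiv Ω (ι k) = p)
    (hV1 : V ≤ sobolevH1 Ω) (hV0 : ∀ (φ : Plane → ℂ) (hφ : IsTestFunction Ω φ),
      smoothPair Ω hφ.contDiff hφ.hasCompactSupport ∈ V) (t : ℝ) :
    eigenspace (laplaceOperator Ω V V) t =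
      (formEig (pairFst Ω ∘L ι.toContinuousLinearMap) t).map
        (pairFst Ω ∘L ι.toContinuousLinearMap).toLinearMap := by
  have key : ∀ x y : K, inner ℂ y x = ((t : ℂ) + 1) *
      inner ℂ (pairEquiv Ω (ι y)).1 (pairEquiv Ω (ι x)).1 ↔
      (∑ i, inner ℂ ((pairEquiv Ω (ι y)).2 i) ((pairEquiv Ω (ι x)).2 i)) =
        inner ℂ (pairEquiv Ω (ι y)).1 ((t : ℂ) • (pairEquiv Ω (ι x)).1) := fun x y => by
    rw [← ι.inner_map_map, inner_pairSpace, inner_smul_right]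
    constructor <;> intro h <;> linear_combination h
  ext u
  constructor
  · rintro ⟨-, g, hg, h⟩
    obtain ⟨x, hx⟩ := (hV _).mp hg
    refine ⟨x, fun y => (key x y).mpr ?_, congrArg Prod.fst hx⟩
    have h1 := h _ ((hV _).mpr ⟨y, rfl⟩)
    rw [normalDerivPairing, sub_eq_zero] at h1
    rw [hx]
    exact h1
  · rintro ⟨x, hx, rfl⟩
    have hxV : pairEquiv Ω (ι x) ∈ V := (hV _).mpr ⟨x, rfl⟩
    have h : ∀ q ∈ V, (∑ i, inner ℂ (q.2 i) ((pairEquiv Ω (ι x)).2 i)) =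
        inner ℂ q.1 ((t : ℂ) • (pairEquiv Ω (ι x)).1) := by
      intro q hq
      obtain ⟨y, rfl⟩ := (hV q).mp hq
      exact (key x y).mp (hx y)
    exact ⟨mem_weakLaplaceGraph_of_forall_test (hV1 hxV) fun φ hφ => h _ (hV0 φ hφ),
      (pairEquiv Ω (ι x)).2, hxV, fun q hq => sub_eq_zero.mpr (h q hq)⟩

theorem injective_pairFst_comp (hΩ : IsOpen Ω) (ι : K →ₗᵢ[ℂ] PairSpace Ω)
    (h : ∀ k, pairEquiv Ω (ι k) ∈ sobolevH1 Ω) :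
    Function.Injective (pairFst Ω ∘L ι.toContinuousLinearMap) := by
  refine (injective_iff_map_eq_zero _).mpr fun x hx => ?_
  have h1 : (pairEquiv Ω (ι x)).1 = 0 := hx
  have h2 := snd_eq_zero_of_mem_sobolevH1 hΩ (h x) h1
  have h3 : pairEquiv Ω (ι x) = 0 := Prod.ext h1 h2
  rw [map_eq_zero_iff _ (pairEquiv Ω).injective, map_eq_zero_iff _ ι.injective] at h3
  exact h3

theorem isEigenvalueSequence_iff (hΩ : IsOpen Ω) (ι : K →ₗᵢ[ℂ] PairSpace Ω)
    {V : Submodule ℂ (L2 Ω × (Fin 2 → L2 Ω))} (hV : ∀ p, p ∈ V ↔ ∃ k, pairEquiv Ω (ι k) = p)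
    (hV1 : V ≤ sobolevH1 Ω) (hV0 : ∀ (φ : Plane → ℂ) (hφ : IsTestFunction Ω φ),
      smoothPair Ω hφ.contDiff hφ.hasCompactSupport ∈ V) (s : ℕ → ℝ) :
    IsEigenvalueSequence (laplaceOperator Ω V V) s ↔
      IsFormEigSeq (pairFst Ω ∘L ι.toContinuousLinearMap) s := by
  refine and_congr_right fun _ => forall_congr' fun t => ?_
  have hinj : Function.Injective (pairFst Ω ∘L ι.toContinuousLinearMap).toLinearMap :=
    injective_pairFst_comp hΩ ι fun k => hV1 ((hV _).mpr ⟨k, rfl⟩)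
  rw [eigenspace_eq_map_formEig ι hV hV1 hV0, Cardinal.lift_id,
    (Submodule.equivMapOfInjective _ hinj (formEig _ t)).rank_eq]

end Eigenspaces

/-! ### The spectrum is discrete -/

section Discrete

variable {K : Type} [NormedAddCommGroup K] [InnerProductSpace ℂ K]

theorem norm_sq_pairSpace (x : PairSpace Ω) :
    ‖x‖ ^ 2 = ‖(pairEquiv Ω x).1‖ ^ 2 + ∑ i, ‖(pairEquiv Ω x).2 i‖ ^ 2 := by
  have h := inner_pairSpace x x
  simp only [inner_self_eq_norm_sq_to_K] at h
  apply Complex.ofReal_injective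
  push_cast
  exact h

theorem norm_fst_le_norm (x : PairSpace Ω) : ‖(pairEquiv Ω x).1‖ ≤ ‖x‖ := by
  refine abs_le_of_sq_le_sq' ?_ (norm_nonneg _) |>.2
  rw [norm_sq_pairSpace]
  exact le_add_of_nonneg_right (Finset.sum_nonneg fun i _ => by positivity)

theorem norm_snd_le_norm (x : PairSpace Ω) (i : Fin 2) : ‖(pairEquiv Ω x).2 i‖ ≤ ‖x‖ := by
  refine abs_le_of_sq_le_sq' ?_ (norm_nonneg _) |>.2
  rw [norm_sq_pairSpace]
  have h := Finset.single_le_sum (f := fun i => ‖(pairEquiv Ω x).2 i‖ ^ 2)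
    (fun i _ => by positivity) (Finset.mem_univ i)
  exact h.trans (le_add_of_nonneg_left (by positivity))

/-- Rellich's theorem for a Lipschitz domain. -/
theorem isCompactOperator_pairFst_comp (hΩ : IsBoundedLipschitzDomain Ω)
    (ι : K →ₗᵢ[ℂ] PairSpace Ω) (h : ∀ k, pairEquiv Ω (ι k) ∈ sobolevH1 Ω) :
    IsCompactOperator (pairFst Ω ∘L ι.toContinuousLinearMap) := by
  refine isCompactOperator_of_le_finite _ fun ε hε => ?_
  obtain ⟨n, F, hF⟩ := exists_functionals hΩ.isBounded hΩ.isOpen hΩ.hasLocalShifts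
    (show 0 < ε / 3 by positivity)
  refine ⟨n, fun j => F j ∘L (pairFst Ω ∘L ι.toContinuousLinearMap), fun x => ?_⟩
  refine (hF _ (h x)).trans ?_
  have h0 := norm_fst_le_norm (ι x)
  have h1 := norm_snd_le_norm (ι x) 0
  have h2 := norm_snd_le_norm (ι x) 1
  rw [ι.norm_map] at h0 h1 h2
  refine add_le_add ?_ le_rfl
  calc ε / 3 * (‖(pairEquiv Ω (ι x)).1‖ + ‖(pairEquiv Ω (ι x)).2 0‖ + ‖(pairEquiv Ω (ι x)).2 1‖)
      ≤ ε / 3 * (‖x‖ + ‖x‖ + ‖x‖) := by gcongr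
    _ = ε * ‖x‖ := by ring

theorem exists_isTestFunction_seq (hΩ : IsOpen Ω) (hne : Ω.Nonempty) :
    ∃ φ : ℕ → Plane → ℂ, (∀ n, IsTestFunction Ω (φ n)) ∧ (∀ n, ∃ x ∈ Ω, φ n x ≠ 0) ∧
      ∀ m n, m ≠ n → ∀ x, φ m x = 0 ∨ φ n x = 0 := by
  obtain ⟨z, hz⟩ := hne
  have : Infinite Ω := (infinite_of_mem_nhds z (hΩ.mem_nhds hz)).to_subtype
  obtain ⟨U, hU, hUo, hUd⟩ := exists_seq_infinite_isOpen_pairwise_disjoint Ω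
  have h : ∀ n, ∃ φ : Plane → ℂ, ContDiff ℝ ∞ φ ∧ HasCompactSupport φ ∧
      tsupport φ ⊆ (↑) '' U n ∧ ∃ x ∈ Ω, φ x ≠ 0 := fun n => by
    obtain ⟨x, hx⟩ := (hU n).nonempty
    obtain ⟨f, hf1, hf2, hf3, -, hf4⟩ := exists_contDiff_tsupport_subset (n := ⊤)
      ((hΩ.isOpenMap_subtype_val _ (hUo n)).mem_nhds (mem_image_of_mem _ hx))
    refine ⟨fun y => (f y : ℂ), Complex.ofRealCLM.contDiff.comp hf3,
      hf2.comp_left Complex.ofReal_zero, ?_, x, x.2, ?_⟩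
    · refine (closure_mono ?_).trans hf1
      intro y hy h0
      exact hy (by simp [h0])
    · simp [hf4]
  choose φ h1 h2 h3 h4 using h
  refine ⟨φ, fun n => ⟨h1 n, h2 n, (h3 n).trans (by rintro _ ⟨y, -, rfl⟩; exact y.2)⟩, h4,
    fun m n hmn x => ?_⟩
  by_contra! hx
  obtain ⟨y, hy, rfl⟩ := h3 m (subset_tsupport _ hx.1)
  obtain ⟨w, hw, hwy⟩ := h3 n (subset_tsupport _ hx.2)
  rw [Subtype.coe_injective hwy] at hw
  exact Set.disjoint_left.mp (hUd hmn) hy hw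

theorem not_finiteDimensional_of_smoothPair_mem (hΩ : IsOpen Ω) (hne : Ω.Nonempty)
    (ι : K →ₗᵢ[ℂ] PairSpace Ω) (hV0 : ∀ (φ : Plane → ℂ) (hφ : IsTestFunction Ω φ),
      ∃ k, pairEquiv Ω (ι k) = smoothPair Ω hφ.contDiff hφ.hasCompactSupport) :
    ¬ FiniteDimensional ℂ K := by
  intro hfd
  obtain ⟨φ, hφ, hφ0, hφd⟩ := exists_isTestFunction_seq hΩ hne
  choose x hx using fun n => hV0 (φ n) (hφ n)
  have hae : ∀ n, pairFst Ω (ι (x n)) =ᵐ[volume.restrict Ω] φ n := fun n => by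
    rw [pairFst_apply, hx]
    exact smoothPair_fst_ae _ _
  have hli : LinearIndependent ℂ fun n => pairFst Ω (ι (x n)) := by
    refine linearIndependent_of_ne_zero_of_inner_eq_zero (fun n h0 => ?_) fun m n hmn => ?_
    · obtain ⟨y, hy, hy0⟩ := hφ0 n
      have h1 := hae n
      rw [h0] at h1
      have h2 : φ n =ᵐ[volume.restrict Ω] fun _ => 0 := h1.symm.trans (Lp.coeFn_zero _ _ _)
      exact hy0 (Measure.eqOn_open_of_ae_eq h2 hΩ (hφ n).contDiff.continuous.continuousOn
        continuousOn_const hy)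
    · change inner ℂ (pairFst Ω (ι (x m))) (pairFst Ω (ι (x n))) = 0
      rw [inner_eq_integral_of_ae (hae m)]
      refine integral_eq_zero_of_ae ?_
      filter_upwards [hae n] with y hy
      rw [hy]
      rcases hφd m n hmn y with h | h <;> simp [h]
  have hli' : LinearIndependent ℂ x :=
    LinearIndependent.of_comp (pairFst Ω ∘L ι.toContinuousLinearMap).toLinearMap hli
  exact (Set.infinite_range_of_injective hli'.injective).not_finite hli'.linearIndepOn_id.setFinite

end Discrete

/-! ### The Dirichlet condition of the mixed Laplacian -/

theorem IsRelOpenInBoundary.measurableSet {Γ : Set Plane} (h : IsRelOpenInBoundary Ω Γ) :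
    MeasurableSet Γ := by
  obtain ⟨U, hU, rfl⟩ := h
  exact hU.measurableSet.inter isClosed_frontier.measurableSet

theorem sobolevH1ZeroOn_congr {Γ Γ' : Set Plane}
    (h : ∀ᵐ x ∂(boundaryMeasure Ω), x ∈ Γ ↔ x ∈ Γ') :
    sobolevH1ZeroOn Ω Γ = sobolevH1ZeroOn Ω Γ' := by
  ext p
  refine and_congr_right fun _ => exists_congr fun τ => and_congr_right fun _ => ?_
  constructor <;> intro h0 <;> filter_upwards [h, h0] with x h1 h2 h3
  · exact h2 (h1.mpr h3)
  · exact h2 (h1.mp h3)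

theorem IsBoundarySplitting.ae_mem_union {ΓD ΓN : Set Plane} (h : IsBoundarySplitting Ω ΓD ΓN) :
    ∀ᵐ x ∂(boundaryMeasure Ω), x ∈ frontier Ω ∧ (x ∈ ΓD ∨ x ∈ ΓN) := by
  have h1 : ∀ᵐ x ∂(boundaryMeasure Ω), x ∈ frontier Ω :=
    ae_restrict_mem isClosed_frontier.measurableSet
  filter_upwards [h1, measure_eq_zero_iff_ae_notMem.mp h.null] with x hx hn
  exact ⟨hx, by_contra fun hc => hn ⟨hx, hc⟩⟩

/-- Relative openness of `ΓD` separates it from the closure of `ΓN`, so the two parts of the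
boundary agree up to a null set. The space used to test the normal derivative is thus the form
domain itself. -/
theorem IsBoundarySplitting.sobolevH1ZeroOn_eq {ΓD ΓN : Set Plane}
    (h : IsBoundarySplitting Ω ΓD ΓN) :
    sobolevH1ZeroOn Ω (frontier Ω \ closure ΓN) = sobolevH1ZeroOn Ω ΓD := by
  obtain ⟨U, hU, hUD⟩ := h.relOpenD
  obtain ⟨U', -, hUN⟩ := h.relOpenN
  refine sobolevH1ZeroOn_congr ?_
  filter_upwards [h.ae_mem_union] with x ⟨hx, hDN⟩
  constructor
  · rintro ⟨-, h2⟩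
    exact hDN.resolve_right fun hN => h2 (subset_closure hN)
  · refine fun hD => ⟨hx, fun hcl => ?_⟩
    rw [hUD] at hD
    obtain ⟨y, hyU, hyN⟩ := mem_closure_iff.mp hcl U hU hD.1
    have hyf : y ∈ frontier Ω := by
      rw [hUN] at hyN
      exact hyN.2
    exact (Set.disjoint_iff_inter_eq_empty.mpr h.disjoint).le_bot ⟨hUD ▸ ⟨hyU, hyf⟩, hyN⟩

/-! ### Plane waves -/

/-- The plane wave with wave vector `c • e`. -/
def planeWave (e : Plane) (c : ℝ) (x : Plane) : ℂ :=
  Complex.exp (((c * inner ℝ e x : ℝ) : ℂ) * Complex.I)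

theorem norm_planeWave (e : Plane) (c : ℝ) (x : Plane) : ‖planeWave e c x‖ = 1 :=
  Complex.norm_exp_ofReal_mul_I _

theorem conj_planeWave (e : Plane) (c : ℝ) (x : Plane) :
    starRingEnd ℂ (planeWave e c x) = planeWave e (-c) x := by
  rw [planeWave, planeWave, ← Complex.exp_conj]
  congr 1
  simp

theorem contDiff_planeWave (e : Plane) (c : ℝ) : ContDiff ℝ ∞ (planeWave e c) := by
  refine ContDiff.cexp (ContDiff.mul ?_ contDiff_const)
  exact Complex.ofRealCLM.contDiff.comp (contDiff_const.mul (contDiff_const.inner ℝ contDiff_id))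

theorem fderiv_planeWave (e : Plane) (c : ℝ) (x z : Plane) :
    fderiv ℝ (planeWave e c) x z = Complex.I * c * (inner ℝ e z : ℝ) * planeWave e c x := by
  have h1 : HasFDerivAt (fun y : Plane => c * inner ℝ e y) (c • innerSL ℝ e) x :=
    ((innerSL ℝ e).hasFDerivAt).const_mul c
  have h2 := ((Complex.ofRealCLM.hasFDerivAt.comp x h1).mul_const Complex.I).cexp
  have h3 : fderiv ℝ (planeWave e c) x = _ := h2.fderiv
  rw [h3]
  simp [planeWave]
  ring

/-- Smooth elements of the trace graph are required to have compact support, which a plane wave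
lacks; the cutoff equals one near the closure of `Ω`. -/
theorem exists_cutoff_planeWave (hΩ : Bornology.IsBounded Ω) (e : Plane) (c : ℝ) :
    ∃ φ : Plane → ℂ, ContDiff ℝ ∞ φ ∧ HasCompactSupport φ ∧
      ∀ x ∈ closure Ω, φ x = planeWave e c x ∧ fderiv ℝ φ x = fderiv ℝ (planeWave e c) x := by
  obtain ⟨R, hR⟩ := hΩ.closure.subset_ball 0
  let χ : ContDiffBump (0 : Plane) := ⟨max R 1, max R 1 + 1, by positivity, by linarith⟩
  refine ⟨fun x => (χ x : ℂ) * planeWave e c x,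
    (Complex.ofRealCLM.contDiff.comp χ.contDiff).mul (contDiff_planeWave e c),
    (χ.hasCompactSupport.comp_left Complex.ofReal_zero).mul_right, fun x hx => ?_⟩
  have hxR : x ∈ Metric.ball (0 : Plane) R := hR hx
  have h : ∀ y ∈ Metric.ball (0 : Plane) R, (χ y : ℂ) * planeWave e c y = planeWave e c y := by
    intro y hy
    rw [χ.one_of_mem_closedBall, Complex.ofReal_one, one_mul]
    exact Metric.ball_subset_closedBall (Metric.ball_subset_ball (le_max_left _ _) hy)
  exact ⟨h x hxR, Filter.EventuallyEq.fderiv_eq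
    (Filter.eventuallyEq_of_mem (Metric.isOpen_ball.mem_nhds hxR) h)⟩

/-- Weighting with a plane wave whose wave vector is parallel to `Γ`, only the part of the boundary
off `Γ` contributes to Green's identity. -/
theorem norm_setIntegral_planeWave_mul_le (hΩ : IsBoundedLipschitzDomain Ω)
    {Γ : Set Plane} (hΓ : MeasurableSet Γ) {Φ : Plane ≃ₗᵢ[ℝ] Plane}
    (hc : ((fun x => (Φ x) 0) '' Γ).Countable) {e : Plane} (he : ‖e‖ = 1)
    (hΦ : Φ.symm !₂[0, -1] = e) (c : ℝ) {φ : Plane → ℂ} (hφ : ContDiff ℝ ∞ φ) :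
    ‖∫ x in Ω, starRingEnd ℂ (planeWave e c x) * (fderiv ℝ φ x e - Complex.I * c * φ x)‖ₑ ≤
      2 * ∫⁻ x in frontier Ω \ Γ, ‖φ x‖ₑ ∂(Measure.hausdorffMeasure 1) := by
  have h := norm_setIntegral_fderiv_le hΩ.isOpen hΩ.isBounded (hausdorffMeasure_frontier_lt_top hΩ)
    hΓ hc (φ := fun x => planeWave e (-c) x * φ x)
    (((contDiff_planeWave e (-c)).mul hφ).of_le (by exact_mod_cast le_top))
  rw [hΦ] at h
  -- The product rule: `∂ₑ (conj v · φ) = conj v · (∂ₑ φ - i c φ)` for the wave `v`, using `‖e‖ =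
  -- 1`; on the boundary the factor `conj v` has modulus one.
  convert h using 3
  · refine funext fun x => ?_
    rw [fderiv_fun_mul ((contDiff_planeWave e (-c)).differentiable (by simp) x)
      (hφ.differentiable (by simp) x), _root_.add_apply, _root_.smul_apply, _root_.smul_apply,
      fderiv_planeWave, real_inner_self_eq_norm_sq, he, conj_planeWave]
    simp only [smul_eq_mul]
    push_cast
    ring
  · refine funext fun x => ?_
    rw [enorm_mul, ← ofReal_norm (planeWave e (-c) x), norm_planeWave, ENNReal.ofReal_one, one_mul]

/-- The boundary length is finite, so the `L¹` bound weakens to an `L²` bound. Both sides are then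
continuous on the product space, and the estimate extends from smooth functions to the whole trace
graph. -/
theorem exists_norm_inner_planeWave_le (hΩ : IsBoundedLipschitzDomain Ω)
    {Γ : Set Plane} (hΓ : MeasurableSet Γ) {Φ : Plane ≃ₗᵢ[ℝ] Plane}
    (hc : ((fun x => (Φ x) 0) '' Γ).Countable) {e : Plane} (he : ‖e‖ = 1)
    (hΦ : Φ.symm !₂[0, -1] = e) (c : ℝ) {v : L2 Ω} (hv : v =ᵐ[volume.restrict Ω] planeWave e c) :
    ∃ C : NNReal, ∀ w ∈ traceGraph Ω,
      ‖inner ℂ v (dirGrad w.1.2 e - (Complex.I * c) • w.1.1)‖ ≤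
        C * ‖LpToLpRestrictCLM Plane ℂ ℂ (boundaryMeasure Ω) 2 (frontier Ω \ Γ) w.2‖ := by
  set S := frontier Ω \ Γ with hS
  have hSm : MeasurableSet S := isClosed_frontier.measurableSet.diff hΓ
  set ν := (boundaryMeasure Ω).restrict S with hν
  have hν' : ν = (Measure.hausdorffMeasure 1 : Measure Plane).restrict S := by
    rw [hν, boundaryMeasure, Measure.restrict_restrict hSm,
      inter_eq_self_of_subset_left sdiff_subset]
  have := isFiniteMeasure_boundaryMeasure hΩ
  set m : ENNReal := ν univ ^ (1 / (1 : ENNReal).toReal - 1 / (2 : ENNReal).toReal) with hm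
  have hmt : m ≠ ⊤ := ENNReal.rpow_ne_top_of_nonneg (by norm_num) (measure_ne_top _ _)
  refine ⟨2 * m.toNNReal, ?_⟩
  have hcl : IsClosed {w : (L2 Ω × (Fin 2 → L2 Ω)) × L2Boundary Ω |
      ‖inner ℂ v (dirGrad w.1.2 e - (Complex.I * c) • w.1.1)‖ ≤
        (2 * m.toNNReal : NNReal) * ‖LpToLpRestrictCLM Plane ℂ ℂ (boundaryMeasure Ω) 2 S w.2‖} := by
    unfold dirGrad
    exact isClosed_le (by fun_prop) (by fun_prop)
  refine fun w hw => closure_minimal ?_ hcl hw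
  rintro ⟨⟨u, g⟩, τ⟩ ⟨φ, hφ, -, hu, hg, hτ⟩
  simp only at hu hg hτ
  have h1 := norm_setIntegral_planeWave_mul_le hΩ hΓ hc he hΦ c hφ
  have h2 : inner ℂ v (dirGrad g e - (Complex.I * c) • u) =
      ∫ x in Ω, starRingEnd ℂ (planeWave e c x) * (fderiv ℝ φ x e - Complex.I * c * φ x) := by
    rw [inner_eq_integral_of_ae hv]
    refine integral_congr_ae ?_
    unfold dirGrad
    filter_upwards [Lp.coeFn_sub ((e 0 : ℂ) • g 0 + (e 1 : ℂ) • g 1) ((Complex.I * c) • u),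
      Lp.coeFn_add ((e 0 : ℂ) • g 0) ((e 1 : ℂ) • g 1), Lp.coeFn_smul (e 0 : ℂ) (g 0),
      Lp.coeFn_smul (e 1 : ℂ) (g 1), Lp.coeFn_smul (Complex.I * c) u, hu, hg 0, hg 1]
      with x k1 k2 k3 k4 k5 k6 k7 k8
    rw [k1, Pi.sub_apply, k2, Pi.add_apply, k3, k4, k5, Pi.smul_apply, Pi.smul_apply, Pi.smul_apply,
      k6, k7, k8, fderiv_eq_sum_partialDeriv]
    rfl
  have h3 : ∫⁻ x in S, ‖φ x‖ₑ ∂(Measure.hausdorffMeasure 1) ≤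
      ‖LpToLpRestrictCLM Plane ℂ ℂ (boundaryMeasure Ω) 2 S τ‖ₑ * m := by
    have h4 : LpToLpRestrictCLM Plane ℂ ℂ (boundaryMeasure Ω) 2 S τ =ᵐ[ν] φ :=
      (LpToLpRestrictCLM_coeFn (𝕜 := ℂ) S τ).trans (ae_restrict_of_ae hτ)
    rw [← hν', ← eLpNorm_one_eq_lintegral_enorm, Lp.enorm_def, eLpNorm_congr_ae h4]
    exact eLpNorm_le_eLpNorm_mul_rpow_measure_univ one_le_two hφ.continuous.aestronglyMeasurable
  simp only [mem_ofPred_eq]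
  rw [h2]
  have h5 := h1.trans (mul_le_mul_right h3 2)
  rw [← ENNReal.coe_toNNReal hmt] at h5
  have h6 := ENNReal.toReal_mono (by finiteness) h5
  rw [toReal_enorm, ENNReal.toReal_mul, ENNReal.toReal_mul, toReal_enorm,
    ENNReal.coe_toReal, ENNReal.toReal_ofNat] at h6
  refine h6.trans_eq ?_
  push_cast
  ring

/-- A trace vanishing on `ΓD` vanishes almost everywhere off `ΓN`, so the bound by the boundary
values off `ΓN` is zero. -/
theorem IsBoundarySplitting.inner_planeWave_dirGrad {ΓD ΓN : Set Plane}
    (hΩ : IsBoundedLipschitzDomain Ω) (hΓ : IsBoundarySplitting Ω ΓD ΓN)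
    {Φ : Plane ≃ₗᵢ[ℝ] Plane} (hc : ((fun x => (Φ x) 0) '' ΓN).Countable) {e : Plane} (he : ‖e‖ = 1)
    (hΦ : Φ.symm !₂[0, -1] = e) (c : ℝ) {v : L2 Ω} (hv : v =ᵐ[volume.restrict Ω] planeWave e c)
    {p : L2 Ω × (Fin 2 → L2 Ω)} (hp : p ∈ sobolevH1ZeroOn Ω ΓD) :
    inner ℂ v (dirGrad p.2 e) = Complex.I * c * inner ℂ v p.1 := by
  obtain ⟨-, τ, hτ, h0⟩ := hp
  have hN := hΓ.relOpenN.measurableSet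
  obtain ⟨C, hC⟩ := exists_norm_inner_planeWave_le hΩ hN hc he hΦ c hv
  have h1 := hC _ hτ
  have h2 : LpToLpRestrictCLM Plane ℂ ℂ (boundaryMeasure Ω) 2 (frontier Ω \ ΓN) τ = 0 := by
    rw [restrict_eq_zero_iff (isClosed_frontier.measurableSet.diff hN)]
    filter_upwards [h0, hΓ.ae_mem_union] with x h3 h4 h5
    exact h3 (h4.2.resolve_right h5.2)
  rw [h2, norm_zero, mul_zero, norm_le_zero_iff, inner_sub_right, inner_smul_right] at h1
  exact sub_eq_zero.mp h1

/-- The trace of a smooth function is its restriction, by uniqueness of traces. If it vanished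
almost everywhere on `ΓD`, then `ΓD` would be a null set, contrary to its being nonempty and
relatively open. -/
theorem smoothPair_notMem_sobolevH1ZeroOn {ΓD : Set Plane} (hΩ : IsBoundedLipschitzDomain Ω)
    (hD : IsRelOpenInBoundary Ω ΓD) (hne : ΓD.Nonempty) {φ : Plane → ℂ} (hφ : ContDiff ℝ ∞ φ)
    (hc : HasCompactSupport φ) (h0 : ∀ x ∈ ΓD, φ x ≠ 0) :
    smoothPair Ω hφ hc ∉ sobolevH1ZeroOn Ω ΓD := by
  rintro ⟨-, τ, hτ, hτ0⟩
  obtain ⟨σ, hσφ, hσ⟩ := smoothPair_mem_traceGraph hΩ hφ hc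
  obtain ⟨C, hC⟩ := exists_trace_bound hΩ
  have h1 := hC _ (Submodule.sub_mem _ hτ hσ)
  rw [Prod.mk_sub_mk, sub_self, norm_zero, mul_zero, norm_le_zero_iff] at h1
  have h2 : τ = σ := sub_eq_zero.mp h1
  have h3 : boundaryMeasure Ω ΓD = 0 := by
    rw [measure_eq_zero_iff_ae_notMem]
    filter_upwards [hτ0, hσφ] with x h4 h5 hx
    rw [h2, h5] at h4
    exact h0 x hx (h4 hx)
  obtain ⟨U, hU, rfl⟩ := hD
  rw [boundaryMeasure, Measure.restrict_apply' isClosed_frontier.measurableSet, inter_assoc,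
    inter_self] at h3
  exact (hausdorffMeasure_pos_of_isOpen hΩ hU hne).ne' h3

variable {ΓD ΓN : Set Plane}

/-! ### The Neumann and the mixed form -/

/-- The form domain of the Neumann Laplacian, as a Hilbert space. -/
def NeumannSpace (Ω : Set Plane) : Type := hilbertSubspace (sobolevH1 Ω)

instance (Ω : Set Plane) : NormedAddCommGroup (NeumannSpace Ω) :=
  inferInstanceAs (NormedAddCommGroup (hilbertSubspace (sobolevH1 Ω)))

instance (Ω : Set Plane) : InnerProductSpace ℂ (NeumannSpace Ω) :=
  inferInstanceAs (InnerProductSpace ℂ (hilbertSubspace (sobolevH1 Ω)))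

/-- The isometric inclusion of the form domain of the Neumann Laplacian. -/
def neumannInclusion (Ω : Set Plane) : NeumannSpace Ω →ₗᵢ[ℂ] PairSpace Ω :=
  (hilbertSubspace (sobolevH1 Ω)).subtypeₗᵢ

/-- The embedding of the form domain of the Neumann Laplacian into `L²(Ω)`. -/
def neumannEmbedding (Ω : Set Plane) : NeumannSpace Ω →L[ℂ] L2 Ω :=
  pairFst Ω ∘L (neumannInclusion Ω).toContinuousLinearMap

theorem neumannEmbedding_apply (x : NeumannSpace Ω) :
    neumannEmbedding Ω x = (pairEquiv Ω (neumannInclusion Ω x)).1 := rfl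

/-- The form domain of the mixed Laplacian, as a subspace of that of the Neumann Laplacian. -/
def mixedSpace (Ω ΓD : Set Plane) : Submodule ℂ (NeumannSpace Ω) :=
  (hilbertSubspace (sobolevH1ZeroOn Ω ΓD)).comap (neumannInclusion Ω).toLinearMap

/-- The isometric inclusion of the form domain of the mixed Laplacian. -/
def mixedInclusion (Ω ΓD : Set Plane) : mixedSpace Ω ΓD →ₗᵢ[ℂ] PairSpace Ω :=
  (neumannInclusion Ω).comp (mixedSpace Ω ΓD).subtypeₗᵢ

theorem sobolevH1ZeroOn_le (Ω Γ : Set Plane) : sobolevH1ZeroOn Ω Γ ≤ sobolevH1 Ω :=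
  fun _ hp => hp.1

theorem neumannInclusion_mem (x : NeumannSpace Ω) :
    pairEquiv Ω (neumannInclusion Ω x) ∈ sobolevH1 Ω := Subtype.prop x

theorem mem_sobolevH1_iff_exists (p : L2 Ω × (Fin 2 → L2 Ω)) :
    p ∈ sobolevH1 Ω ↔ ∃ k, pairEquiv Ω (neumannInclusion Ω k) = p := by
  constructor
  · intro hp
    have h : pairEquiv Ω ((pairEquiv Ω).symm p) = p := (pairEquiv Ω).apply_symm_apply p
    exact ⟨(⟨(pairEquiv Ω).symm p, by rwa [mem_hilbertSubspace, h]⟩ :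
      hilbertSubspace (sobolevH1 Ω)), h⟩
  · rintro ⟨k, rfl⟩
    exact neumannInclusion_mem k

theorem mem_sobolevH1ZeroOn_iff_exists (p : L2 Ω × (Fin 2 → L2 Ω)) :
    p ∈ sobolevH1ZeroOn Ω ΓD ↔ ∃ k, pairEquiv Ω (mixedInclusion Ω ΓD k) = p := by
  constructor
  · intro hp
    obtain ⟨k, hk⟩ := (mem_sobolevH1_iff_exists p).mp hp.1
    exact ⟨⟨k, by rw [← hk] at hp; exact hp⟩, hk⟩
  · rintro ⟨k, rfl⟩
    exact k.2

theorem completeSpace_neumannSpace (Ω : Set Plane) : CompleteSpace (NeumannSpace Ω) :=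
  (isClosed_hilbertSubspace (isClosed_sobolevH1 Ω)).completeSpace_coe

theorem completeSpace_mixedSpace (hΩ : IsBoundedLipschitzDomain Ω)
    (hD : IsRelOpenInBoundary Ω ΓD) : CompleteSpace (mixedSpace Ω ΓD) := by
  have := completeSpace_neumannSpace Ω
  have h : IsClosed (mixedSpace Ω ΓD : Set (NeumannSpace Ω)) :=
    (isClosed_hilbertSubspace (isClosed_sobolevH1ZeroOn hΩ hD.measurableSet)).preimage
      (neumannInclusion Ω).continuous
  exact h.completeSpace_coe

theorem isEigenvalueSequence_neumannLaplacian_iff (hΩ : IsBoundedLipschitzDomain Ω) (s : ℕ → ℝ) :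
    IsEigenvalueSequence (neumannLaplacian Ω) s ↔ IsFormEigSeq (neumannEmbedding Ω) s :=
  isEigenvalueSequence_iff hΩ.isOpen (neumannInclusion Ω) mem_sobolevH1_iff_exists le_rfl
    (fun _ _ => smoothPair_mem_sobolevH1 _ _) s

theorem isEigenvalueSequence_mixedLaplacian_iff (hΩ : IsBoundedLipschitzDomain Ω)
    (hΓ : IsBoundarySplitting Ω ΓD ΓN) (s : ℕ → ℝ) :
    IsEigenvalueSequence (mixedLaplacian Ω ΓD ΓN) s ↔
      IsFormEigSeq (neumannEmbedding Ω ∘L (mixedSpace Ω ΓD).subtypeL) s := by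
  rw [mixedLaplacian, hΓ.sobolevH1ZeroOn_eq]
  exact isEigenvalueSequence_iff hΩ.isOpen (mixedInclusion Ω ΓD) mem_sobolevH1ZeroOn_iff_exists
    (sobolevH1ZeroOn_le Ω ΓD) (fun _ hφ => hφ.smoothPair_mem_sobolevH1ZeroOn hΩ ΓD) s

theorem isCompactOperator_neumannEmbedding (hΩ : IsBoundedLipschitzDomain Ω) :
    IsCompactOperator (neumannEmbedding Ω) :=
  isCompactOperator_pairFst_comp hΩ _ neumannInclusion_mem

theorem injective_neumannEmbedding (hΩ : IsBoundedLipschitzDomain Ω) :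
    Function.Injective (neumannEmbedding Ω) :=
  injective_pairFst_comp hΩ.isOpen _ neumannInclusion_mem

theorem exists_isEigenvalueSequence_neumannLaplacian (hΩ : IsBoundedLipschitzDomain Ω) :
    ∃ μ, IsEigenvalueSequence (neumannLaplacian Ω) μ := by
  have := completeSpace_neumannSpace Ω
  simp_rw [isEigenvalueSequence_neumannLaplacian_iff hΩ]
  exact exists_isFormEigSeq (isCompactOperator_neumannEmbedding hΩ) (injective_neumannEmbedding hΩ)
    (not_finiteDimensional_of_smoothPair_mem hΩ.isOpen hΩ.isConnected.nonempty
      (neumannInclusion Ω) fun _ _ =>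
        (mem_sobolevH1_iff_exists _).mp (smoothPair_mem_sobolevH1 _ _))

theorem exists_isEigenvalueSequence_mixedLaplacian (hΩ : IsBoundedLipschitzDomain Ω)
    (hΓ : IsBoundarySplitting Ω ΓD ΓN) :
    ∃ lam, IsEigenvalueSequence (mixedLaplacian Ω ΓD ΓN) lam := by
  have := completeSpace_mixedSpace hΩ hΓ.relOpenD
  simp_rw [isEigenvalueSequence_mixedLaplacian_iff hΩ hΓ]
  exact exists_isFormEigSeq ((isCompactOperator_neumannEmbedding hΩ).comp_clm _)
    ((injective_neumannEmbedding hΩ).comp Subtype.val_injective)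
    (not_finiteDimensional_of_smoothPair_mem hΩ.isOpen hΩ.isConnected.nonempty
      (mixedInclusion Ω ΓD) fun _ hφ =>
        (mem_sobolevH1ZeroOn_iff_exists _).mp (hφ.smoothPair_mem_sobolevH1ZeroOn hΩ ΓD))

/-- The embedding into `L²(Ω)` is a contraction. Nonnegativity is what permits a real wave number
`√t`. -/
theorem nonneg_of_mem_formEig {t : ℝ} (K : Submodule ℂ (NeumannSpace Ω)) {x : K} (hx0 : ‖x‖ = 1)
    (hx : x ∈ formEig (neumannEmbedding Ω ∘L K.subtypeL) t) : 0 ≤ t := by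
  have h1 := norm_sq_of_mem_formEig hx
  have h2 : ‖(neumannEmbedding Ω ∘L K.subtypeL) x‖ ≤ ‖x‖ :=
    by
    have h := norm_fst_le_norm (neumannInclusion Ω x)
    rwa [LinearIsometry.norm_map] at h
  rw [hx0] at h1 h2
  by_contra! ht
  have h3 : ‖(neumannEmbedding Ω ∘L K.subtypeL) x‖ ^ 2 ≤ 1 := by
    rw [← one_pow 2]
    gcongr
  have h4 := sq_nonneg ‖(neumannEmbedding Ω ∘L K.subtypeL) x‖
  generalize ‖(neumannEmbedding Ω ∘L K.subtypeL) x‖ ^ 2 = a at h1 h3 h4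
  have h5 : a = 1 + -t * a := by linear_combination -h1
  have h6 : 1 ≤ a := by linarith [mul_nonneg (neg_nonneg.mpr ht.le) h4]
  linarith [mul_pos (neg_pos.mpr ht) (zero_lt_one.trans_le h6)]

/-- A plane wave whose wave vector is parallel to the Neumann part of the boundary, as a trial
function for the Neumann Laplacian. -/
theorem exists_trial_function (hΩ : IsBoundedLipschitzDomain Ω) (hΓ : IsBoundarySplitting Ω ΓD ΓN)
    (hpar : ContainedInParallelSegments ΓN) {t : ℝ} (ht : 0 ≤ t) :
    ∃ v : NeumannSpace Ω, v ∉ mixedSpace Ω ΓD ∧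
      (∀ u ∈ mixedSpace Ω ΓD, inner ℂ u v =
        ((t : ℂ) + 1) * inner ℂ (neumannEmbedding Ω u) (neumannEmbedding Ω v)) ∧
      ‖v‖ ^ 2 = (t + 1) * ‖neumannEmbedding Ω v‖ ^ 2 := by
  obtain ⟨e, he, hcount⟩ := countable_image_of_parallel hpar
  obtain ⟨Φ, hΦ⟩ := exists_isometry_symm_down he
  set c := Real.sqrt t with hc
  have hct : c ^ 2 = t := Real.sq_sqrt ht
  obtain ⟨φ, hφ, hφc, hφv⟩ := exists_cutoff_planeWave hΩ.isBounded e c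
  set T := smoothPair Ω hφ hφc with hT
  have hmem : ∀ᵐ x ∂(volume.restrict Ω), x ∈ Ω := ae_restrict_mem hΩ.isOpen.measurableSet
  have hT1 : T.1 =ᵐ[volume.restrict Ω] planeWave e c := by
    filter_upwards [smoothPair_fst_ae hφ hφc, hmem] with x h1 h2
    rw [hT, h1, (hφv x (subset_closure h2)).1]
  -- The gradient of the wave is the constant vector `i c e` times the wave.
  have hT2 : ∀ i, T.2 i = (Complex.I * c * (e i : ℝ)) • T.1 := fun i => by
    refine Lp.ext ?_
    filter_upwards [smoothPair_snd_ae hφ hφc i, hmem, hT1,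
      Lp.coeFn_smul (Complex.I * c * (e i : ℝ)) T.1] with x h1 h2 h3 h4
    rw [h4, Pi.smul_apply, h3, hT, h1, partialDeriv, (hφv x (subset_closure h2)).2,
      fderiv_planeWave, EuclideanSpace.inner_single_right]
    simp
  have hsum : e 0 ^ 2 + e 1 ^ 2 = 1 := by
    have h := EuclideanSpace.norm_sq_eq e
    rw [he, Fin.sum_univ_two, Real.norm_eq_abs, Real.norm_eq_abs, sq_abs, sq_abs] at h
    linarith
  obtain ⟨v, hv⟩ := (mem_sobolevH1_iff_exists T).mp (smoothPair_mem_sobolevH1 hφ hφc)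
  refine ⟨v, ?_, fun u hu => ?_, ?_⟩
  · intro h
    have h1 : T ∈ sobolevH1ZeroOn Ω ΓD := by
      rw [← hv]
      exact h
    refine smoothPair_notMem_sobolevH1ZeroOn hΩ hΓ.relOpenD hΓ.nonemptyD hφ hφc (fun x hx => ?_) h1
    obtain ⟨U, -, hU⟩ := hΓ.relOpenD
    rw [hU] at hx
    rw [(hφv x (frontier_subset_closure hx.2)).1]
    exact Complex.exp_ne_zero _
  · have h1 := hΓ.inner_planeWave_dirGrad hΩ (hcount Φ hΦ) he hΦ c hT1
      (show pairEquiv Ω (neumannInclusion Ω u) ∈ sobolevH1ZeroOn Ω ΓD from hu)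
    have h2 := congrArg (starRingEnd ℂ) h1
    rw [dirGrad, inner_add_right, inner_smul_right, inner_smul_right] at h2
    simp only [map_add, map_mul, inner_conj_symm, Complex.conj_ofReal, Complex.conj_I] at h2
    rw [neumannEmbedding_apply, neumannEmbedding_apply, ← (neumannInclusion Ω).inner_map_map]
    have h3 : (c : ℂ) ^ 2 = t := by exact_mod_cast hct
    rw [inner_pairSpace, hv, Fin.sum_univ_two, hT2, hT2, inner_smul_right, inner_smul_right, ← h3]
    -- The gradient part is `i c ⟪∂ₑ u, v⟫`, and the conjugated boundary identity gives `⟪∂ₑ u, v⟫ =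
    -- -i c ⟪u, v⟫`; the product of the two factors is `c² = t`.
    linear_combination (Complex.I * c) * h2 - (c : ℂ) ^ 2 *
      inner ℂ (pairEquiv Ω (neumannInclusion Ω u)).1 T.1 * Complex.I_sq
  · rw [neumannEmbedding_apply, ← (neumannInclusion Ω).norm_map]
    rw [norm_sq_pairSpace, hv, Fin.sum_univ_two, hT2, hT2, norm_smul, norm_smul, norm_mul, norm_mul,
      norm_mul, Complex.norm_I, Complex.norm_real, Complex.norm_real, Complex.norm_real,
      Real.norm_eq_abs, Real.norm_eq_abs, Real.norm_eq_abs]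
    simp only [mul_pow, sq_abs, one_mul, Complex.norm_I, norm_mul, Complex.norm_real,
      Real.norm_eq_abs]
    rw [hct]
    linear_combination t * ‖T.1‖ ^ 2 * hsum

end MixedLaplacian

end

/-- The sequences are indexed from `0`, so that `μ k` is the eigenvalue number `k + 1`. -/
theorem corollary3p2 (Ω ΓD ΓN : Set MixedLaplacian.Plane)
    (hΩ : MixedLaplacian.IsBoundedLipschitzDomain Ω)
    (hΓ : MixedLaplacian.IsBoundarySplitting Ω ΓD ΓN)
    (hpar : MixedLaplacian.ContainedInParallelSegments ΓN) :
    (∃ μ : ℕ → ℝ,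
      MixedLaplacian.IsEigenvalueSequence (MixedLaplacian.neumannLaplacian Ω) μ) ∧
    (∃ lam : ℕ → ℝ,
      MixedLaplacian.IsEigenvalueSequence (MixedLaplacian.mixedLaplacian Ω ΓD ΓN) lam) ∧
    ∀ μ lam : ℕ → ℝ,
      MixedLaplacian.IsEigenvalueSequence (MixedLaplacian.neumannLaplacian Ω) μ →
      MixedLaplacian.IsEigenvalueSequence (MixedLaplacian.mixedLaplacian Ω ΓD ΓN) lam →
      ∀ k : ℕ, μ (k + 1) ≤ lam k := by
  refine ⟨MixedLaplacian.exists_isEigenvalueSequence_neumannLaplacian hΩ,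
    MixedLaplacian.exists_isEigenvalueSequence_mixedLaplacian hΩ hΓ, fun μ lam hμ hlam k => ?_⟩
  rw [MixedLaplacian.isEigenvalueSequence_neumannLaplacian_iff hΩ] at hμ
  rw [MixedLaplacian.isEigenvalueSequence_mixedLaplacian_iff hΩ hΓ] at hlam
  have hJ := MixedLaplacian.isCompactOperator_neumannEmbedding hΩ
  have := MixedLaplacian.completeSpace_neumannSpace Ω
  have := MixedLaplacian.completeSpace_mixedSpace hΩ hΓ.relOpenD
  -- A normalized eigenvector for `lam k` is needed only to know that `lam k` is nonnegative.
  obtain ⟨x, hx, hxs, -⟩ := hlam.exists_orthonormal (hJ.comp_clm _)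
  obtain ⟨v, hv, h1, h2⟩ := MixedLaplacian.exists_trial_function hΩ hΓ hpar
    (MixedLaplacian.nonneg_of_mem_formEig _ (hx.1 k) (hxs k))
  exact MixedLaplacian.IsFormEigSeq.le_of_trial hJ
    (MixedLaplacian.injective_neumannEmbedding hΩ) _ hμ hlam k hv h1 h2
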